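/- Let $m,n\ge 0$ be integers, not both zero. All vector spaces are over $\mathbb C$, and all modules over Lie superalgebras are $\mathbb Z_2$-graded; a module is simple if it is nonzero and has no graded submodules other than $0$ and itself. Let $A=A_{m,n}=\mathbb C[t_1^{\pm1},\dots,t_m^{\pm1}]\otimes\Lambda(\xi_1,\dots,\xi_n)$ be the superalgebra with even variables $t_i$ and odd variables $\xi_j$, let $W=W_{m,n}$ be the Lie superalgebra of superderivations of $A$, and put $d_i=t_i\frac{\partial}{\partial t_i}\in W$. Let $\tilde W=W\ltimes A$ be the Lie superalgebra containing $W$ as a subalgebra, with $[x,a]=-(-1)^{|x||a|}[a,x]=x(a)$ and $[a,a']=0$ for $x\in W$, $a,a'\in A$. An $AW_{m,n}$-module is a $\tilde W$-module $M$ on which $A$ acts associatively: $a\cdot(a'\cdot v)=(aa')\cdot v$ and $1\cdot v=v$ for $a,a'\in A$, $v\in M$. It is called cuspidal if $M=\bigoplus_{\mu\in\mathbb C^m}M_\mu$, where $M_\mu=\{v\in M: d_iv=\mu_iv,\ i=1,\dots,m\}$, and there is a positive integer $N$ with $\dim M_\mu<N$ for all $\mu$. For $\lambda\in\mathbb C^m$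 and a module $V$ over the general linear Lie superalgebra $\mathfrak{gl}(m,n)$ with matrix units $E_{r,s}$, the tensor module $\Gamma(\lambda,V)$ is the $AW_{m,n}$-module with underlying superspace $A\otimes V$ and actions, for homogeneous $x,y\in A$ and $v\in V$, $$xd_i\cdot(y\otimes v)=\sum_{s=1}^n(-1)^{|x|-1+|y|}\frac{\partial x}{\partial\xi_s}y\otimes E_{m+s,i}v+\sum_{s=1}^m d_s(x)y\otimes E_{s,i}v+x(d_i(y)+\lambda_iy)\otimes v,$$ $$x\frac{\partial}{\partial\xi_j}\cdot(y\otimes v)=\sum_{s=1}^n(-1)^{|x|-1}\frac{\partial x}{\partial\xi_s}y\otimes E_{m+s,m+j}v+\sum_{s=1}^m(-1)^{|y|}d_s(x)y\otimes E_{s,m+j}v+x\frac{\partial y}{\partial\xi_j}\otimes v,$$ $$x\cdot(y\otimes v)=xy\otimes v.$$ Then for every simple cuspidal $AW_{m,n}$-module $M$ there exist a finite-dimensional simple $\mathfrak{gl}(m,n)$-module $V$ and $\lambda\in\mathbb C^m$ such that $M\cong\Gamma(\lambda,V)$ as $AW_{m,n}$-modules, by a parity-preserving isomorphism. -/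

import Mathlib

open scoped TensorProduct

noncomputable section

namespace WittSuper

/-- The Koszul sign `(-1)^{pq}`. -/
def sgn (p q : ZMod 2) : ℂ := (-1) ^ (p.val * q.val)

/-- Laurent polynomials in `m` even variables: `single α 1` is `t^α`. -/
abbrev Laurent (m : ℕ) : Type := AddMonoidAlgebra ℂ (Fin m → ℤ)

/-- The exterior algebra in `n` odd variables. -/
abbrev Grassmann (n : ℕ) : Type := ExteriorAlgebra ℂ (Fin n → ℂ)

/-- The superalgebra `A_{m,n}`, the tensor product of the Laurent polynomial algebra in `m` even
variables and the exterior algebra in `n` odd variables. As the Laurent polynomials are purely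
even, the tensor product of superalgebras has the ordinary multiplication. -/
def A (m n : ℕ) : Type := Laurent m ⊗[ℂ] Grassmann n

instance (m n : ℕ) : Ring (A m n) := inferInstanceAs (Ring (Laurent m ⊗[ℂ] Grassmann n))

instance (m n : ℕ) : Algebra ℂ (A m n) :=
  inferInstanceAs (Algebra ℂ (Laurent m ⊗[ℂ] Grassmann n))

/-- The element `f w` of `A_{m,n}`, for a Laurent polynomial `f` and `w` in the exterior
algebra. -/
def mk {m n : ℕ} : Laurent m →ₗ[ℂ] Grassmann n →ₗ[ℂ] A m n :=
  TensorProduct.mk ℂ (Laurent m) (Grassmann n)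

/-- The homogeneous components of `A_{m,n}`. -/
def grA (m n : ℕ) (p : ZMod 2) : Submodule ℂ (A m n) :=
  Submodule.span ℂ {z | ∃ (f : Laurent m) (w : Grassmann n),
    w ∈ CliffordAlgebra.evenOdd (0 : QuadraticForm ℂ (Fin n → ℂ)) p ∧ z = mk f w}

/-- The monomial `t^α`. -/
def tpow {m n : ℕ} (α : Fin m → ℤ) : A m n := mk (AddMonoidAlgebra.single α 1) 1

/-- The odd variable `ξ_j`. -/
def xi {m n : ℕ} (j : Fin n) : A m n := mk 1 (ExteriorAlgebra.ι ℂ (Pi.single j 1))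

/-- The Euler operator `t_i ∂/∂t_i` on Laurent polynomials, `t^α ↦ α_i t^α`. -/
def euler {m : ℕ} (i : Fin m) : Laurent m →ₗ[ℂ] Laurent m :=
  Finsupp.lsum ℂ (fun α : Fin m → ℤ => ((α i : ℤ) : ℂ) • AddMonoidAlgebra.lsingle α) ∘ₗ
    (AddMonoidAlgebra.coeffLinearEquiv ℂ).toLinearMap

/-- The index set of the basis `d_1, …, d_m, ∂/∂ξ_1, …, ∂/∂ξ_n` of `Δ`, and of the rows
and columns of `gl(m,n)`. -/
abbrev Ix (m n : ℕ) : Type := Fin m ⊕ Fin n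

/-- The parity of an index. -/
def par {m n : ℕ} : Ix m n → ZMod 2 := Sum.elim (fun _ => 0) (fun _ => 1)

/-- The linear operator `f w ↦ g(f) h(w)` on `A_{m,n}`. -/
def mapA {m n : ℕ} (g : Laurent m →ₗ[ℂ] Laurent m) (h : Grassmann n →ₗ[ℂ] Grassmann n) :
    Module.End ℂ (A m n) :=
  TensorProduct.map g h

/-- The operators `d_i = t_i ∂/∂t_i` and `∂/∂ξ_j` on `A_{m,n}`. -/
def del {m n : ℕ} : Ix m n → Module.End ℂ (A m n) :=
  Sum.elim (fun i => mapA (euler i) LinearMap.id)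
    (fun j => mapA LinearMap.id
      (CliffordAlgebra.contractLeft (Q := (0 : QuadraticForm ℂ (Fin n → ℂ)))
        (LinearMap.proj j : (Fin n → ℂ) →ₗ[ℂ] ℂ)))

/-- The parity automorphism `a ↦ (-1)^{|a|} a` of `A_{m,n}`. -/
def parity (m n : ℕ) : A m n →ₐ[ℂ] A m n :=
  Algebra.TensorProduct.map (AlgHom.id ℂ (Laurent m))
    (CliffordAlgebra.involute (Q := (0 : QuadraticForm ℂ (Fin n → ℂ))))

/-- The automorphism `a ↦ (-1)^{p|a|} a` of `A_{m,n}`. -/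
def sig {m n : ℕ} (p : ZMod 2) : A m n →ₐ[ℂ] A m n :=
  if p = 0 then AlgHom.id ℂ _ else parity m n

/-- The space of superderivations of `A_{m,n}` of parity `p`. This is the component of parity `p`
of the Witt superalgebra `W_{m,n}`, which is the direct sum `superDer m n 0 ⊕ superDer m n 1`. -/
def superDer (m n : ℕ) (p : ZMod 2) : Submodule ℂ (Module.End ℂ (A m n)) where
  carrier := {D | (∀ i, ∀ a ∈ grA m n i, D a ∈ grA m n (p + i)) ∧
    ∀ i, ∀ a ∈ grA m n i, ∀ b, D (a * b) = D a * b + sgn p i • (a * D b)}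
  zero_mem' := by simp
  add_mem' := by
    rintro D E ⟨h1, h2⟩ ⟨h3, h4⟩
    refine ⟨fun i a ha => add_mem (h1 i a ha) (h3 i a ha), fun i a ha b => ?_⟩
    simp only [LinearMap.add_apply, h2 i a ha, h4 i a ha, add_mul, mul_add, smul_add]
    abel
  smul_mem' := by
    rintro c D ⟨h1, h2⟩
    refine ⟨fun i a ha => Submodule.smul_mem _ _ (h1 i a ha), fun i a ha b => ?_⟩
    simp only [LinearMap.smul_apply, h2 i a ha, smul_add, smul_mul_assoc, mul_smul_comm,
      smul_comm c]

/-! ### signs -/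

theorem zmod2 (p : ZMod 2) : p = 0 ∨ p = 1 := by
  revert p; decide

theorem one_add_one : (1 + 1 : ZMod 2) = 0 := rfl

theorem sgn_zero_left (p) : sgn 0 p = 1 := by simp [sgn]
theorem sgn_zero_right (p) : sgn p 0 = 1 := by simp [sgn]
theorem sgn_one_one : sgn 1 1 = -1 := by simp [sgn, ZMod.val_one]
theorem sgn_comm (p q) : sgn p q = sgn q p := by simp [sgn, mul_comm]
theorem sgn_add_left (p q r) : sgn (p + q) r = sgn p r * sgn q r := by
  rcases zmod2 p with rfl | rfl <;> rcases zmod2 q with rfl | rfl <;> rcases zmod2 r with rfl | rfl <;>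
    simp [sgn_zero_left, sgn_zero_right, sgn_one_one, one_add_one]
theorem sgn_add_right (p q r) : sgn p (q + r) = sgn p q * sgn p r := by
  rw [sgn_comm, sgn_add_left, sgn_comm q, sgn_comm r]
theorem sgn_mul_self (p q) : sgn p q * sgn p q = 1 := by
  rcases zmod2 p with rfl | rfl <;> rcases zmod2 q with rfl | rfl <;>
    simp [sgn_zero_left, sgn_zero_right, sgn_one_one]

/-! ### the grading of `A_{m,n}` -/

section
variable {m n : ℕ}

theorem A_tmul_induction {P : A m n → Prop} (zero : P 0) (mk : ∀ f w, P (mk f w))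
    (add : ∀ x y, P x → P y → P (x + y)) (a : A m n) : P a :=
  TensorProduct.induction_on (motive := P) a zero mk add

theorem mk_mul_mk (f g : Laurent m) (v w : Grassmann n) :
    (mk f v * mk g w : A m n) = mk (f * g) (v * w) :=
  Algebra.TensorProduct.tmul_mul_tmul _ _ _ _

theorem mk_one_one : (mk 1 1 : A m n) = 1 := rfl

theorem parity_mk (f : Laurent m) (w : Grassmann n) :
    parity m n (mk f w) = mk f (CliffordAlgebra.involute w) := rfl

theorem parity_parity (a : A m n) : parity m n (parity m n a) = a := by
  induction a using A_tmul_induction with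
  | zero => simp
  | mk f w => simp [parity_mk, CliffordAlgebra.involute_involute]
  | add x y hx hy => simp only [map_add, hx, hy]

theorem parity_of_mem {p : ZMod 2} {a : A m n} (ha : a ∈ grA m n p) :
    parity m n a = sgn 1 p • a := by
  induction ha using Submodule.span_induction with
  | mem x h =>
    obtain ⟨f, w, hw, rfl⟩ := h
    rcases zmod2 p with rfl | rfl
    · simp [parity_mk, CliffordAlgebra.involute_eq_of_mem_even hw, sgn_zero_right]
    · rw [parity_mk, CliffordAlgebra.involute_eq_of_mem_odd hw, sgn_one_one,
        map_neg, neg_one_smul]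
  | zero => simp
  | add x y _ _ hx hy => simp only [map_add, hx, hy, smul_add]
  | smul c x _ hx => simp only [map_smul, hx, smul_comm c]

theorem exists_add (a : A m n) : ∃ x ∈ grA m n 0, ∃ y ∈ grA m n 1, a = x + y := by
  induction a using A_tmul_induction with
  | zero => exact ⟨0, zero_mem _, 0, zero_mem _, by simp⟩
  | mk f w =>
    have hw : w ∈ CliffordAlgebra.evenOdd (0 : QuadraticForm ℂ (Fin n → ℂ)) 0 ⊔
        CliffordAlgebra.evenOdd (0 : QuadraticForm ℂ (Fin n → ℂ)) 1 := by
      rw [(CliffordAlgebra.evenOdd_isCompl _).sup_eq_top]; trivial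
    obtain ⟨u, hu, v, hv, rfl⟩ := Submodule.mem_sup.1 hw
    exact ⟨mk f u, Submodule.subset_span ⟨f, u, hu, rfl⟩, mk f v,
      Submodule.subset_span ⟨f, v, hv, rfl⟩, map_add _ _ _⟩
  | add x y hx hy =>
    obtain ⟨a, ha, b, hb, rfl⟩ := hx
    obtain ⟨c, hc, d, hd, rfl⟩ := hy
    exact ⟨a + c, add_mem ha hc, b + d, add_mem hb hd, by abel⟩

theorem neg_eq_self {V : Type*} [AddCommGroup V] [Module ℂ V] {x : V} (h : x = -x) : x = 0 := by
  have h2 : (2 : ℂ) • x = 0 := by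
    rw [two_smul]; nth_rewrite 1 [h]; simp
  simpa using h2

theorem mem_grA_iff {p : ZMod 2} {a : A m n} : a ∈ grA m n p ↔ parity m n a = sgn 1 p • a := by
  refine ⟨parity_of_mem, fun h => ?_⟩
  obtain ⟨x, hx, y, hy, rfl⟩ := exists_add a
  rw [map_add, parity_of_mem hx, parity_of_mem hy] at h
  rcases zmod2 p with rfl | rfl
  · rw [sgn_zero_right, sgn_one_one, one_smul, one_smul, neg_one_smul, add_right_inj] at h
    have hy0 : y = 0 := neg_eq_self h.symm
    simpa [hy0] using hx
  · rw [sgn_zero_right, sgn_one_one, one_smul, neg_one_smul, neg_one_smul, neg_add,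
      add_left_inj] at h
    have hx0 : x = 0 := neg_eq_self h
    simpa [hx0] using hy

theorem sig_of_mem (p : ZMod 2) {q : ZMod 2} {a : A m n} (ha : a ∈ grA m n q) :
    sig p a = sgn p q • a := by
  rcases zmod2 p with rfl | rfl
  · simp [sig, sgn_zero_left]
  · simp [sig, parity_of_mem ha]

theorem sig_sig (p q : ZMod 2) (a : A m n) : sig p (sig q a) = sig (p + q) a := by
  rcases zmod2 p with rfl | rfl <;> rcases zmod2 q with rfl | rfl <;>
    simp [sig, parity_parity, one_add_one]

theorem grA_mul {p q : ZMod 2} {a b : A m n} (ha : a ∈ grA m n p) (hb : b ∈ grA m n q) :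
    a * b ∈ grA m n (p + q) := by
  rw [mem_grA_iff, map_mul, parity_of_mem ha, parity_of_mem hb, sgn_add_right, smul_mul_smul_comm]

theorem grA_ext {V : Type*} [AddCommGroup V] [Module ℂ V] {f g : A m n →ₗ[ℂ] V}
    (h : ∀ q, ∀ a ∈ grA m n q, f a = g a) : f = g := by
  refine LinearMap.ext fun a => ?_
  obtain ⟨x, hx, y, hy, rfl⟩ := exists_add a
  rw [map_add, map_add, h 0 x hx, h 1 y hy]

theorem tpow_mem (α : Fin m → ℤ) : (tpow α : A m n) ∈ grA m n 0 := by
  rw [mem_grA_iff]; simp [tpow, parity_mk, sgn_zero_right]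

theorem xi_mem (j : Fin n) : (xi j : A m n) ∈ grA m n 1 := by
  rw [mem_grA_iff]
  simp only [xi, parity_mk, sgn_one_one]
  rw [ExteriorAlgebra.ι, CliffordAlgebra.involute_ι, map_neg, neg_one_smul]

theorem tpow_add (α β : Fin m → ℤ) : (tpow (α + β) : A m n) = tpow α * tpow β := by
  simp [tpow, mk_mul_mk, AddMonoidAlgebra.single_mul_single]

theorem tpow_zero : (tpow 0 : A m n) = 1 := by
  simp only [tpow]; rfl

/-- Induction on `A_{m,n}` along the generators. -/
theorem A_induction {P : A m n → Prop} (h1 : P 1) (ht : ∀ α, P (tpow α)) (hx : ∀ j, P (xi j))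
    (hadd : ∀ a b, P a → P b → P (a + b)) (hmul : ∀ a b, P a → P b → P (a * b))
    (hs : ∀ (c : ℂ) a, P a → P (c • a)) (a : A m n) : P a := by
  have h0 : P 0 := by simpa using hs 0 _ h1
  have hl : ∀ f : Laurent m, P (mk f 1) := by
    intro f
    induction f using AddMonoidAlgebra.induction_on with
    | of g => exact ht _
    | add f g hf hg => rw [map_add, LinearMap.add_apply]; exact hadd _ _ hf hg
    | smul c f hf => rw [map_smul, LinearMap.smul_apply]; exact hs _ _ hf
  have hr : ∀ w : Grassmann n, P (mk 1 w) := by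
    intro w
    induction w using CliffordAlgebra.induction with
    | algebraMap r =>
      rw [Algebra.algebraMap_eq_smul_one, map_smul]; exact hs _ _ h1
    | ι x =>
      have : mk (1 : Laurent m) (CliffordAlgebra.ι (0 : QuadraticForm ℂ (Fin n → ℂ)) x) =
          ∑ j, x j • (xi j : A m n) := by
        conv_lhs => rw [← Finset.univ_sum_single x]
        simp only [map_sum, xi]
        refine Finset.sum_congr rfl fun j _ => ?_
        rw [← map_smul, ← map_smul]
        congr 2
        ext k; simp [Pi.single_apply]
      rw [this]
      exact Finset.sum_induction _ _ hadd h0 fun j _ => hs _ _ (hx j)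
    | mul a b ha hb =>
      have h := hmul _ _ ha hb
      rw [mk_mul_mk, mul_one] at h
      exact h
    | add a b ha hb => rw [map_add]; exact hadd _ _ ha hb
  induction a using A_tmul_induction with
  | zero => exact h0
  | mk f w => simpa [mk_mul_mk] using hmul _ _ (hl f) (hr w)
  | add x y hx hy => exact hadd _ _ hx hy

theorem tpow_comm (α : Fin m → ℤ) (y : A m n) : y * tpow α = tpow α * y := by
  induction y using A_tmul_induction with
  | zero => simp
  | mk f w => simp [tpow, mk_mul_mk, mul_comm]
  | add x y hx hy => simp only [add_mul, mul_add, hx, hy]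

theorem xi_mul_xi (j k : Fin n) : (xi j * xi k : A m n) = - (xi k * xi j) := by
  simp only [xi, mk_mul_mk, mul_one]
  rw [← map_neg, eq_neg_of_add_eq_zero_left (ExteriorAlgebra.ι_add_mul_swap _ _)]

theorem mul_xi (j : Fin n) (y : A m n) : y * xi j = xi j * parity m n y := by
  induction y using A_induction with
  | h1 => simp
  | ht α => rw [parity_of_mem (tpow_mem α), sgn_zero_right, one_smul, tpow_comm]
  | hx k => rw [parity_of_mem (xi_mem k), sgn_one_one, neg_one_smul, mul_neg, xi_mul_xi]
  | hadd a b ha hb => rw [add_mul, ha, hb, map_add, mul_add]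
  | hmul a b ha hb => rw [mul_assoc, hb, ← mul_assoc, ha, map_mul, mul_assoc]
  | hs c a ha => rw [smul_mul_assoc, ha, map_smul, mul_smul_comm]

/-- `A_{m,n}` is supercommutative. -/
theorem supercomm {q : ZMod 2} {y : A m n} (hy : y ∈ grA m n q) (x : A m n) :
    y * x = sig q x * y := by
  induction x using A_induction with
  | h1 => simp
  | ht α => rw [sig_of_mem q (tpow_mem α), sgn_zero_right, one_smul, tpow_comm]
  | hx k => rw [sig_of_mem q (xi_mem k), mul_xi, parity_of_mem hy, smul_mul_assoc,
      mul_smul_comm, sgn_comm]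
  | hadd a b ha hb => rw [mul_add, ha, hb, map_add, add_mul]
  | hmul a b ha hb => rw [← mul_assoc, ha, mul_assoc, hb, map_mul, mul_assoc]
  | hs c a ha => rw [mul_smul_comm, ha, map_smul, smul_mul_assoc]

/-! ### superderivations -/

theorem superDer_sig {p : ZMod 2} {D : Module.End ℂ (A m n)} (hD : D ∈ superDer m n p)
    (r : ZMod 2) (a : A m n) : sig r (D a) = sgn r p • D (sig r a) := by
  have : (sig r).toLinearMap ∘ₗ D = sgn r p • (D ∘ₗ (sig r).toLinearMap) := by
    refine grA_ext fun q a ha => ?_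
    simp only [LinearMap.comp_apply, AlgHom.toLinearMap_apply, LinearMap.smul_apply]
    rw [sig_of_mem r ha, sig_of_mem r (hD.1 q a ha), map_smul, smul_smul, sgn_add_right]
  exact LinearMap.congr_fun this a

theorem superDer_mul {p : ZMod 2} {D : Module.End ℂ (A m n)} (hD : D ∈ superDer m n p)
    (a b : A m n) : D (a * b) = D a * b + sig p a * D b := by
  have : D ∘ₗ LinearMap.mulRight ℂ b = LinearMap.mulRight ℂ b ∘ₗ D +
      LinearMap.mulRight ℂ (D b) ∘ₗ (sig p).toLinearMap := by
    refine grA_ext fun q a ha => ?_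
    simp only [LinearMap.comp_apply, AlgHom.toLinearMap_apply, LinearMap.add_apply,
      LinearMap.mulRight_apply]
    rw [sig_of_mem p ha, hD.2 q a ha, smul_mul_assoc]
  exact LinearMap.congr_fun this a

theorem mem_superDer {p : ZMod 2} {D : Module.End ℂ (A m n)}
    (h1 : ∀ a, parity m n (D a) = sgn 1 p • D (parity m n a))
    (h2 : ∀ a b, D (a * b) = D a * b + sig p a * D b) : D ∈ superDer m n p := by
  refine ⟨fun i a ha => ?_, fun i a ha b => ?_⟩
  · rw [mem_grA_iff, h1, parity_of_mem ha, map_smul, smul_smul, sgn_add_right]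
  · rw [h2, sig_of_mem p ha, smul_mul_assoc]

theorem superDer_one {p : ZMod 2} {D : Module.End ℂ (A m n)} (hD : D ∈ superDer m n p) :
    D 1 = 0 := by
  have h := superDer_mul hD 1 1
  simpa using h

theorem mapA_mk (g : Laurent m →ₗ[ℂ] Laurent m) (h : Grassmann n →ₗ[ℂ] Grassmann n)
    (f : Laurent m) (w : Grassmann n) : mapA g h (mk f w) = mk (g f) (h w) := rfl

theorem euler_single (i : Fin m) (α : Fin m → ℤ) (c : ℂ) :
    euler i (AddMonoidAlgebra.single α c) = ((α i : ℤ) : ℂ) • AddMonoidAlgebra.single α c := by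
  simp [euler]

theorem euler_mul (i : Fin m) (f g : Laurent m) :
    euler i (f * g) = euler i f * g + f * euler i g := by
  induction f using AddMonoidAlgebra.induction_linear with
  | zero => simp
  | add f f' hf hf' => simp only [add_mul, map_add, hf, hf']; abel
  | single α c =>
    induction g using AddMonoidAlgebra.induction_linear with
    | zero => simp
    | add f f' hf hf' => simp only [mul_add, map_add, hf, hf']; abel
    | single β d =>
      rw [AddMonoidAlgebra.single_mul_single, euler_single, euler_single, euler_single,
        smul_mul_assoc, mul_smul_comm, AddMonoidAlgebra.single_mul_single, ← add_smul]
      simp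

theorem contract_involute (f : Module.Dual ℂ (Fin n → ℂ)) (w : Grassmann n) :
    CliffordAlgebra.involute (CliffordAlgebra.contractLeft f w) =
      - CliffordAlgebra.contractLeft f (CliffordAlgebra.involute w) := by
  induction w using CliffordAlgebra.left_induction with
  | algebraMap r => simp
  | add x y hx hy => simp only [map_add, hx, hy]; abel
  | ι_mul x v hx =>
    simp only [CliffordAlgebra.contractLeft_ι_mul, map_mul, map_sub, map_smul, hx,
      CliffordAlgebra.involute_ι, neg_mul, map_neg]
    simp

theorem contract_mul (f : Module.Dual ℂ (Fin n → ℂ)) (v w : Grassmann n) :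
    CliffordAlgebra.contractLeft f (v * w) = CliffordAlgebra.contractLeft f v * w +
      CliffordAlgebra.involute v * CliffordAlgebra.contractLeft f w := by
  induction v using CliffordAlgebra.left_induction with
  | algebraMap r => simp [CliffordAlgebra.contractLeft_algebraMap_mul]
  | add x y hx hy => simp only [add_mul, map_add, hx, hy]; abel
  | ι_mul x v hx =>
    rw [mul_assoc, CliffordAlgebra.contractLeft_ι_mul, hx, CliffordAlgebra.contractLeft_ι_mul,
      map_mul, CliffordAlgebra.involute_ι]
    simp only [mul_add, sub_mul, smul_mul_assoc, neg_mul, mul_assoc]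
    abel

theorem del_mem (b : Ix m n) : (del b : Module.End ℂ (A m n)) ∈ superDer m n (par b) := by
  have ext2 : ∀ {F G : A m n →ₗ[ℂ] A m n}, (∀ f w, F (mk f w) = G (mk f w)) → F = G := by
    intro F G h
    refine LinearMap.ext fun a => ?_
    induction a using A_tmul_induction with
    | zero => simp
    | mk f w => exact h f w
    | add x y hx hy => rw [map_add, map_add, hx, hy]
  have key : ∀ (p : ZMod 2) (D : Module.End ℂ (A m n)),
      (∀ f w, parity m n (D (mk f w)) = sgn 1 p • D (parity m n (mk f w))) →
      (∀ f w f' w', D (mk f w * mk f' w') =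
        D (mk f w) * mk f' w' + sig p (mk f w) * D (mk f' w')) → D ∈ superDer m n p := by
    intro p D h1 h2
    refine mem_superDer ?_ ?_
    · exact LinearMap.congr_fun (f := (parity m n).toLinearMap ∘ₗ D)
        (g := sgn 1 p • (D ∘ₗ (parity m n).toLinearMap)) (ext2 fun f w => h1 f w)
    · intro a b
      induction b using A_tmul_induction with
      | zero => simp
      | add x y hx hy => simp only [mul_add, map_add, hx, hy]; abel
      | mk f' w' =>
        induction a using A_tmul_induction with
        | zero => simp
        | add x y hx hy => simp only [add_mul, map_add, hx, hy]; abel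
        | mk f w => exact h2 f w f' w'
  rcases b with i | j
  · refine key _ _ (fun f w => ?_) fun f w f' w' => ?_
    · simp [par, sgn_zero_right, del, mapA_mk, parity_mk]
    · simp [par, sig, del, mapA_mk, mk_mul_mk, euler_mul]
  · refine key _ _ (fun f w => ?_) fun f w f' w' => ?_
    · simp [par, sgn_one_one, del, mapA_mk, parity_mk, contract_involute]
    · simp [par, sig, del, mapA_mk, mk_mul_mk, parity_mk, contract_mul]

theorem del_comm (a b : Ix m n) (x : A m n) :
    del a (del b x) = sgn (par a) (par b) • del b (del a x) := by
  induction x using A_tmul_induction with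
  | zero => simp
  | add x y hx hy => simp only [map_add, hx, hy, smul_add]
  | mk f w =>
    rcases a with i | i <;> rcases b with j | j
    · simp only [par, Sum.elim_inl, sgn_zero_left, one_smul, del, mapA_mk]
      congr 2
      induction f using AddMonoidAlgebra.induction_linear with
      | zero => simp
      | add f f' hf hf' => simp only [map_add, hf, hf']
      | single α c => simp only [euler_single, map_smul, smul_comm ((α i : ℤ) : ℂ)]
    · simp [par, sgn_zero_left, del, mapA_mk]
    · simp [par, sgn_zero_right, del, mapA_mk]
    · simp only [par, Sum.elim_inr, sgn_one_one, neg_one_smul, del, mapA_mk, LinearMap.id_apply]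
      rw [CliffordAlgebra.contractLeft_comm, map_neg]

/-- The supercommutator of homogeneous superderivations. -/
theorem bracket_mem {p q : ZMod 2} {D E : Module.End ℂ (A m n)} (hD : D ∈ superDer m n p)
    (hE : E ∈ superDer m n q) : D * E - sgn p q • (E * D) ∈ superDer m n (p + q) := by
  refine mem_superDer (fun a => ?_) fun a b => ?_
  · have h1 := fun a => superDer_sig hD 1 a
    have h2 := fun a => superDer_sig hE 1 a
    have hs : sig 1 = parity m n := rfl
    rw [hs] at h1 h2
    simp only [LinearMap.sub_apply, LinearMap.smul_apply, Module.End.mul_apply, map_sub, map_smul,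
      h1, h2, sgn_add_right, smul_sub, smul_smul]
    congr 2
    ring
  · simp only [LinearMap.sub_apply, LinearMap.smul_apply, Module.End.mul_apply,
      superDer_mul hD, superDer_mul hE, map_add, superDer_sig hD, superDer_sig hE, sig_sig,
      sub_mul, mul_sub, smul_add, smul_smul, smul_mul_assoc, mul_smul_comm, add_comm q p]
    rw [sgn_comm q p, sgn_mul_self]
    module

/-- The `del b`-coefficient of a superderivation `D`: `t_i⁻¹ D(t_i)` for `b = i` even, and
`D(ξ_j)` for `b = j` odd. -/
def coef : Ix m n → Module.End ℂ (A m n) →ₗ[ℂ] A m n :=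
  Sum.elim
    (fun i => LinearMap.mulLeft ℂ (tpow (-Pi.single i 1)) ∘ₗ
      LinearMap.applyₗ (tpow (Pi.single i 1)))
    (fun j => LinearMap.applyₗ (xi j))

theorem coef_mem {p : ZMod 2} {D : Module.End ℂ (A m n)} (hD : D ∈ superDer m n p) (b : Ix m n) :
    coef b D ∈ grA m n (p + par b) := by
  rcases b with i | j
  · simpa [coef, par] using grA_mul (tpow_mem (-Pi.single i 1)) (hD.1 _ _ (tpow_mem (Pi.single i 1)))
  · exact hD.1 _ _ (xi_mem j)

theorem del_tpow (i : Fin m) (α : Fin m → ℤ) :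
    (del (.inl i) (tpow α) : A m n) = ((α i : ℤ) : ℂ) • tpow α := by
  rw [tpow, del, Sum.elim_inl, mapA_mk, euler_single, map_smul, LinearMap.smul_apply,
    LinearMap.id_apply]

theorem del_tpow_odd (j : Fin n) (α : Fin m → ℤ) : (del (.inr j) (tpow α) : A m n) = 0 := by
  simp [del, tpow, mapA_mk]

theorem del_xi_even (i : Fin m) (j : Fin n) : (del (.inl i) (xi j) : A m n) = 0 := by
  have : euler i (1 : Laurent m) = 0 := by
    rw [AddMonoidAlgebra.one_def, euler_single]; simp
  simp [del, xi, mapA_mk, this]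

theorem del_xi (i j : Fin n) : (del (.inr i) (xi j) : A m n) = if i = j then 1 else 0 := by
  simp only [del, xi, Sum.elim_inr, mapA_mk, LinearMap.id_apply, ExteriorAlgebra.ι,
    CliffordAlgebra.contractLeft_ι]
  split_ifs with h
  · subst h; simp [mk_one_one]
  · simp [h]

/-- `W_{m,n} = A_{m,n} Δ`. -/
theorem superDer_eq {p : ZMod 2} {D : Module.End ℂ (A m n)} (hD : D ∈ superDer m n p) (a : A m n) :
    D a = ∑ b, coef b D * del b a := by
  induction a using A_induction with
  | h1 => rw [superDer_one hD]; simp [superDer_one (del_mem _)]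
  | ht α =>
    have htt : ∀ β : Fin m → ℤ, (tpow (-β) * tpow β : A m n) = 1 := by
      intro β; rw [← tpow_add, neg_add_cancel, tpow_zero]
    have hd : ∀ β γ, D (tpow (β + γ)) = D (tpow β) * tpow γ + tpow β * D (tpow γ) := by
      intro β γ
      rw [tpow_add, superDer_mul hD, sig_of_mem p (tpow_mem β), sgn_zero_right, one_smul]
    let g : (Fin m → ℤ) →+ A m n :=
      { toFun := fun β => tpow (-β) * D (tpow β)
        map_zero' := by rw [tpow_zero, superDer_one hD, mul_zero]
        map_add' := by
          intro β γ
          have h1 : ∀ x : A m n, tpow (-(β + γ)) * (x * tpow γ) = tpow (-β) * x := by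
            intro x
            rw [tpow_comm, neg_add_rev, add_comm, tpow_add, mul_assoc, ← mul_assoc (tpow (-γ)),
              htt, one_mul]
          have h2 : ∀ x : A m n, tpow (-(β + γ)) * (tpow β * x) = tpow (-γ) * x := by
            intro x
            rw [neg_add_rev, tpow_add, mul_assoc, ← mul_assoc (tpow (-β)), htt, one_mul]
          rw [hd, mul_add, h1, h2] }
    have hg : g α = ∑ i, α i • g (Pi.single i 1) := by
      conv_lhs => rw [← Finset.univ_sum_single α]
      rw [map_sum]
      refine Finset.sum_congr rfl fun i _ => ?_
      rw [← map_zsmul]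
      congr 1
      ext k; simp [Pi.single_apply]
    have : D (tpow α) = tpow α * g α := by
      change _ = tpow α * (tpow (-α) * D (tpow α))
      rw [← mul_assoc, ← tpow_add, add_neg_cancel, tpow_zero, one_mul]
    rw [this, hg, Fintype.sum_sum_type]
    simp only [del_tpow, del_tpow_odd, mul_zero, Finset.sum_const_zero, add_zero, Finset.mul_sum]
    refine Finset.sum_congr rfl fun i _ => ?_
    rw [mul_smul_comm, mul_smul_comm, Int.cast_smul_eq_zsmul, tpow_comm]
    rfl
  | hx j =>
    rw [Fintype.sum_sum_type]
    simp [del_xi_even, del_xi, coef]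
  | hadd a b ha hb => simp only [map_add, ha, hb, mul_add, Finset.sum_add_distrib]
  | hmul a b ha hb =>
    rw [superDer_mul hD, ha, hb, Finset.sum_mul, Finset.mul_sum, ← Finset.sum_add_distrib]
    refine Finset.sum_congr rfl fun k _ => ?_
    rw [superDer_mul (del_mem k), mul_add, ← mul_assoc, ← mul_assoc, ← mul_assoc,
      supercomm (coef_mem hD k) (sig (par k) a), sig_sig, add_assoc, CharTwo.add_self_eq_zero,
      add_zero]
  | hs c a ha => simp only [map_smul, ha, Finset.smul_sum, mul_smul_comm]

theorem coef_bracket {p q : ZMod 2} {D E : Module.End ℂ (A m n)} (hD : D ∈ superDer m n p)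
    (hE : E ∈ superDer m n q) (b : Ix m n) :
    coef b (D * E - sgn p q • (E * D)) = D (coef b E) - sgn p q • E (coef b D) := by
  rcases b with i | j
  · set t : A m n := tpow (Pi.single i 1) with ht
    have h1 : ∀ x : A m n, tpow (-Pi.single i 1) * (x * t) = x := by
      intro x
      rw [ht, tpow_comm, ← mul_assoc, ← tpow_add, neg_add_cancel, tpow_zero, one_mul]
    have h2 : ∀ F : Module.End ℂ (A m n), F t = coef (.inl i) F * t := by
      intro F
      change F t = (tpow (-Pi.single i 1) * F t) * t
      rw [ht, tpow_comm, ← mul_assoc, ← tpow_add, add_neg_cancel, tpow_zero, one_mul]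
    have hc : ∀ F : Module.End ℂ (A m n), coef (.inl i) F = tpow (-Pi.single i 1) * F t :=
      fun F => rfl
    have hd := coef_mem hD (.inl i)
    have he := coef_mem hE (.inl i)
    simp only [par, Sum.elim_inl, add_zero] at hd he
    rw [hc (_ - _)]
    simp only [LinearMap.sub_apply, LinearMap.smul_apply, Module.End.mul_apply]
    rw [h2 E, h2 D, superDer_mul hD, superDer_mul hE, h2 E, h2 D, ← mul_assoc, ← mul_assoc,
      ← add_mul, ← add_mul, ← smul_mul_assoc, ← sub_mul, h1, smul_add,
      sig_of_mem p he, sig_of_mem q hd]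
    simp only [smul_mul_assoc]
    rw [supercomm hd, sig_of_mem p he, smul_mul_assoc, sgn_comm q p, smul_smul (sgn p q) (sgn p q),
      sgn_mul_self, one_smul]
    abel
  · rfl

/-- The coefficient `(-1)^{|a|(|x|-1)} ∂_a(x)`, `x` the `∂_b`-coefficient of `D`, in the action of
`D` on a tensor module. -/
def mcoef (a b : Ix m n) : Module.End ℂ (A m n) →ₗ[ℂ] A m n :=
  (sig (par a)).toLinearMap ∘ₗ del a ∘ₗ coef b

theorem mcoef_mem {p : ZMod 2} {D : Module.End ℂ (A m n)} (hD : D ∈ superDer m n p)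
    (a b : Ix m n) : mcoef a b D ∈ grA m n (p + (par a + par b)) := by
  have h := (del_mem a).1 _ _ (coef_mem hD b)
  change sig (par a) (del a (coef b D)) ∈ _
  rw [sig_of_mem _ h]
  have e : p + (par a + par b) = par a + (p + par b) := by ring
  rw [e]
  exact Submodule.smul_mem _ _ h

theorem del_superDer {p : ZMod 2} {D : Module.End ℂ (A m n)} (hD : D ∈ superDer m n p)
    (a : Ix m n) (x : A m n) :
    sig (par a) (del a (D x)) =
      ∑ c, mcoef a c D * sig (par a) (del c x) + D (sig (par a) (del a x)) := by
  rw [superDer_eq hD x, map_sum, map_sum]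
  have h2 : D (sig (par a) (del a x)) = sgn (par a) p • sig (par a) (D (del a x)) := by
    rw [superDer_sig hD, smul_smul, sgn_mul_self, one_smul]
  rw [h2, superDer_eq hD (del a x), map_sum, Finset.smul_sum, ← Finset.sum_add_distrib]
  refine Finset.sum_congr rfl fun c _ => ?_
  rw [superDer_mul (del_mem a), map_add, map_mul, sig_of_mem (par a) (coef_mem hD c), del_comm a c]
  refine congrArg₂ (· + ·) rfl ?_
  rw [smul_mul_smul_comm, map_smul, sgn_add_right, mul_assoc, sgn_mul_self, mul_one]

theorem mcoef_bracket {p q : ZMod 2} {D E : Module.End ℂ (A m n)} (hD : D ∈ superDer m n p)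
    (hE : E ∈ superDer m n q) (a b : Ix m n) :
    mcoef a b (D * E - sgn p q • (E * D)) = D (mcoef a b E) - sgn p q • E (mcoef a b D) +
      (∑ c, mcoef a c D * sig (par a + par c) (mcoef c b E) -
        sgn p q • ∑ c, mcoef a c E * sig (par a + par c) (mcoef c b D)) := by
  have hm : ∀ F, mcoef a b F = sig (par a) (del a (coef b F)) := fun F => rfl
  have hs : ∀ (F : Module.End ℂ (A m n)) c,
      sig (par a + par c) (mcoef c b F) = sig (par a) (del c (coef b F)) := by
    intro F c
    change sig (par a + par c) (sig (par c) _) = _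
    rw [sig_sig, add_assoc, CharTwo.add_self_eq_zero, add_zero]
    rfl
  simp only [hs]
  rw [hm (_ - _), coef_bracket hD hE, map_sub, map_sub, map_smul, map_smul, del_superDer hD,
    del_superDer hE, smul_add, hm, hm]
  abel

/-- The quadratic terms commute up to sign. -/
theorem mcoef_swap {p q : ZMod 2} {D E : Module.End ℂ (A m n)} (hD : D ∈ superDer m n p)
    (hE : E ∈ superDer m n q) (a b c d : Ix m n) :
    sgn p q • (mcoef c d E * sig (par c + par d) (mcoef a b D)) =
      sgn (par a + par b) (par c + par d) •
        (mcoef a b D * sig (par a + par b) (mcoef c d E)) := by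
  have h1 := mcoef_mem hD a b
  have h2 := mcoef_mem hE c d
  rw [sig_of_mem _ h1, sig_of_mem _ h2, mul_smul_comm, mul_smul_comm, supercomm h2,
    sig_of_mem _ h1, smul_mul_assoc, smul_smul, smul_smul, smul_smul]
  congr 1
  generalize par a + par b = r
  generalize par c + par d = s
  rcases zmod2 p with rfl | rfl <;> rcases zmod2 q with rfl | rfl <;>
    rcases zmod2 r with rfl | rfl <;> rcases zmod2 s with rfl | rfl <;>
    simp [sgn_zero_left, sgn_zero_right, sgn_one_one, one_add_one]

end

/-! ### modules -/

/-- The Lie superalgebra bracket of `W_{m,n}` on homogeneous elements. -/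
def bracket {m n : ℕ} {p q : ZMod 2} (D : superDer m n p) (E : superDer m n q) :
    superDer m n (p + q) :=
  ⟨D.1 * E.1 - sgn p q • (E.1 * D.1), bracket_mem D.2 E.2⟩

/-- A graded subspace of a superspace. -/
def IsGraded {V : Type*} [AddCommGroup V] [Module ℂ V] (gr : ZMod 2 → Submodule ℂ V)
    (N : Submodule ℂ V) : Prop :=
  N = ⨆ p, N ⊓ gr p

/-- A (`ℤ/2`-graded) module over the extended Witt superalgebra `W_{m,n} ⋉ A_{m,n}`, whose
brackets are the bracket of `W_{m,n}`, `[D, a] = D(a)` and `[a, b] = 0`. The action of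
`W_{m,n} = W_0 ⊕ W_1` is given by its restrictions `actW p` to the two components, the action of
`A_{m,n}` by `actA`. The last three fields say that `[x, y]` acts as
`x y - (-1)^{|x||y|} y x`, for `x, y` in `W_{m,n}`, for `x` in `W_{m,n}` and `y` in `A_{m,n}`,
and for `x, y` in `A_{m,n}`. -/
structure ExtWittModule (m n : ℕ) (M : Type*) [AddCommGroup M] [Module ℂ M] where
  gr : ZMod 2 → Submodule ℂ M
  isInternal : DirectSum.IsInternal gr
  actW : ∀ p : ZMod 2, superDer m n p →ₗ[ℂ] Module.End ℂ M
  actA : A m n →ₗ[ℂ] Module.End ℂ M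
  actW_mem : ∀ (p q : ZMod 2) (D : superDer m n p), ∀ v ∈ gr q, actW p D v ∈ gr (p + q)
  actA_mem : ∀ p q : ZMod 2, ∀ a ∈ grA m n p, ∀ v ∈ gr q, actA a v ∈ gr (p + q)
  actW_bracket : ∀ (p q : ZMod 2) (D : superDer m n p) (E : superDer m n q),
    actW (p + q) (bracket D E) = actW p D * actW q E - sgn p q • (actW q E * actW p D)
  actW_actA : ∀ (p q : ZMod 2) (D : superDer m n p), ∀ a ∈ grA m n q,
    actA (D.1 a) = actW p D * actA a - sgn p q • (actA a * actW p D)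
  actA_actA : ∀ p q : ZMod 2, ∀ a ∈ grA m n p, ∀ b ∈ grA m n q,
    0 = actA a * actA b - sgn p q • (actA b * actA a)

/-- The homogeneous components of `gl(m,n)`. -/
def grGL (m n : ℕ) (p : ZMod 2) : Submodule ℂ (Matrix (Ix m n) (Ix m n) ℂ) where
  carrier := {X | ∀ a b, par a + par b ≠ p → X a b = 0}
  zero_mem' := fun _ _ _ => rfl
  add_mem' := fun hX hY a b h => by simp [hX a b h, hY a b h]
  smul_mem' := fun c X hX a b h => by simp [hX a b h]

/-- A (`ℤ/2`-graded) module over the Lie superalgebra `gl(m,n)` of all matrices with the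
supercommutator as bracket. -/
structure GLModule (m n : ℕ) (V : Type*) [AddCommGroup V] [Module ℂ V] where
  gr : ZMod 2 → Submodule ℂ V
  isInternal : DirectSum.IsInternal gr
  act : Matrix (Ix m n) (Ix m n) ℂ →ₗ[ℂ] Module.End ℂ V
  act_mem : ∀ p q : ZMod 2, ∀ X ∈ grGL m n p, ∀ v ∈ gr q, act X v ∈ gr (p + q)
  act_bracket : ∀ p q : ZMod 2, ∀ X ∈ grGL m n p, ∀ Y ∈ grGL m n q,
    act (X * Y - sgn p q • (Y * X)) = act X * act Y - sgn p q • (act Y * act X)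

theorem single_mem {m n : ℕ} (a b : Ix m n) :
    (Matrix.single a b 1 : Matrix (Ix m n) (Ix m n) ℂ) ∈ grGL m n (par a + par b) := by
  intro c d h
  rw [Matrix.single_apply]
  split_ifs with h'
  · obtain ⟨rfl, rfl⟩ := h'; exact absurd rfl h
  · rfl

section
variable {m n : ℕ} {V : Type*} [AddCommGroup V] [Module ℂ V]

/-- The grading of the tensor product of `A_{m,n}` with a superspace `V`. -/
def grTensor (gr : ZMod 2 → Submodule ℂ V) (p : ZMod 2) : Submodule ℂ (A m n ⊗[ℂ] V) :=
  Submodule.span ℂ {z | ∃ i j, ∃ y ∈ grA m n i, ∃ v ∈ gr j, i + j = p ∧ z = y ⊗ₜ v}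

theorem tmul_mem {gr : ZMod 2 → Submodule ℂ V} {i j p : ZMod 2} {y : A m n} {v : V}
    (hy : y ∈ grA m n i) (hv : v ∈ gr j) (h : i + j = p) : y ⊗ₜ v ∈ grTensor (m := m) (n := n) gr p :=
  Submodule.subset_span ⟨i, j, y, hy, v, hv, h, rfl⟩

theorem isInternal_iff (gr : ZMod 2 → Submodule ℂ V) :
    DirectSum.IsInternal gr ↔ IsCompl (gr 0) (gr 1) :=
  DirectSum.isInternal_submodule_iff_isCompl gr zero_ne_one
    (by ext p; rcases zmod2 p with rfl | rfl <;> simp)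

theorem isInternal_grTensor {gr : ZMod 2 → Submodule ℂ V} (h : DirectSum.IsInternal gr) :
    DirectSum.IsInternal (grTensor (m := m) (n := n) gr) := by
  rw [isInternal_iff] at h ⊢
  set s : V →ₗ[ℂ] V := LinearMap.ofIsCompl h (gr 0).subtype (-(gr 1).subtype) with hs
  have hs' : ∀ q, ∀ v ∈ gr q, s v = sgn 1 q • v := by
    intro q v hv
    rcases zmod2 q with rfl | rfl
    · rw [hs, sgn_zero_right, one_smul]
      exact LinearMap.ofIsCompl_apply_left h ⟨v, hv⟩
    · rw [hs, sgn_one_one, neg_one_smul]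
      exact LinearMap.ofIsCompl_apply_right h ⟨v, hv⟩
  have hS : ∀ p, ∀ z ∈ grTensor (m := m) (n := n) gr p,
      TensorProduct.map (parity m n).toLinearMap s z = sgn 1 p • z := by
    intro p z hz
    induction hz using Submodule.span_induction with
    | zero => simp
    | add x y _ _ hx hy => rw [map_add, hx, hy, smul_add]
    | smul c x _ hx => rw [map_smul, hx, smul_comm]
    | mem x hx =>
      obtain ⟨i, j, y, hy, v, hv, rfl, rfl⟩ := hx
      rw [TensorProduct.map_tmul, AlgHom.toLinearMap_apply, parity_of_mem hy, hs' j v hv,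
        TensorProduct.smul_tmul_smul, sgn_add_right]
  constructor
  · rw [Submodule.disjoint_def]
    intro z h0 h1
    have e := (hS 0 z h0).symm.trans (hS 1 z h1)
    have e2 : (2 : ℂ) • z = 0 := by
      have : (2 : ℂ) • z = sgn 1 0 • z + (1 : ℂ) • z := by
        rw [sgn_zero_right, ← add_smul]; norm_num
      rw [this, e, ← add_smul, sgn_one_one, neg_add_cancel, zero_smul]
    simpa using e2
  · rw [codisjoint_iff, eq_top_iff]
    rintro z -
    induction z using TensorProduct.induction_on with
    | zero => exact zero_mem _
    | add x y hx hy => exact add_mem (hx) (hy)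
    | tmul y v =>
      obtain ⟨y0, hy0, y1, hy1, rfl⟩ := exists_add y
      have hv : v ∈ gr 0 ⊔ gr 1 := by rw [h.sup_eq_top]; trivial
      obtain ⟨v0, hv0, v1, hv1, rfl⟩ := Submodule.mem_sup.1 hv
      rw [TensorProduct.add_tmul, TensorProduct.tmul_add, TensorProduct.tmul_add]
      refine add_mem (add_mem ?_ ?_) (add_mem ?_ ?_)
      · exact Submodule.mem_sup_left (tmul_mem hy0 hv0 rfl)
      · exact Submodule.mem_sup_right (tmul_mem hy0 hv1 rfl)
      · exact Submodule.mem_sup_right (tmul_mem hy1 hv0 rfl)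
      · exact Submodule.mem_sup_left (tmul_mem hy1 hv1 rfl)

/-- The action of a superderivation `D` of `A_{m,n}` on the tensor module `A_{m,n} ⊗ V`. Writing
`D = ∑ b, D_b ∂_b` with `∂_b` running through `d_1, …, d_m, ∂/∂ξ_1, …, ∂/∂ξ_n` (`del b`) and
`D_b ∈ A_{m,n}` (`coef b D`), this is the sum over `b` of the actions of the `x ∂_b`, `x = D_b`,
which for homogeneous `x`, `y` are
`x ∂_b (y ⊗ v) = x (∂_b y + lam_b y) ⊗ v
  + ∑ a, (-1)^{|a|(|x|-1) + (|a|+|b|)|y|} (∂_a x) y ⊗ E_{a,b} v`,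
where `lam_b = 0` for `b` odd; see `tensorW_mulLeft_del`. -/
def tensorW (lam : Fin m → ℂ) (τ : GLModule m n V) :
    Module.End ℂ (A m n) →ₗ[ℂ] Module.End ℂ (A m n ⊗[ℂ] V) where
  toFun D := TensorProduct.map (D + ∑ i, lam i • LinearMap.mulLeft ℂ (coef (.inl i) D))
      LinearMap.id +
    ∑ a, ∑ b, TensorProduct.map
      (LinearMap.mulLeft ℂ (mcoef a b D) ∘ₗ (sig (par a + par b)).toLinearMap)
      (τ.act (Matrix.single a b 1))
  map_add' D E := by
    ext y v
    simp [add_mul, TensorProduct.add_tmul, Finset.sum_add_distrib, TensorProduct.sum_tmul]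
    abel
  map_smul' c D := by
    ext y v
    simp [TensorProduct.smul_tmul', Finset.smul_sum, smul_comm c]

/-- `∑ i, lam_i D_i`, the `D_i` being the `d_i`-coefficients of `D`. -/
def lamc (lam : Fin m → ℂ) (D : Module.End ℂ (A m n)) : A m n := ∑ i, lam i • coef (.inl i) D

theorem tensorW_tmul (lam : Fin m → ℂ) (τ : GLModule m n V) (D : Module.End ℂ (A m n))
    (y : A m n) (v : V) : tensorW lam τ D (y ⊗ₜ v) = (D y + lamc lam D * y) ⊗ₜ v +
      ∑ a, ∑ b, (mcoef a b D * sig (par a + par b) y) ⊗ₜ τ.act (Matrix.single a b 1) v := by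
  simp [tensorW, lamc, Finset.sum_mul]

theorem lamc_mem (lam : Fin m → ℂ) {p : ZMod 2} {D : Module.End ℂ (A m n)}
    (hD : D ∈ superDer m n p) : lamc lam D ∈ grA m n p := by
  refine Submodule.sum_mem _ fun i _ => Submodule.smul_mem _ _ ?_
  simpa [par] using coef_mem hD (.inl i)

theorem lamc_bracket (lam : Fin m → ℂ) {p q : ZMod 2} {D E : Module.End ℂ (A m n)}
    (hD : D ∈ superDer m n p) (hE : E ∈ superDer m n q) :
    lamc lam (D * E - sgn p q • (E * D)) = D (lamc lam E) - sgn p q • E (lamc lam D) := by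
  simp only [lamc, coef_bracket hD hE, map_sum, map_smul, Finset.smul_sum, smul_sub,
    Finset.sum_sub_distrib, smul_comm (sgn p q)]

theorem GLModule.act_single (τ : GLModule m n V) (a b c d : Ix m n) (v : V) :
    τ.act (Matrix.single a b 1) (τ.act (Matrix.single c d 1) v) -
      sgn (par a + par b) (par c + par d) •
        τ.act (Matrix.single c d 1) (τ.act (Matrix.single a b 1) v) =
    (if b = c then τ.act (Matrix.single a d 1) v else 0) -
      sgn (par a + par b) (par c + par d) •
        (if d = a then τ.act (Matrix.single c b 1) v else 0) := by
  have h := LinearMap.congr_fun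
    (τ.act_bracket _ _ _ (single_mem a b) _ (single_mem c d)) v
  simp only [LinearMap.sub_apply, LinearMap.smul_apply, Module.End.mul_apply] at h
  rw [← h, map_sub, map_smul]
  have h' : ∀ a b c d : Ix m n, (Matrix.single a b 1 * Matrix.single c d 1 :
      Matrix (Ix m n) (Ix m n) ℂ) = if b = c then Matrix.single a d 1 else 0 := by
    intro a b c d
    split_ifs with h
    · subst h; simp
    · exact Matrix.single_mul_single_of_ne _ _ _ _ h _
  rw [h', h', LinearMap.sub_apply, LinearMap.smul_apply]
  congr 1
  · split_ifs <;> simp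
  · split_ifs <;> simp

theorem sum4 {T : Type*} [AddCommMonoid T] (f : Ix m n → Ix m n → Ix m n → Ix m n → T) :
    ∑ c, ∑ d, ∑ a, ∑ b, f a b c d = ∑ a, ∑ b, ∑ c, ∑ d, f a b c d := by
  calc _ = ∑ c, ∑ a, ∑ d, ∑ b, f a b c d :=
        Finset.sum_congr rfl fun c _ => Finset.sum_comm
    _ = ∑ a, ∑ c, ∑ d, ∑ b, f a b c d := Finset.sum_comm
    _ = ∑ a, ∑ c, ∑ b, ∑ d, f a b c d :=
        Finset.sum_congr rfl fun a _ => Finset.sum_congr rfl fun c _ => Finset.sum_comm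
    _ = _ := Finset.sum_congr rfl fun a _ => Finset.sum_comm

theorem tensorW_quad (τ : GLModule m n V) {p q : ZMod 2} {D E : Module.End ℂ (A m n)}
    (hD : D ∈ superDer m n p) (hE : E ∈ superDer m n q) (y : A m n) (v : V) :
    (∑ a, ∑ b, ∑ c, ∑ d, (mcoef a b D * sig (par a + par b) (mcoef c d E * sig (par c + par d) y))
      ⊗ₜ[ℂ] τ.act (Matrix.single a b 1) (τ.act (Matrix.single c d 1) v)) -
    sgn p q • (∑ c, ∑ d, ∑ a, ∑ b,
      (mcoef c d E * sig (par c + par d) (mcoef a b D * sig (par a + par b) y))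
      ⊗ₜ[ℂ] τ.act (Matrix.single c d 1) (τ.act (Matrix.single a b 1) v)) =
    ∑ a, ∑ b, ((∑ c, mcoef a c D * sig (par a + par c) (mcoef c b E) -
        sgn p q • ∑ c, mcoef a c E * sig (par a + par c) (mcoef c b D)) * sig (par a + par b) y)
      ⊗ₜ[ℂ] τ.act (Matrix.single a b 1) v := by
  set X : Ix m n → Ix m n → Ix m n → Ix m n → A m n := fun a b c d =>
    mcoef a b D * sig (par a + par b) (mcoef c d E) with hX
  set Y : Ix m n → Ix m n → Ix m n → Ix m n → A m n := fun a b c d =>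
    mcoef c d E * sig (par c + par d) (mcoef a b D) with hY
  have hswap : ∀ a b c d, sgn p q • Y a b c d =
    sgn (par a + par b) (par c + par d) • X a b c d := fun a b c d => mcoef_swap hD hE a b c d
  have e1 : ∀ a b c d : Ix m n, (mcoef a b D * sig (par a + par b) (mcoef c d E *
      sig (par c + par d) y)) = X a b c d * sig (par a + par b + (par c + par d)) y := by
    intro a b c d; rw [map_mul, sig_sig, mul_assoc]
  have e2 : ∀ a b c d : Ix m n, (mcoef c d E * sig (par c + par d) (mcoef a b D *
      sig (par a + par b) y)) = Y a b c d * sig (par a + par b + (par c + par d)) y := by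
    intro a b c d; rw [map_mul, sig_sig, mul_assoc, add_comm (par c + par d)]
  simp only [e1, e2]
  rw [sum4 (fun a b c d => (Y a b c d * sig (par a + par b + (par c + par d)) y)
      ⊗ₜ[ℂ] τ.act (Matrix.single c d 1) (τ.act (Matrix.single a b 1) v))]
  simp only [Finset.smul_sum, ← Finset.sum_sub_distrib]
  have e3 : ∀ a b c d : Ix m n,
      (X a b c d * sig (par a + par b + (par c + par d)) y) ⊗ₜ[ℂ]
        τ.act (Matrix.single a b 1) (τ.act (Matrix.single c d 1) v) -
      sgn p q • ((Y a b c d * sig (par a + par b + (par c + par d)) y) ⊗ₜ[ℂ]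
        τ.act (Matrix.single c d 1) (τ.act (Matrix.single a b 1) v)) =
      (if b = c then (X a b c d * sig (par a + par d) y) ⊗ₜ[ℂ] τ.act (Matrix.single a d 1) v
        else 0) -
      (if d = a then (sgn p q • Y a b c d * sig (par c + par b) y) ⊗ₜ[ℂ]
        τ.act (Matrix.single c b 1) v else 0) := by
    intro a b c d
    rw [TensorProduct.smul_tmul', ← smul_mul_assoc, hswap, smul_mul_assoc,
      TensorProduct.smul_tmul, ← TensorProduct.tmul_sub, τ.act_single, TensorProduct.tmul_sub]
    congr 1
    · split_ifs with h
      · subst h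
        congr 3
        have : par a + par b + (par b + par d) = par a + par d + (par b + par b) := by ring
        rw [this, CharTwo.add_self_eq_zero, add_zero]
      · simp
    · split_ifs with h
      · subst h
        rw [smul_mul_assoc, TensorProduct.smul_tmul]
        congr 3
        have : par d + par b + (par c + par d) = par c + par b + (par d + par d) := by ring
        rw [this, CharTwo.add_self_eq_zero, add_zero]
      · simp
  simp only [e3, Finset.sum_sub_distrib]
  simp only [sub_mul, TensorProduct.sub_tmul, Finset.sum_sub_distrib, Finset.sum_mul,
    TensorProduct.sum_tmul]
  congr 1
  · refine Finset.sum_congr rfl fun a _ => ?_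
    calc _ = ∑ b, ∑ d, (X a b b d * sig (par a + par d) y) ⊗ₜ[ℂ]
            τ.act (Matrix.single a d 1) v := by
          refine Finset.sum_congr rfl fun b _ => ?_
          rw [Finset.sum_comm]
          refine Finset.sum_congr rfl fun d _ => ?_
          rw [Finset.sum_ite_eq, if_pos (Finset.mem_univ _)]
      _ = _ := Finset.sum_comm
  · calc _ = ∑ a, ∑ b, ∑ c, (sgn p q • Y a b c a * sig (par c + par b) y) ⊗ₜ[ℂ]
            τ.act (Matrix.single c b 1) v := by
          refine Finset.sum_congr rfl fun a _ => Finset.sum_congr rfl fun b _ =>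
            Finset.sum_congr rfl fun c _ => ?_
          rw [Finset.sum_ite_eq', if_pos (Finset.mem_univ _)]
      _ = ∑ a, ∑ c, ∑ b, (sgn p q • Y a b c a * sig (par c + par b) y) ⊗ₜ[ℂ]
            τ.act (Matrix.single c b 1) v :=
          Finset.sum_congr rfl fun a _ => Finset.sum_comm
      _ = ∑ c, ∑ a, ∑ b, (sgn p q • Y a b c a * sig (par c + par b) y) ⊗ₜ[ℂ]
            τ.act (Matrix.single c b 1) v := Finset.sum_comm
      _ = _ := Finset.sum_congr rfl fun c _ => Finset.sum_comm

theorem tensorW_bracket (lam : Fin m → ℂ) (τ : GLModule m n V) {p q : ZMod 2}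
    {D E : Module.End ℂ (A m n)} (hD : D ∈ superDer m n p) (hE : E ∈ superDer m n q) :
    tensorW lam τ (D * E - sgn p q • (E * D)) =
      tensorW lam τ D * tensorW lam τ E - sgn p q • (tensorW lam τ E * tensorW lam τ D) := by
  have prod : ∀ {p q : ZMod 2} {D E : Module.End ℂ (A m n)}, D ∈ superDer m n p →
      E ∈ superDer m n q → ∀ (y : A m n) (v : V),
      tensorW lam τ D (tensorW lam τ E (y ⊗ₜ v)) =
        (D (E y) + (D (lamc lam E) * y + lamc lam D * lamc lam E * y) +
          (sig p (lamc lam E) * D y + lamc lam D * E y)) ⊗ₜ v +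
        (∑ a, ∑ b, (mcoef a b D * sig (par a + par b) (E y + lamc lam E * y)) ⊗ₜ
          τ.act (Matrix.single a b 1) v +
        ∑ a, ∑ b, ((D (mcoef a b E) * sig (par a + par b) y) +
          (sig p (mcoef a b E) * D (sig (par a + par b) y) +
            lamc lam D * mcoef a b E * sig (par a + par b) y)) ⊗ₜ
          τ.act (Matrix.single a b 1) v) +
        ∑ a, ∑ b, ∑ c, ∑ d,
          (mcoef a b D * sig (par a + par b) (mcoef c d E * sig (par c + par d) y))
          ⊗ₜ[ℂ] τ.act (Matrix.single a b 1) (τ.act (Matrix.single c d 1) v) := by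
    intro p q D E hD hE y v
    rw [← sum4]
    simp only [tensorW_tmul, map_add, map_sum, superDer_mul hD, Finset.sum_add_distrib, mul_add, TensorProduct.add_tmul, mul_assoc]
    abel
  have lin : ∀ {p q : ZMod 2} {D E : Module.End ℂ (A m n)}, D ∈ superDer m n p →
      E ∈ superDer m n q → ∀ (y : A m n) (a b : Ix m n),
      mcoef a b D * sig (par a + par b) (E y + lamc lam E * y) =
        sgn p q • (sig q (mcoef a b D) * E (sig (par a + par b) y) +
            lamc lam E * mcoef a b D * sig (par a + par b) y) := by
    intro p q D E hD hE y a b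
    have h1 := mcoef_mem hD a b
    have h2 := lamc_mem lam hE
    rw [supercomm h2 (mcoef a b D), map_add, map_mul, superDer_sig hE, sig_of_mem _ h1,
      sig_of_mem _ h2]
    simp only [mul_add, smul_add, smul_mul_assoc, mul_smul_comm, smul_smul, mul_assoc]
    have e : sgn p q * sgn q (p + (par a + par b)) = sgn (par a + par b) q := by
      rw [sgn_add_right, sgn_comm q p, ← mul_assoc, sgn_mul_self, one_mul, sgn_comm]
    rw [e]
  refine TensorProduct.ext' fun y v => ?_
  have hq := tensorW_quad τ hD hE y v
  have hsc : (D * E - sgn p q • (E * D)) y + lamc lam (D * E - sgn p q • (E * D)) * y =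
      (D (E y) + (D (lamc lam E) * y + lamc lam D * lamc lam E * y) +
          (sig p (lamc lam E) * D y + lamc lam D * E y)) -
      sgn p q • (E (D y) + (E (lamc lam D) * y + lamc lam E * lamc lam D * y) +
          (sig q (lamc lam D) * E y + lamc lam E * D y)) := by
    have h1 := lamc_mem lam hD
    have h2 := lamc_mem lam hE
    rw [lamc_bracket lam hD hE, supercomm h2, sig_of_mem p h2, sig_of_mem q h1, sgn_comm q p]
    simp only [LinearMap.sub_apply, LinearMap.smul_apply, Module.End.mul_apply, smul_add, sub_mul,
      smul_mul_assoc, smul_smul, sgn_mul_self, one_smul]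
    abel
  simp only [LinearMap.sub_apply, LinearMap.smul_apply, Module.End.mul_apply (M := A m n ⊗[ℂ] V)]
  rw [prod hD hE, prod hE hD, tensorW_tmul, hsc]
  simp only [mcoef_bracket hD hE, lin hD hE, lin hE hD, sgn_comm q p]
  simp only [add_mul _ _ (sig _ y), sub_mul _ _ (sig _ y), TensorProduct.add_tmul,
    TensorProduct.sub_tmul, ← TensorProduct.smul_tmul', Finset.sum_add_distrib,
    Finset.sum_sub_distrib, smul_mul_assoc, ← Finset.smul_sum, smul_add, smul_smul,
    sgn_mul_self, one_smul] at hq ⊢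
  rw [← hq]
  abel


theorem tensorW_mem (lam : Fin m → ℂ) (τ : GLModule m n V) {p q : ZMod 2}
    {D : Module.End ℂ (A m n)} (hD : D ∈ superDer m n p) {z : A m n ⊗[ℂ] V}
    (hz : z ∈ grTensor τ.gr q) : tensorW lam τ D z ∈ grTensor τ.gr (p + q) := by
  induction hz using Submodule.span_induction with
  | zero => simp
  | add x y _ _ hx hy => rw [map_add]; exact add_mem hx hy
  | smul c x _ hx => rw [map_smul]; exact Submodule.smul_mem _ _ hx
  | mem x hx =>
    obtain ⟨i, j, y, hy, v, hv, rfl, rfl⟩ := hx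
    rw [tensorW_tmul]
    refine add_mem (tmul_mem (add_mem (hD.1 i y hy) (grA_mul (lamc_mem lam hD) hy)) hv
      (by ring)) (Submodule.sum_mem _ fun a _ => Submodule.sum_mem _ fun b _ => ?_)
    rw [sig_of_mem _ hy]
    refine tmul_mem (grA_mul (mcoef_mem hD a b) (Submodule.smul_mem _ _ hy))
      (τ.act_mem _ _ _ (single_mem a b) v hv) ?_
    have : p + (par a + par b) + i + (par a + par b + j) =
        p + (i + j) + ((par a + par b) + (par a + par b)) := by ring
    rw [this, CharTwo.add_self_eq_zero, add_zero]

/-- The action of `A_{m,n}` on `A_{m,n} ⊗ V` by multiplication on the first factor. -/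
def tensorA (m n : ℕ) (V : Type*) [AddCommGroup V] [Module ℂ V] :
    A m n →ₗ[ℂ] Module.End ℂ (A m n ⊗[ℂ] V) :=
  LinearMap.rTensorHom V ∘ₗ LinearMap.mul ℂ (A m n)

theorem tensorA_tmul (a y : A m n) (v : V) : tensorA m n V a (y ⊗ₜ v) = (a * y) ⊗ₜ v := rfl

theorem tensorA_mem {gr : ZMod 2 → Submodule ℂ V} {p q : ZMod 2} {a : A m n}
    (ha : a ∈ grA m n p) {z : A m n ⊗[ℂ] V} (hz : z ∈ grTensor gr q) :
    tensorA m n V a z ∈ grTensor gr (p + q) := by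
  induction hz using Submodule.span_induction with
  | zero => simp
  | add x y _ _ hx hy => rw [map_add]; exact add_mem hx hy
  | smul c x _ hx => rw [map_smul]; exact Submodule.smul_mem _ _ hx
  | mem x hx =>
    obtain ⟨i, j, y, hy, v, hv, rfl, rfl⟩ := hx
    exact tmul_mem (grA_mul ha hy) hv (by ring)

theorem tensorW_tensorA (lam : Fin m → ℂ) (τ : GLModule m n V) {p q : ZMod 2}
    {D : Module.End ℂ (A m n)} (hD : D ∈ superDer m n p) {a : A m n} (ha : a ∈ grA m n q) :
    tensorA m n V (D a) = tensorW lam τ D * tensorA m n V a -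
      sgn p q • (tensorA m n V a * tensorW lam τ D) := by
  refine TensorProduct.ext' fun y v => ?_
  have h1 : ∀ b c, mcoef b c D * sig (par b + par c) (a * y) =
      sgn p q • (a * (mcoef b c D * sig (par b + par c) y)) := by
    intro b c
    have h := mcoef_mem hD b c
    rw [map_mul, ← mul_assoc, ← mul_assoc, supercomm h, sig_sig, sig_of_mem _ ha, smul_mul_assoc,
      smul_mul_assoc, add_assoc, CharTwo.add_self_eq_zero, add_zero]
  have h2 : lamc lam D * (a * y) = sgn p q • (a * (lamc lam D * y)) := by
    rw [← mul_assoc, supercomm (lamc_mem lam hD) a, sig_of_mem _ ha, smul_mul_assoc,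
      smul_mul_assoc, mul_assoc]
  simp only [LinearMap.sub_apply, LinearMap.smul_apply, Module.End.mul_apply (M := A m n ⊗[ℂ] V),
    tensorA_tmul, tensorW_tmul, map_add, map_sum, h1, h2, superDer_mul hD, sig_of_mem p ha,
    TensorProduct.add_tmul, smul_add, Finset.smul_sum, TensorProduct.smul_tmul',
    smul_mul_assoc]
  abel

/-- The tensor module (Shen-Larsson module) `Γ(lam, V)`, on the superspace `A_{m,n} ⊗ V`. -/
def tensorModule (lam : Fin m → ℂ) (τ : GLModule m n V) : ExtWittModule m n (A m n ⊗[ℂ] V) where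
  gr := grTensor τ.gr
  isInternal := isInternal_grTensor τ.isInternal
  actW p := tensorW lam τ ∘ₗ (superDer m n p).subtype
  actA := tensorA m n V
  actW_mem _ _ D _ hz := tensorW_mem lam τ D.2 hz
  actA_mem _ _ _ ha _ hz := tensorA_mem ha hz
  actW_bracket _ _ D E := tensorW_bracket lam τ D.2 E.2
  actW_actA _ _ D _ ha := tensorW_tensorA lam τ D.2 ha
  actA_actA p q a ha b hb := by
    refine TensorProduct.ext' fun y v => ?_
    simp only [LinearMap.zero_apply, LinearMap.sub_apply, LinearMap.smul_apply,
      Module.End.mul_apply (M := A m n ⊗[ℂ] V), tensorA_tmul]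
    rw [← mul_assoc, supercomm ha b, sig_of_mem p hb, smul_mul_assoc, smul_mul_assoc, mul_assoc,
      TensorProduct.smul_tmul', sub_self]

theorem coef_mulLeft_del (x : A m n) (b c : Ix m n) :
    coef c (LinearMap.mulLeft ℂ x * del b) = if c = b then x else 0 := by
  rcases c with i | j
  · have h : ∀ F : Module.End ℂ (A m n), coef (.inl i) F =
        tpow (-Pi.single i 1) * F (tpow (Pi.single i 1)) := fun F => rfl
    rw [h, Module.End.mul_apply, LinearMap.mulLeft_apply]
    rcases b with i' | j'
    · rw [del_tpow, mul_smul_comm, tpow_comm, mul_smul_comm, ← mul_assoc, ← tpow_add,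
        neg_add_cancel, tpow_zero, one_mul]
      by_cases e : i = i'
      · subst e; simp
      · simp [e, Ne.symm e]
    · simp [del_tpow_odd]
  · have h : ∀ F : Module.End ℂ (A m n), coef (.inr j) F = F (xi j) := fun F => rfl
    rw [h, Module.End.mul_apply, LinearMap.mulLeft_apply]
    rcases b with i' | j'
    · simp [del_xi_even]
    · by_cases e : j = j'
      · subst e; simp [del_xi]
      · simp [del_xi, e, Ne.symm e]

/-- The action of `x d_i`, resp. `x ∂/∂ξ_j`, on a tensor module, for homogeneous `x`, `y`. -/
theorem tensorW_mulLeft_del (lam : Fin m → ℂ) (τ : GLModule m n V) {p q : ZMod 2} {x y : A m n}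
    (hx : x ∈ grA m n p) (hy : y ∈ grA m n q) (b : Ix m n) (v : V) :
    tensorW lam τ (LinearMap.mulLeft ℂ x * del b) (y ⊗ₜ v) =
      (x * (del b y + Sum.elim lam 0 b • y)) ⊗ₜ v +
      ∑ a, (sgn (par a) (par a + p) * sgn (par a + par b) q) •
        ((del a x * y) ⊗ₜ τ.act (Matrix.single a b 1) v) := by
  have hm : ∀ a c, mcoef a c (LinearMap.mulLeft ℂ x * del b) =
      if c = b then sig (par a) (del a x) else 0 := by
    intro a c
    change sig (par a) (del a (coef c (LinearMap.mulLeft ℂ x * del b))) = _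
    rw [coef_mulLeft_del]
    split_ifs <;> simp
  have hl : lamc lam (LinearMap.mulLeft ℂ x * del b) = Sum.elim lam 0 b • x := by
    rcases b with i | j
    · simp [lamc, coef_mulLeft_del]
    · simp [lamc, coef_mulLeft_del]
  rw [tensorW_tmul, hl, Module.End.mul_apply, LinearMap.mulLeft_apply, mul_add, mul_smul_comm,
    smul_mul_assoc]
  congr 1
  refine Finset.sum_congr rfl fun a _ => ?_
  rw [Finset.sum_eq_single b (fun c _ hc => by simp [hm, hc]) (by simp), hm, if_pos rfl,
    sig_of_mem _ ((del_mem a).1 _ _ hx), sig_of_mem _ hy, smul_mul_smul_comm,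
    TensorProduct.smul_tmul']

end

section
variable {m n : ℕ}

/-- A nonzero `gl(m,n)`-module without graded submodules except `0` and itself. -/
def GLModule.IsSimple {V : Type*} [AddCommGroup V] [Module ℂ V] (τ : GLModule m n V) : Prop :=
  Nontrivial V ∧ ∀ N : Submodule ℂ V, IsGraded τ.gr N → (∀ X, ∀ v ∈ N, τ.act X v ∈ N) →
    N = ⊥ ∨ N = ⊤

variable {M M' : Type*} [AddCommGroup M] [Module ℂ M] [AddCommGroup M'] [Module ℂ M']

/-- `M` is an `AW_{m,n}`-module: `A_{m,n}` acts associatively and unitally. -/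
def ExtWittModule.IsAW (ρ : ExtWittModule m n M) : Prop :=
  (∀ a b : A m n, ∀ v, ρ.actA a (ρ.actA b v) = ρ.actA (a * b) v) ∧ ∀ v, ρ.actA 1 v = v

/-- A nonzero module without graded submodules except `0` and itself. -/
def ExtWittModule.IsSimple (ρ : ExtWittModule m n M) : Prop :=
  Nontrivial M ∧ ∀ N : Submodule ℂ M, IsGraded ρ.gr N →
    (∀ p, ∀ D : superDer m n p, ∀ v ∈ N, ρ.actW p D v ∈ N) →
    (∀ a, ∀ v ∈ N, ρ.actA a v ∈ N) → N = ⊥ ∨ N = ⊤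

/-- The element `d_i = t_i ∂/∂t_i` of `W_{m,n}`. -/
def eulerDer (i : Fin m) : superDer m n 0 := ⟨del (.inl i), del_mem (.inl i)⟩

/-- The weight space `M_μ = {v | d_i v = μ_i v for all i}`. -/
def ExtWittModule.weightSpace (ρ : ExtWittModule m n M) (μ : Fin m → ℂ) : Submodule ℂ M :=
  ⨅ i, Module.End.eigenspace (ρ.actW 0 (eulerDer i)) (μ i)

/-- `M` is a weight module, i.e. the sum of its weight spaces. -/
def ExtWittModule.IsWeight (ρ : ExtWittModule m n M) : Prop :=
  (⨆ μ : Fin m → ℂ, ρ.weightSpace μ) = ⊤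

/-- `M` is cuspidal: a weight module whose weight spaces have uniformly bounded dimensions. -/
def ExtWittModule.IsCuspidal (ρ : ExtWittModule m n M) : Prop :=
  ρ.IsWeight ∧ ∃ N : ℕ, ∀ μ : Fin m → ℂ, Module.rank ℂ (ρ.weightSpace μ) < (N : Cardinal)

/-- Isomorphism of modules, by an even linear bijection. -/
def ExtWittModule.IsIsomorphic (ρ : ExtWittModule m n M) (ρ' : ExtWittModule m n M') : Prop :=
  ∃ e : M ≃ₗ[ℂ] M', (∀ p, ∀ v ∈ ρ.gr p, e v ∈ ρ'.gr p) ∧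
    (∀ p, ∀ D : superDer m n p, ∀ v, e (ρ.actW p D v) = ρ'.actW p D (e v)) ∧
    ∀ a v, e (ρ.actA a v) = ρ'.actA a (e v)

end

end WittSuper

end

universe u

/-! The module behaves like the sections of a homogeneous bundle on the supertorus and is rebuilt
from its fibre `M / 𝔪M`, where 𝔪 is the maximal ideal of the point `t = 1`, `ξ = 0`. Let Δ be the
span of the `d_i` and `∂/∂ξ_j`. Every vector field is the sum of an element of Δ and a field
vanishing at the point, and fields of the second kind act on the fibre.

The main device is `core ρ U`, the set of vectors all of whose iterated Δ-derivatives lie in U. If U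
contains 𝔪M and is stable under parity and under the fields vanishing at the point, its core is a
graded submodule, hence zero or everything (`core_eq_bot_or_top`). For U = 𝔪M ≠ M this says that a
vector vanishing at the point together with all its derivatives is zero (`core_mM`). For larger U it
makes the fibre simple over the fields vanishing at the point (`eq_mM_or_top`).

All weights lie in one coset of the lattice ℤ^m. The fibre is nonzero, since otherwise a nonzero
weight space would be the sum of its images under the nilpotent, anticommuting `ξ_j` (`mM_ne_top`).
It is a quotient of a weight space, hence finite-dimensional, and it is realized inside `M` as the
vectors of a fixed weight killed by all `∂/∂ξ_j` (`isCompl_topSpace`).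

Fields vanishing to second order act on the fibre by zero (`sq_killed`). The Euler field at the
point acts on the finite-dimensional fibre, and an eigenvector whose eigenvalue has maximal real
part is killed by all fields of positive degree. Coefficients in `A` are polynomials in the
coordinates only up to terms of high order, and fields with such coefficients kill the whole fibre
because ad of the Euler field has finitely many eigenvalues there. The vectors killed by all second
order fields form a stable subspace, which is everything by simplicity. Thus a field acts on the
fibre through its linear part, and the fibre becomes a simple `gl(m,n)`-module (`jac_bracket`,
`sub_linField`, `fibreModule_isSimple`).

Finally, on the realized fibre the difference between the action of a field and the tensor module
formula lies in 𝔪M together with all its derivatives, so it vanishes (`extW_topSpace`). Hence `a ⊗ v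
↦ a v` is a homomorphism. It is onto by simplicity and injective because a Δ-stable subspace of 𝔪 is
zero (`eq_zero_of_mem_stable`). -/

open scoped TensorProduct

namespace WittSuper

/-! ### The point `t = 1`, `ξ = 0`, its maximal ideal and its coordinates. -/

section
variable {m n : ℕ}

/-- Evaluation at the point `t = 1`, `ξ = 0`. -/
noncomputable def eps (m n : ℕ) : A m n →ₐ[ℂ] ℂ :=
  Algebra.TensorProduct.lift (AddMonoidAlgebra.lift ℂ ℂ (Fin m → ℤ) 1)
    (ExteriorAlgebra.algebraMapInv (R := ℂ) (M := Fin n → ℂ)) fun _ _ => Commute.all _ _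

theorem eps_mk (f : Laurent m) (w : Grassmann n) :
    eps m n (mk f w) = AddMonoidAlgebra.lift ℂ ℂ (Fin m → ℤ) 1 f *
      ExteriorAlgebra.algebraMapInv w :=
  Algebra.TensorProduct.lift_tmul _ _ _ _ _

theorem eps_tpow (α : Fin m → ℤ) : eps m n (tpow α) = 1 := by
  simp [tpow, eps_mk]

theorem eps_xi (j : Fin n) : eps m n (xi j) = 0 := by
  simp [xi, eps_mk, ExteriorAlgebra.algebraMapInv]

theorem eps_parity (a : A m n) : eps m n (parity m n a) = eps m n a := by
  induction a using A_induction with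
  | h1 => simp
  | ht α => rw [parity_of_mem (tpow_mem α), sgn_zero_right, one_smul]
  | hx k => rw [parity_of_mem (xi_mem k), map_smul, eps_xi, smul_zero]
  | hadd a b ha hb => simp only [map_add, ha, hb]
  | hmul a b ha hb => simp only [map_mul, ha, hb]
  | hs c a ha => simp only [map_smul, ha]

theorem eps_sig (p : ZMod 2) (a : A m n) : eps m n (sig p a) = eps m n a := by
  rcases zmod2 p with rfl | rfl <;> simp [sig, eps_parity]

theorem eps_odd {a : A m n} (ha : a ∈ grA m n 1) : eps m n a = 0 := by
  have h := eps_parity a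
  rw [parity_of_mem ha, sgn_one_one, neg_one_smul, map_neg] at h
  exact self_eq_neg.1 h.symm

/-- The maximal ideal of the point `t = 1`, `ξ = 0`. -/
noncomputable def mI (m n : ℕ) : Submodule ℂ (A m n) := LinearMap.ker (eps m n).toLinearMap

theorem mem_mI {a : A m n} : a ∈ mI m n ↔ eps m n a = 0 := by
  simp [mI]

theorem mul_mem_mI_left (b : A m n) {a : A m n} (ha : a ∈ mI m n) : b * a ∈ mI m n := by
  rw [mem_mI] at *; simp [ha]

theorem mul_mem_mI_right (b : A m n) {a : A m n} (ha : a ∈ mI m n) : a * b ∈ mI m n := by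
  rw [mem_mI] at *; simp [ha]

theorem sub_eps_mem (a : A m n) : a - eps m n a • (1 : A m n) ∈ mI m n := by
  rw [mem_mI]; simp

theorem parity_mem_mI {a : A m n} (ha : a ∈ mI m n) : parity m n a ∈ mI m n := by
  rw [mem_mI] at *; rw [eps_parity, ha]

theorem mI_sq_le : mI m n * mI m n ≤ mI m n :=
  Submodule.mul_le.2 fun _ _ _ hb => mul_mem_mI_left _ hb

theorem mul_mem_mI_sq_left (b : A m n) {a : A m n} (ha : a ∈ mI m n * mI m n) :
    b * a ∈ mI m n * mI m n := by
  induction ha using Submodule.mul_induction_on' with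
  | mem_mul_mem x hx y hy =>
    rw [← mul_assoc]; exact Submodule.mul_mem_mul (mul_mem_mI_left b hx) hy
  | add x _ y _ hx hy => rw [mul_add]; exact add_mem hx hy

theorem mul_mem_mI_sq_right (b : A m n) {a : A m n} (ha : a ∈ mI m n * mI m n) :
    a * b ∈ mI m n * mI m n := by
  induction ha using Submodule.mul_induction_on' with
  | mem_mul_mem x hx y hy =>
    rw [mul_assoc]; exact Submodule.mul_mem_mul hx (mul_mem_mI_right b hy)
  | add x _ y _ hx hy => rw [add_mul]; exact add_mem hx hy

/-- A superderivation with values in the maximal ideal preserves its square. -/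
theorem superDer_mI_sq {p : ZMod 2} {D : Module.End ℂ (A m n)} (hD : D ∈ superDer m n p)
    (h : ∀ a, D a ∈ mI m n) {a : A m n} (ha : a ∈ mI m n * mI m n) :
    D a ∈ mI m n * mI m n := by
  induction ha using Submodule.mul_induction_on' with
  | mem_mul_mem x hx y hy =>
    rw [superDer_mul hD]
    refine add_mem (Submodule.mul_mem_mul (h x) hy) (Submodule.mul_mem_mul ?_ (h y))
    rw [mem_mI, eps_sig]; exact mem_mI.1 hx
  | add x _ y _ hx hy => rw [map_add]; exact add_mem hx hy

/-- The coordinates `t_i - 1` and `ξ_j` at the point `t = 1`, `ξ = 0`. -/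
noncomputable def crd : Ix m n → A m n :=
  Sum.elim (fun i => tpow (Pi.single i 1) - 1) xi

theorem one_mem_grA : (1 : A m n) ∈ grA m n 0 := by
  rw [← tpow_zero]; exact tpow_mem 0

theorem crd_mem (b : Ix m n) : (crd b : A m n) ∈ grA m n (par b) := by
  rcases b with i | j
  · exact sub_mem (tpow_mem _) one_mem_grA
  · exact xi_mem j

theorem crd_mem_mI (b : Ix m n) : (crd b : A m n) ∈ mI m n := by
  rw [mem_mI]
  rcases b with i | j
  · simp [crd, eps_tpow]
  · exact eps_xi j

theorem del_one (b : Ix m n) : (del b (1 : A m n)) = 0 := superDer_one (del_mem b)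

theorem del_crd (a b : Ix m n) : eps m n (del a (crd b)) = if a = b then 1 else 0 := by
  rcases b with i | j
  · rcases a with k | k
    · simp only [crd, Sum.elim_inl, map_sub, del_one, del_tpow, map_smul, eps_tpow, sub_zero]
      by_cases h : k = i
      · subst h; simp
      · simp [h]
    · simp [crd, del_one, del_tpow_odd]
  · rcases a with k | k
    · simp [crd, del_xi_even]
    · simp only [crd, Sum.elim_inr, del_xi]
      by_cases h : k = j
      · subst h; simp
      · simp [h]

/-! ### Coordinate derivations and the grading by the Euler field. -/

theorem mulLeft_mul_mem {p q : ZMod 2} {x : A m n} {D : Module.End ℂ (A m n)}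
    (hx : x ∈ grA m n p) (hD : D ∈ superDer m n q) :
    LinearMap.mulLeft ℂ x * D ∈ superDer m n (p + q) := by
  refine ⟨fun i a ha => ?_, fun i a ha b => ?_⟩
  · rw [Module.End.mul_apply, LinearMap.mulLeft_apply, add_assoc]
    exact grA_mul hx (hD.1 i a ha)
  · simp only [Module.End.mul_apply, LinearMap.mulLeft_apply]
    rw [hD.2 i a ha, mul_add, mul_smul_comm, ← mul_assoc, ← mul_assoc, ← mul_assoc,
      supercomm ha x, sig_of_mem i hx, smul_mul_assoc, smul_mul_assoc, smul_smul, sgn_add_left,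
      sgn_comm i p, mul_right_comm, sgn_mul_self, one_mul]

/-- The derivations `∂/∂t_i` and `∂/∂ξ_j`. -/
noncomputable def pd : Ix m n → Module.End ℂ (A m n) :=
  Sum.elim (fun i => LinearMap.mulLeft ℂ (tpow (-Pi.single i 1)) * del (.inl i))
    (fun j => del (.inr j))

theorem pd_mem (b : Ix m n) : (pd b : Module.End ℂ (A m n)) ∈ superDer m n (par b) := by
  rcases b with i | j
  · have := mulLeft_mul_mem (tpow_mem (-Pi.single i 1)) (del_mem (m := m) (n := n) (.inl i))
    rwa [zero_add] at this
  · exact del_mem (.inr j)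

/-- The basis `pd` is exactly dual to the coordinates (`pd_crd`), whereas the `del` basis is dual to
them only at the point. This exactness gives clean degrees under the Euler field. -/
theorem superDer_eq_pd {p : ZMod 2} {D : Module.End ℂ (A m n)} (hD : D ∈ superDer m n p) :
    D = ∑ b, LinearMap.mulLeft ℂ (D (crd b)) * pd b := by
  refine LinearMap.ext fun a => ?_
  rw [superDer_eq hD a, LinearMap.sum_apply]
  refine Finset.sum_congr rfl fun b _ => ?_
  rcases b with i | j
  · simp only [crd, pd, coef, Sum.elim_inl, Module.End.mul_apply, LinearMap.mulLeft_apply,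
      LinearMap.comp_apply, map_sub, superDer_one hD, sub_zero, LinearMap.applyₗ_apply_apply]
    rw [← mul_assoc, tpow_comm]
  · rfl

theorem pd_crd (a b : Ix m n) : (pd a (crd b) : A m n) = if a = b then 1 else 0 := by
  rcases b with i | j
  · rcases a with k | k
    · simp only [pd, crd, Sum.elim_inl, map_sub, Module.End.mul_apply, LinearMap.mulLeft_apply,
        del_one, del_tpow, sub_zero, mul_smul_comm, mul_zero]
      by_cases h : k = i
      · subst h; simp [← tpow_add, tpow_zero]
      · simp [h]
    · simp [pd, crd, del_one, del_tpow_odd]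
  · rcases a with k | k
    · simp [pd, crd, del_xi_even]
    · simp only [pd, crd, Sum.elim_inr, del_xi]
      by_cases h : k = j
      · subst h; simp
      · simp [h]

/-- Reduces identities between fields, in particular bracket computations, to the values on the
coordinates. The two parities may differ formally. -/
theorem superDer_ext {p q : ZMod 2} {D F : Module.End ℂ (A m n)} (hD : D ∈ superDer m n p)
    (hF : F ∈ superDer m n q) (h : ∀ b, D (crd b) = F (crd b)) : D = F := by
  rw [superDer_eq_pd hD, superDer_eq_pd hF]
  simp only [h]

/-- The Euler field at the point `t = 1`, `ξ = 0`. -/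
noncomputable def eul (m n : ℕ) : Module.End ℂ (A m n) :=
  ∑ b, LinearMap.mulLeft ℂ (crd b) * pd b

theorem eul_mem : eul m n ∈ superDer m n 0 := by
  refine Submodule.sum_mem _ fun b _ => ?_
  have := mulLeft_mul_mem (crd_mem b) (pd_mem (m := m) (n := n) b)
  rwa [CharTwo.add_self_eq_zero] at this

theorem eul_mem_mI (a : A m n) : eul m n a ∈ mI m n := by
  rw [eul, LinearMap.sum_apply]
  exact Submodule.sum_mem _ fun b _ => mul_mem_mI_right _ (crd_mem_mI b)

theorem eul_crd (b : Ix m n) : eul m n (crd b) = crd b := by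
  simp only [eul, LinearMap.sum_apply, Module.End.mul_apply, LinearMap.mulLeft_apply, pd_crd,
    mul_ite, mul_one, mul_zero, Finset.sum_ite_eq', Finset.mem_univ, if_true]

theorem eul_mul (a b : A m n) : eul m n (a * b) = eul m n a * b + a * eul m n b := by
  rw [superDer_mul eul_mem]; simp [sig]

theorem eul_pd (b : Ix m n) : eul m n * pd b - pd b * eul m n = - pd b := by
  have h0 := bracket_mem eul_mem (pd_mem (m := m) (n := n) b)
  rw [sgn_zero_left, one_smul] at h0
  refine superDer_ext h0 (neg_mem (pd_mem b)) fun c => ?_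
  simp only [LinearMap.sub_apply, Module.End.mul_apply, pd_crd, LinearMap.neg_apply, eul_crd]
  split_ifs <;> simp [superDer_one eul_mem]

/-- The derivation `pd b` has degree -1, so a coefficient of degree r gives a field of degree r - 1.
Coefficients of degree at least two therefore give fields of positive degree. -/
theorem eul_mulLeft_pd {r : ℂ} {f : A m n} (hf : eul m n f = r • f) (b : Ix m n) :
    eul m n * (LinearMap.mulLeft ℂ f * pd b) - LinearMap.mulLeft ℂ f * pd b * eul m n =
      (r - 1) • (LinearMap.mulLeft ℂ f * pd b) := by
  refine LinearMap.ext fun a => ?_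
  have h := LinearMap.congr_fun (eul_pd b) a
  simp only [LinearMap.sub_apply, Module.End.mul_apply, LinearMap.neg_apply, LinearMap.smul_apply,
    LinearMap.mulLeft_apply, eul_mul, hf] at h ⊢
  rw [sub_eq_iff_eq_add.1 h, sub_smul, one_smul, mul_add, smul_mul_assoc, mul_neg]
  abel

theorem eul_pow (i : Fin m) (k : ℕ) :
    eul m n (crd (.inl i) ^ k) = (k : ℂ) • crd (.inl i) ^ k := by
  induction k with
  | zero => simp [superDer_one eul_mem]
  | succ k ih =>
    rw [pow_succ, eul_mul, ih, eul_crd, smul_mul_assoc, ← pow_succ]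
    push_cast
    rw [add_smul, one_smul]

/-- The span of the coordinates. -/
noncomputable def lin (m n : ℕ) : Submodule ℂ (A m n) := Submodule.span ℂ (Set.range crd)

theorem eul_lin_pow {r : ℕ} {f : A m n} (hf : f ∈ lin m n ^ r) : eul m n f = (r : ℂ) • f := by
  induction hf using Submodule.pow_induction_on_left' with
  | algebraMap c => simp [Algebra.algebraMap_eq_smul_one, superDer_one eul_mem]
  | add x y i hx hy h1 h2 => rw [map_add, h1, h2, smul_add]
  | mem_mul x hx i y hy h =>
    have h' : eul m n x = x := by
      induction hx using Submodule.span_induction with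
      | mem x hx => obtain ⟨b, rfl⟩ := hx; exact eul_crd b
      | zero => simp
      | add x y _ _ hx hy => rw [map_add, hx, hy]
      | smul c x _ hx => rw [map_smul, hx]
    rw [eul_mul, h', h, mul_smul_comm, Nat.succ_eq_add_one]
    push_cast
    rw [add_smul, one_smul, add_comm]

theorem lin_le : lin m n ≤ mI m n :=
  Submodule.span_le.2 (by rintro _ ⟨b, rfl⟩; exact crd_mem_mI b)

theorem lin_pow_le (r : ℕ) : lin m n ^ (r + 2) ≤ mI m n * mI m n := by
  rw [pow_succ, pow_succ, mul_assoc]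
  refine Submodule.mul_le.2 fun x _ y hy => mul_mem_mI_sq_left x ?_
  exact mul_le_mul' lin_le lin_le hy

/-! ### Taylor expansion and approximation by polynomials in the coordinates. -/

theorem tpow_generators {P : A m n → Prop} (h1 : P 1) (ht : ∀ i, P (tpow (Pi.single i 1)))
    (hi : ∀ i, P (tpow (-Pi.single i 1))) (hmul : ∀ a b, P a → P b → P (a * b))
    (α : Fin m → ℤ) : P (tpow α) := by
  rw [← Finset.univ_sum_single α]
  refine Finset.sum_induction _ (fun β => P (tpow β)) (fun β γ hb hc => ?_)
    (by rw [tpow_zero]; exact h1) fun i _ => ?_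
  · rw [tpow_add]; exact hmul _ _ hb hc
  · generalize α i = k
    induction k using Int.induction_on with
    | zero => rw [Pi.single_zero, tpow_zero]; exact h1
    | succ k ih => rw [Pi.single_add, tpow_add]; exact hmul _ _ ih (ht i)
    | pred k ih =>
      rw [Pi.single_sub, sub_eq_add_neg, tpow_add]; exact hmul _ _ ih (hi i)

theorem tpow_neg_mul (α : Fin m → ℤ) : (tpow (-α) * tpow α : A m n) = 1 := by
  rw [← tpow_add, neg_add_cancel, tpow_zero]

/-- First order Taylor expansion at the point `t = 1`, `ξ = 0`. -/
theorem taylor (x : A m n) :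
    x - eps m n x • (1 : A m n) - ∑ a, eps m n (del a x) • crd a ∈ mI m n * mI m n := by
  induction x using A_induction with
  | h1 => simp [del_one]
  | ht α =>
    refine tpow_generators (P := fun x : A m n => x - eps m n x • (1 : A m n) -
      ∑ a, eps m n (del a x) • crd a ∈ mI m n * mI m n) ?_ ?_ ?_ ?_ α
    · simp [del_one]
    · intro i
      rw [Fintype.sum_sum_type]
      simp only [del_tpow, del_tpow_odd, map_smul, eps_tpow]
      rw [Finset.sum_eq_single i (by intro b _ hb; simp [hb]) (by simp)]
      simp [crd]
    · intro i
      rw [Fintype.sum_sum_type]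
      simp only [del_tpow, del_tpow_odd, map_smul, eps_tpow]
      rw [Finset.sum_eq_single i (by intro b _ hb; simp [hb]) (by simp)]
      -- The remainder of `t⁻¹` is `t⁻¹ + t - 2`, which factors as `(t - 1)(1 - t⁻¹)`.
      have h := Submodule.mul_mem_mul (crd_mem_mI (m := m) (n := n) (.inl i))
        (Submodule.neg_mem _ (sub_eps_mem (m := m) (n := n) (tpow (-Pi.single i 1))))
      rw [eps_tpow] at h
      have e := tpow_neg_mul (m := m) (n := n) (Pi.single i 1)
      rw [← tpow_comm] at e
      convert h using 1
      simp [crd, mul_sub, sub_mul, e]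
      abel
    · intro a b ha hb
      exact taylor_mul ha hb
  | hx j =>
    rw [Fintype.sum_sum_type]
    simp only [del_xi_even, del_xi, eps_xi]
    rw [Finset.sum_eq_zero (by simp), Finset.sum_eq_single j (by intro b _ hb; simp [hb]) (by simp)]
    simp [crd]
  | hadd a b ha hb =>
    have e : a + b - eps m n (a + b) • (1 : A m n) - ∑ c, eps m n (del c (a + b)) • crd c =
        (a - eps m n a • (1 : A m n) - ∑ c, eps m n (del c a) • crd c) +
        (b - eps m n b • (1 : A m n) - ∑ c, eps m n (del c b) • crd c) := by
      simp only [map_add, add_smul, Finset.sum_add_distrib]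
      abel
    rw [e]
    exact add_mem ha hb
  | hmul a b ha hb => exact taylor_mul ha hb
  | hs c a ha =>
    have e : c • a - eps m n (c • a) • (1 : A m n) - ∑ b, eps m n (del b (c • a)) • crd b =
        c • (a - eps m n a • (1 : A m n) - ∑ b, eps m n (del b a) • crd b) := by
      simp only [map_smul, smul_eq_mul, mul_smul, smul_sub, Finset.smul_sum]
    rw [e]
    exact Submodule.smul_mem _ c ha
where
  taylor_mul {a b : A m n}
    (ha : a - eps m n a • (1 : A m n) - ∑ c, eps m n (del c a) • crd c ∈ mI m n * mI m n)
    (hb : b - eps m n b • (1 : A m n) - ∑ c, eps m n (del c b) • crd c ∈ mI m n * mI m n) :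
    a * b - eps m n (a * b) • (1 : A m n) - ∑ c, eps m n (del c (a * b)) • crd c ∈
      mI m n * mI m n := by
    -- The remainder of a product is `(a - ε(a))(b - ε(b))` plus `ε(b)` times the remainder of `a`
    -- plus `ε(a)` times that of `b`. The Koszul signs disappear under `ε`.
    have h1 := Submodule.mul_mem_mul (sub_eps_mem a) (sub_eps_mem b)
    convert add_mem h1 (add_mem (Submodule.smul_mem _ (eps m n b) ha)
      (Submodule.smul_mem _ (eps m n a) hb)) using 1
    simp only [superDer_mul (del_mem _), map_add, map_mul, eps_sig, add_smul,
      Finset.sum_add_distrib, smul_sub, sub_mul, mul_sub, Finset.smul_sum, smul_smul,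
      smul_mul_assoc, mul_smul_comm, one_mul, mul_one, mul_comm (eps m n b)]
    abel

/-- The ideal generated by the `K`-th powers of the even coordinates. -/
noncomputable def powI (m n K : ℕ) : Submodule ℂ (A m n) :=
  Submodule.span ℂ {z | ∃ (i : Fin m) (a : A m n), z = crd (.inl i) ^ K * a}

theorem even_comm {x : A m n} (hx : x ∈ grA m n 0) (y : A m n) : x * y = y * x := by
  rw [supercomm hx]; simp [sig]

theorem crd_pow_mem (i : Fin m) (K : ℕ) : (crd (.inl i) ^ K : A m n) ∈ grA m n 0 := by
  induction K with
  | zero => exact one_mem_grA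
  | succ K ih =>
    have h := grA_mul ih (crd_mem (.inl i))
    simp only [par, Sum.elim_inl, add_zero] at h
    rwa [pow_succ]

theorem powI_mul_right {K : ℕ} {z : A m n} (hz : z ∈ powI m n K) (b : A m n) :
    z * b ∈ powI m n K := by
  induction hz using Submodule.span_induction with
  | mem x hx =>
    obtain ⟨i, a, rfl⟩ := hx
    exact Submodule.subset_span ⟨i, a * b, mul_assoc _ _ _⟩
  | zero => simp
  | add x y _ _ hx hy => rw [add_mul]; exact add_mem hx hy
  | smul c x _ hx => rw [smul_mul_assoc]; exact Submodule.smul_mem _ _ hx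

theorem powI_mul_left {K : ℕ} {z : A m n} (hz : z ∈ powI m n K) (b : A m n) :
    b * z ∈ powI m n K := by
  induction hz using Submodule.span_induction with
  | mem x hx =>
    obtain ⟨i, a, rfl⟩ := hx
    refine Submodule.subset_span ⟨i, b * a, ?_⟩
    rw [← mul_assoc, ← mul_assoc, even_comm (crd_pow_mem i K) b]
  | zero => simp
  | add x y _ _ hx hy => rw [mul_add]; exact add_mem hx hy
  | smul c x _ hx => rw [mul_smul_comm]; exact Submodule.smul_mem _ _ hx

theorem powI_le (K : ℕ) : powI m n (K + 2) ≤ mI m n * mI m n := by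
  refine Submodule.span_le.2 ?_
  rintro _ ⟨i, a, rfl⟩
  refine mul_mem_mI_sq_right a ?_
  rw [pow_succ, pow_succ, mul_assoc]
  exact mul_mem_mI_sq_left _ (Submodule.mul_mem_mul (crd_mem_mI _) (crd_mem_mI _))

/-- Modulo high powers of the even coordinates, every element of `A_{m,n}` is a polynomial in the
coordinates. -/
theorem poly_add_powI (K : ℕ) (a : A m n) :
    ∃ p ∈ Algebra.adjoin ℂ (Set.range (crd : Ix m n → A m n)), a - p ∈ powI m n K := by
  have hmul : ∀ a b : A m n,
      (∃ p ∈ Algebra.adjoin ℂ (Set.range (crd : Ix m n → A m n)), a - p ∈ powI m n K) →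
      (∃ p ∈ Algebra.adjoin ℂ (Set.range (crd : Ix m n → A m n)), b - p ∈ powI m n K) →
      ∃ p ∈ Algebra.adjoin ℂ (Set.range (crd : Ix m n → A m n)), a * b - p ∈ powI m n K := by
    rintro a b ⟨p, hp, h1⟩ ⟨q, hq, h2⟩
    refine ⟨p * q, mul_mem hp hq, ?_⟩
    convert add_mem (powI_mul_right h1 b) (powI_mul_left h2 p) using 1
    noncomm_ring
  have hc : ∀ b, (crd b : A m n) ∈ Algebra.adjoin ℂ (Set.range (crd : Ix m n → A m n)) :=
    fun b => Algebra.subset_adjoin ⟨b, rfl⟩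
  induction a using A_induction with
  | h1 => exact ⟨1, one_mem _, by simp⟩
  | ht α =>
    refine tpow_generators (P := fun a : A m n =>
      ∃ p ∈ Algebra.adjoin ℂ (Set.range (crd : Ix m n → A m n)), a - p ∈ powI m n K)
      ⟨1, one_mem _, by simp⟩ (fun i => ⟨crd (.inl i) + 1, add_mem (hc _) (one_mem _), ?_⟩)
      -- With `x = t - 1`, the inverse `t⁻¹ = 1/(1 + x)` is approximated by the truncated geometric
      -- series, and the error is `(-x)^K t⁻¹`.
      (fun i => ⟨∑ k ∈ Finset.range K, (- crd (.inl i)) ^ k,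
        sum_mem fun k _ => pow_mem (neg_mem (hc _)) k, ?_⟩) hmul α
    · simp [crd]
    · refine Submodule.subset_span ⟨i, (-1) ^ K * tpow (-Pi.single i 1), ?_⟩
      have h : (tpow (-Pi.single i 1) : A m n) * (1 - (- crd (.inl i))) = 1 := by
        simp [crd, tpow_neg_mul]
      have h2 : (1 - (- crd (.inl i) : A m n)) * ∑ k ∈ Finset.range K, (- crd (.inl i)) ^ k =
          1 - (- crd (.inl i)) ^ K := mul_neg_geom_sum _ _
      calc _ = (tpow (-Pi.single i 1) : A m n) - (tpow (-Pi.single i 1) *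
            (1 - (- crd (.inl i)))) * ∑ k ∈ Finset.range K, (- crd (.inl i)) ^ k := by
              rw [h, one_mul]
        _ = _ := by
          rw [mul_assoc, h2, mul_sub, mul_one, sub_sub_cancel, neg_pow, ← mul_assoc,
            ← even_comm (crd_pow_mem i K), ← tpow_comm, ← mul_assoc]
  | hx j => exact ⟨crd (.inr j), hc _, by simp [crd]⟩
  | hadd a b ha hb =>
    obtain ⟨p, hp, h1⟩ := ha
    obtain ⟨q, hq, h2⟩ := hb
    exact ⟨p + q, add_mem hp hq, by convert add_mem h1 h2 using 1; abel⟩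
  | hmul a b ha hb => exact hmul a b ha hb
  | hs c a ha =>
    obtain ⟨p, hp, h1⟩ := ha
    exact ⟨c • p, Subalgebra.smul_mem _ hp c, by
      rw [← smul_sub]; exact Submodule.smul_mem _ _ h1⟩

theorem adjoin_crd_le : Subalgebra.toSubmodule (Algebra.adjoin ℂ (Set.range (crd : Ix m n → A m n)))
    ≤ ⨆ r : ℕ, lin m n ^ r := by
  intro p hp
  induction hp using Algebra.adjoin_induction with
  | mem x hx =>
    exact Submodule.mem_iSup_of_mem 1 (by rw [pow_one]; exact Submodule.subset_span hx)
  | algebraMap c =>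
    exact Submodule.mem_iSup_of_mem 0 (by rw [pow_zero]; exact Submodule.algebraMap_mem c)
  | add x y _ _ hx hy => exact add_mem hx hy
  | mul x y _ _ hx hy =>
    have h := Submodule.mul_mem_mul hx hy
    rw [Submodule.iSup_mul] at h
    refine (iSup_le fun i => ?_ : _ ≤ ⨆ r : ℕ, lin m n ^ r) h
    rw [Submodule.mul_iSup]
    refine iSup_le fun j => ?_
    rw [← pow_add]
    exact le_iSup (fun r => lin m n ^ r) (i + j)

/-- The square of the maximal ideal, modulo high powers of the even coordinates. -/
theorem mI_sq_le_iSup (K : ℕ) :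
    mI m n * mI m n ≤ (⨆ r : ℕ, lin m n ^ (r + 2)) ⊔ powI m n (K + 2) := by
  intro f hf
  obtain ⟨p, hp, hq⟩ := poly_add_powI (K + 2) f
  have h1 : p ∈ (lin m n ^ 0 ⊔ lin m n ^ 1) ⊔ ⨆ r : ℕ, lin m n ^ (r + 2) := by
    refine (iSup_le fun r => ?_ : (⨆ r : ℕ, lin m n ^ r) ≤ _) (adjoin_crd_le hp)
    rcases r with _ | _ | r
    · exact le_sup_of_le_left le_sup_left
    · exact le_sup_of_le_left le_sup_right
    · exact le_sup_of_le_right (le_iSup (fun r => lin m n ^ (r + 2)) r)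
  obtain ⟨u, hu, p2, hp2, rfl⟩ := Submodule.mem_sup.1 h1
  obtain ⟨u0, hu0, u1, hu1, rfl⟩ := Submodule.mem_sup.1 hu
  have hp2' : p2 ∈ mI m n * mI m n := iSup_le lin_pow_le hp2
  -- The part of degree at most one lies in 𝔪², because `f`, the part of degree at least two and the
  -- error do. The exponent `K + 2` serves to put the error into 𝔪².
  have hu' : u0 + u1 ∈ mI m n * mI m n := by
    have : u0 + u1 = f - (f - (u0 + u1 + p2)) - p2 := by abel
    rw [this]
    exact sub_mem (sub_mem hf (powI_le _ hq)) hp2'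
  rw [pow_zero, Submodule.mem_one] at hu0
  obtain ⟨c, rfl⟩ := hu0
  rw [pow_one, lin, Submodule.mem_span_range_iff_exists_fun] at hu1
  obtain ⟨d, rfl⟩ := hu1
  -- By the Leibniz rule the functionals `ε ∘ ∂_a` vanish on 𝔪². They read off the linear
  -- coefficients, which are therefore zero.
  have hdel : ∀ x ∈ mI m n * mI m n, ∀ a, eps m n (del a x) = 0 := by
    intro x hx a
    induction hx using Submodule.mul_induction_on' with
    | mem_mul_mem x hx y hy =>
      rw [superDer_mul (del_mem a), map_add, map_mul, map_mul, eps_sig, mem_mI.1 hx, mem_mI.1 hy]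
      simp
    | add x _ y _ hx hy => rw [map_add, map_add, hx, hy, add_zero]
  have hc : c = 0 := by
    have h := mem_mI.1 (mI_sq_le hu')
    simp only [map_add, map_sum, map_smul, mem_mI.1 (crd_mem_mI _), AlgHom.commutes] at h
    simpa using h
  subst hc
  have hd : ∀ a, d a = 0 := by
    intro a
    have h := hdel _ hu' a
    simpa only [map_add, map_sum, map_smul, map_zero, zero_add, del_crd, smul_eq_mul, mul_ite,
      mul_one, mul_zero, Finset.sum_ite_eq, Finset.mem_univ, if_true] using h
  have hz : (algebraMap ℂ (A m n) 0 + ∑ i, d i • crd i) = 0 := by simp [hd]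
  rw [hz, zero_add] at hq
  have : f = p2 + (f - p2) := by abel
  rw [this]
  exact Submodule.add_mem_sup hp2 hq

theorem pd_crd_pow_same (i : Fin m) (k : ℕ) :
    (pd (.inl i) (crd (.inl i) ^ k) : A m n) = (k : ℂ) • crd (.inl i) ^ (k - 1) := by
  induction k with
  | zero => simp [superDer_one (pd_mem _)]
  | succ k ih =>
    rw [pow_succ, superDer_mul (pd_mem _), ih, pd_crd, if_pos rfl]
    rcases k with _ | k
    · simp [par, sig]
    · simp only [par, sig, Sum.elim_inl, if_true, AlgHom.id_apply, add_tsub_cancel_right, mul_one,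
        smul_mul_assoc, ← pow_succ]
      rw [Nat.cast_succ (k + 1), add_smul, one_smul]

theorem pd_crd_pow_ne {i : Fin m} {b : Ix m n} (hb : b ≠ .inl i) (k : ℕ) :
    (pd b (crd (.inl i) ^ k) : A m n) = 0 := by
  induction k with
  | zero => simp [superDer_one (pd_mem _)]
  | succ k ih => rw [pow_succ, superDer_mul (pd_mem _), ih, pd_crd, if_neg hb]; simp

end

/-! ### Parity operators and graded subspaces. -/

section
variable {V : Type*} [AddCommGroup V] [Module ℂ V]

theorem exists_parityOp {gr : ZMod 2 → Submodule ℂ V} (h : DirectSum.IsInternal gr) :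
    ∃ s : Module.End ℂ V, (∀ p v, v ∈ gr p ↔ s v = sgn 1 p • v) ∧ ∀ v, s (s v) = v := by
  rw [isInternal_iff] at h
  set s : V →ₗ[ℂ] V := LinearMap.ofIsCompl h (gr 0).subtype (-(gr 1).subtype) with hs
  have hs' : ∀ q, ∀ v ∈ gr q, s v = sgn 1 q • v := by
    intro q v hv
    rcases zmod2 q with rfl | rfl
    · rw [hs, sgn_zero_right, one_smul]
      exact LinearMap.ofIsCompl_apply_left h ⟨v, hv⟩
    · rw [hs, sgn_one_one, neg_one_smul]
      exact LinearMap.ofIsCompl_apply_right h ⟨v, hv⟩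
  have hdec : ∀ v, ∃ x ∈ gr 0, ∃ y ∈ gr 1, x + y = v := fun v =>
    Submodule.mem_sup.1 (by rw [h.sup_eq_top]; trivial)
  refine ⟨s, fun p v => ⟨hs' p v, fun hv => ?_⟩, fun v => ?_⟩
  · obtain ⟨x, hx, y, hy, rfl⟩ := hdec v
    rw [map_add, hs' 0 x hx, hs' 1 y hy] at hv
    rcases zmod2 p with rfl | rfl
    · rw [sgn_zero_right, sgn_one_one, one_smul, one_smul, neg_one_smul, add_right_inj] at hv
      rwa [neg_eq_self hv.symm, add_zero]
    · rw [sgn_zero_right, sgn_one_one, one_smul, neg_one_smul, neg_one_smul, neg_add,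
        add_left_inj] at hv
      rwa [neg_eq_self hv, zero_add]
  · obtain ⟨x, hx, y, hy, rfl⟩ := hdec v
    rw [map_add, hs' 0 x hx, hs' 1 y hy, map_add, map_smul, map_smul, hs' 0 x hx, hs' 1 y hy,
      smul_smul, smul_smul, sgn_mul_self, sgn_mul_self, one_smul, one_smul]

/-- The parity operator of a superspace. -/
noncomputable def parityOp {gr : ZMod 2 → Submodule ℂ V} (h : DirectSum.IsInternal gr) :
    Module.End ℂ V := (exists_parityOp h).choose

theorem mem_gr_iff {gr : ZMod 2 → Submodule ℂ V} (h : DirectSum.IsInternal gr) {p : ZMod 2}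
    {v : V} : v ∈ gr p ↔ parityOp h v = sgn 1 p • v := (exists_parityOp h).choose_spec.1 p v

theorem parityOp_parityOp {gr : ZMod 2 → Submodule ℂ V} (h : DirectSum.IsInternal gr) (v : V) :
    parityOp h (parityOp h v) = v := (exists_parityOp h).choose_spec.2 v

theorem exists_gr_add {gr : ZMod 2 → Submodule ℂ V} (h : DirectSum.IsInternal gr)
    {N : Submodule ℂ V} (hN : ∀ v ∈ N, parityOp h v ∈ N) {v : V} (hv : v ∈ N) :
    ∃ x ∈ N ⊓ gr 0, ∃ y ∈ N ⊓ gr 1, v = x + y := by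
  refine ⟨(2⁻¹ : ℂ) • (v + parityOp h v),
    ⟨Submodule.smul_mem _ _ (add_mem hv (hN v hv)), (mem_gr_iff h).2 ?_⟩,
    (2⁻¹ : ℂ) • (v - parityOp h v),
    ⟨Submodule.smul_mem _ _ (sub_mem hv (hN v hv)), (mem_gr_iff h).2 ?_⟩, ?_⟩
  · rw [map_smul, map_add, parityOp_parityOp, sgn_zero_right, one_smul, add_comm]
  · rw [map_smul, map_sub, parityOp_parityOp, sgn_one_one, neg_one_smul, ← smul_neg, neg_sub]
  · rw [← smul_add]
    have : v + parityOp h v + (v - parityOp h v) = (2 : ℂ) • v := by rw [two_smul]; abel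
    rw [this, smul_smul]; norm_num

/-- The homogeneous components of `v` are `(v ± s v)/2` for the parity operator `s`. Gradedness thus
becomes a stability condition, which can be checked like the other submodule conditions. -/
theorem isGraded_iff {gr : ZMod 2 → Submodule ℂ V} (h : DirectSum.IsInternal gr)
    {N : Submodule ℂ V} : IsGraded gr N ↔ ∀ v ∈ N, parityOp h v ∈ N := by
  constructor
  · intro hN v hv
    rw [IsGraded] at hN
    rw [hN] at hv
    induction hv using Submodule.iSup_induction' with
    | mem p x hx =>
      rw [(mem_gr_iff h).1 hx.2]; exact Submodule.smul_mem _ _ hx.1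
    | zero => simp
    | add x y _ _ hx hy => rw [map_add]; exact add_mem hx hy
  · intro hN
    refine le_antisymm (fun v hv => ?_) (iSup_le fun p => inf_le_left)
    obtain ⟨x, hx, y, hy, rfl⟩ := exists_gr_add h hN hv
    exact add_mem (Submodule.mem_iSup_of_mem 0 hx) (Submodule.mem_iSup_of_mem 1 hy)

end

/-! ### The action of vector fields on the module as one linear map. -/

section
variable {m n : ℕ}

theorem superDer_disjoint {D : Module.End ℂ (A m n)} (h0 : D ∈ superDer m n 0)
    (h1 : D ∈ superDer m n 1) : D = 0 := by
  refine grA_ext fun q a ha => ?_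
  have e0 := mem_grA_iff.1 (h0.1 q a ha)
  have e1 := mem_grA_iff.1 (h1.1 q a ha)
  rw [e1, zero_add, sgn_add_right, sgn_one_one, mul_smul, neg_one_smul] at e0
  have h2 := neg_eq_self e0.symm
  rcases zmod2 q with rfl | rfl
  · simpa [sgn_zero_right] using h2
  · simpa [sgn_one_one] using h2

variable {M : Type*} [AddCommGroup M] [Module ℂ M]

/-- Even and odd superderivations meet only in zero, so their sum embeds into the operators on `A`,
and any linear left inverse of this embedding transports the two actions. The values away from
superderivations are arbitrary and carry no information. -/
theorem exists_extW (ρ : ExtWittModule m n M) :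
    ∃ φ : Module.End ℂ (A m n) →ₗ[ℂ] Module.End ℂ M,
      ∀ p (D : superDer m n p), φ D.1 = ρ.actW p D := by
  set ι : (superDer m n 0 × superDer m n 1) →ₗ[ℂ] Module.End ℂ (A m n) :=
    LinearMap.coprod (superDer m n 0).subtype (superDer m n 1).subtype with hι
  have hker : LinearMap.ker ι = ⊥ := by
    rw [LinearMap.ker_eq_bot']
    rintro ⟨D, F⟩ h
    simp only [hι, LinearMap.coprod_apply, Submodule.subtype_apply] at h
    have hD : (D : Module.End ℂ (A m n)) = -F := eq_neg_of_add_eq_zero_left h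
    have h0 : (D : Module.End ℂ (A m n)) = 0 :=
      superDer_disjoint D.2 (by rw [hD]; exact neg_mem F.2)
    rw [h0, zero_add] at h
    exact Prod.ext (Subtype.ext h0) (Subtype.ext h)
  obtain ⟨g, hg⟩ := LinearMap.exists_leftInverse_of_injective
    (V := superDer m n 0 × superDer m n 1) (V' := Module.End ℂ (A m n)) ι hker
  refine ⟨LinearMap.coprod (ρ.actW 0) (ρ.actW 1) ∘ₗ g, fun p D => ?_⟩
  rcases zmod2 p with rfl | rfl
  · have h : g D.1 = (D, 0) := by
      have := LinearMap.congr_fun hg (D, 0)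
      simpa [hι] using this
    simp [h]
  · have h : g D.1 = (0, D) := by
      have := LinearMap.congr_fun hg (0, D)
      simpa [hι] using this
    simp [h]

/-- The action of the Witt superalgebra, extended linearly to all operators on `A_{m,n}`. -/
noncomputable def extW (ρ : ExtWittModule m n M) :
    Module.End ℂ (A m n) →ₗ[ℂ] Module.End ℂ M := (exists_extW ρ).choose

theorem extW_coe (ρ : ExtWittModule m n M) {p : ZMod 2} (D : superDer m n p) :
    extW ρ D.1 = ρ.actW p D := (exists_extW ρ).choose_spec p D

variable (ρ : ExtWittModule m n M) {p q : ZMod 2} {D F : Module.End ℂ (A m n)}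

theorem extW_mem (hD : D ∈ superDer m n p) {v : M} (hv : v ∈ ρ.gr q) :
    extW ρ D v ∈ ρ.gr (p + q) := by
  have := ρ.actW_mem p q ⟨D, hD⟩ v hv
  rwa [← extW_coe] at this

theorem extW_bracket (hD : D ∈ superDer m n p) (hF : F ∈ superDer m n q) :
    extW ρ (D * F - sgn p q • (F * D)) =
      extW ρ D * extW ρ F - sgn p q • (extW ρ F * extW ρ D) := by
  have := ρ.actW_bracket p q ⟨D, hD⟩ ⟨F, hF⟩
  rwa [← extW_coe, ← extW_coe, ← extW_coe] at this

/-- The form of the bracket relation used to move one field past another in inductions along words.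
-/
theorem extW_comp (hD : D ∈ superDer m n p) (hF : F ∈ superDer m n q) (v : M) :
    extW ρ D (extW ρ F v) = extW ρ (D * F - sgn p q • (F * D)) v +
      sgn p q • extW ρ F (extW ρ D v) := by
  rw [extW_bracket ρ hD hF]
  simp

theorem extW_actA (hD : D ∈ superDer m n p) (a : A m n) (v : M) :
    extW ρ D (ρ.actA a v) = ρ.actA (D a) v + ρ.actA (sig p a) (extW ρ D v) := by
  have h : LinearMap.applyₗ v ∘ₗ (LinearMap.mulLeft ℂ (extW ρ D)) ∘ₗ ρ.actA =
      LinearMap.applyₗ v ∘ₗ ρ.actA ∘ₗ D +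
        LinearMap.applyₗ (extW ρ D v) ∘ₗ ρ.actA ∘ₗ (sig p).toLinearMap := by
    refine grA_ext fun q a ha => ?_
    have h := LinearMap.congr_fun (ρ.actW_actA p q ⟨D, hD⟩ a ha) v
    rw [← extW_coe] at h
    simp only [LinearMap.sub_apply, LinearMap.smul_apply, Module.End.mul_apply] at h
    simp only [LinearMap.comp_apply, LinearMap.add_apply, LinearMap.applyₗ_apply_apply,
      LinearMap.mulLeft_apply, AlgHom.toLinearMap_apply, sig_of_mem p ha, map_smul, h,
      Module.End.mul_apply]
    abel
  exact LinearMap.congr_fun h a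

theorem extW_parityOp (hD : D ∈ superDer m n p) (v : M) :
    extW ρ D (parityOp ρ.isInternal v) = sgn 1 p • parityOp ρ.isInternal (extW ρ D v) := by
  obtain ⟨x, hx, y, hy, rfl⟩ := exists_gr_add ρ.isInternal (N := ⊤) (by simp)
    (Submodule.mem_top (x := v))
  have h : ∀ r, ∀ v ∈ ρ.gr r, extW ρ D (parityOp ρ.isInternal v) =
      sgn 1 p • parityOp ρ.isInternal (extW ρ D v) := by
    intro r v hv
    rw [(mem_gr_iff ρ.isInternal).1 hv, (mem_gr_iff ρ.isInternal).1 (extW_mem ρ hD hv), map_smul,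
      smul_smul, sgn_add_right, ← mul_assoc, sgn_mul_self, one_mul]
  simp only [map_add, smul_add, h 0 x hx.2, h 1 y hy.2]

theorem actA_parityOp (a : A m n) (v : M) :
    parityOp ρ.isInternal (ρ.actA a v) = ρ.actA (parity m n a) (parityOp ρ.isInternal v) := by
  obtain ⟨x, hx, y, hy, rfl⟩ := exists_gr_add ρ.isInternal (N := ⊤) (by simp)
    (Submodule.mem_top (x := v))
  obtain ⟨a0, ha0, a1, ha1, rfl⟩ := exists_add a
  have h : ∀ q r, ∀ a ∈ grA m n q, ∀ v ∈ ρ.gr r, parityOp ρ.isInternal (ρ.actA a v) =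
      ρ.actA (parity m n a) (parityOp ρ.isInternal v) := by
    intro q r a ha v hv
    rw [(mem_gr_iff ρ.isInternal).1 hv, (mem_gr_iff ρ.isInternal).1 (ρ.actA_mem q r a ha v hv),
      parity_of_mem ha, map_smul, map_smul, LinearMap.smul_apply, smul_smul, sgn_add_right,
      mul_comm]
  simp only [map_add, LinearMap.add_apply, h _ _ a0 ha0 x hx.2, h _ _ a0 ha0 y hy.2,
    h _ _ a1 ha1 x hx.2, h _ _ a1 ha1 y hy.2]

/-! ### The subspace 𝔪M and the fields vanishing at the point. -/

/-- The subspace `𝔪 M`, `𝔪` the maximal ideal at the point `t = 1`, `ξ = 0`. -/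
noncomputable def mM : Submodule ℂ M := Submodule.map₂ ρ.actA (mI m n) ⊤

theorem actA_mem_mM {a : A m n} (ha : a ∈ mI m n) (v : M) : ρ.actA a v ∈ mM ρ :=
  Submodule.apply_mem_map₂ _ ha trivial

variable {ρ} in
theorem mM_le {N : Submodule ℂ M} (h : ∀ a ∈ mI m n, ∀ v, ρ.actA a v ∈ N) : mM ρ ≤ N :=
  Submodule.map₂_le.2 fun a ha v _ => h a ha v

/-- The vector fields of parity `p` vanishing at the point `t = 1`, `ξ = 0`. -/
def isoDer (m n : ℕ) (p : ZMod 2) : Submodule ℂ (Module.End ℂ (A m n)) where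
  carrier := {D | D ∈ superDer m n p ∧ ∀ a, D a ∈ mI m n}
  zero_mem' := ⟨zero_mem _, fun _ => by simp⟩
  add_mem' := fun h h' => ⟨add_mem h.1 h'.1, fun a => add_mem (h.2 a) (h'.2 a)⟩
  smul_mem' := fun c _ h =>
    ⟨Submodule.smul_mem _ c h.1, fun a => Submodule.smul_mem _ c (h.2 a)⟩

/-- In the Leibniz rule for `D(a v)` with `a` in 𝔪, both `D(a)` and the coefficient of `D v` lie in
𝔪. Hence these fields act on the fibre. -/
theorem extW_mM (hD : D ∈ isoDer m n p) {z : M} (hz : z ∈ mM ρ) : extW ρ D z ∈ mM ρ := by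
  have : mM ρ ≤ (mM ρ).comap (extW ρ D) := mM_le fun a ha v => by
    rw [Submodule.mem_comap, extW_actA ρ hD.1]
    refine add_mem (actA_mem_mM ρ (hD.2 a) v) (actA_mem_mM ρ ?_ _)
    rw [mem_mI, eps_sig, ← mem_mI]; exact ha
  exact this hz

theorem parityOp_mM {z : M} (hz : z ∈ mM ρ) : parityOp ρ.isInternal z ∈ mM ρ := by
  have : mM ρ ≤ (mM ρ).comap (parityOp ρ.isInternal) := mM_le fun a ha v => by
    rw [Submodule.mem_comap, actA_parityOp]
    exact actA_mem_mM ρ (parity_mem_mI ha) _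
  exact this hz

theorem isoDer_bracket (hD : D ∈ isoDer m n p) (hF : F ∈ isoDer m n q) :
    D * F - sgn p q • (F * D) ∈ isoDer m n (p + q) :=
  ⟨bracket_mem hD.1 hF.1, fun _ => sub_mem (hD.2 _) (Submodule.smul_mem _ _ (hF.2 _))⟩

/-- If `par b` differs from the parity of `D`, the coefficient is odd and has value zero at the
point. -/
theorem const_smul_del_mem (hD : D ∈ superDer m n p) (b : Ix m n) :
    eps m n (coef b D) • (del b : Module.End ℂ (A m n)) ∈ superDer m n p := by
  by_cases h : par b = p
  · subst h; exact Submodule.smul_mem _ _ (del_mem b)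
  · have : p + par b = 1 := by
      revert h; generalize par b = r; revert p r
      rintro p - r; revert p r; decide
    have h1 := coef_mem hD b
    rw [this] at h1
    rw [eps_odd h1, zero_smul]; exact zero_mem _

/-- Freezing the coefficients of `D` at the point splits off an element of Δ. This is the
decomposition of a field into a constant part and a part vanishing at the point. -/
theorem sub_const_mem (hD : D ∈ superDer m n p) :
    D - ∑ b, eps m n (coef b D) • del b ∈ isoDer m n p := by
  refine ⟨sub_mem hD (Submodule.sum_mem _ fun b _ => const_smul_del_mem hD b), fun a => ?_⟩
  rw [LinearMap.sub_apply, superDer_eq hD a, LinearMap.sum_apply, ← Finset.sum_sub_distrib]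
  refine Submodule.sum_mem _ fun b _ => ?_
  have := mul_mem_mI_right (del b a) (sub_eps_mem (coef b D))
  rwa [sub_mul, smul_mul_assoc, one_mul] at this

/-! ### The core of a subspace and the consequences of simplicity. -/

/-- The composite of the operators `d_i`, `∂/∂ξ_j` along a list, the head acting first. -/
noncomputable def word : List (Ix m n) → Module.End ℂ M
  | [] => 1
  | b :: l => word l * extW ρ (del b)

/-- The largest subspace of `U` stable under the `d_i` and `∂/∂ξ_j`. -/
noncomputable def core (U : Submodule ℂ M) : Submodule ℂ M := ⨅ l, U.comap (word ρ l)

variable {ρ} {U : Submodule ℂ M}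

theorem mem_core {z : M} : z ∈ core ρ U ↔ ∀ l, word ρ l z ∈ U := by
  simp [core, Submodule.mem_iInf]

theorem core_le : core ρ U ≤ U := fun _ hz => mem_core.1 hz []

theorem del_mem_core {z : M} (hz : z ∈ core ρ U) (b : Ix m n) :
    extW ρ (del b) z ∈ core ρ U :=
  mem_core.2 fun l => mem_core.1 hz (b :: l)

theorem core_parityOp (hs : ∀ v ∈ U, parityOp ρ.isInternal v ∈ U) {z : M}
    (hz : z ∈ core ρ U) : parityOp ρ.isInternal z ∈ core ρ U := by
  refine mem_core.2 fun l => ?_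
  induction l generalizing z with
  | nil => exact hs z (core_le hz)
  | cons b l ih =>
    rw [word, Module.End.mul_apply, extW_parityOp ρ (del_mem b), map_smul]
    exact Submodule.smul_mem _ _ (ih (del_mem_core hz b))

/-- The Leibniz rule moves the letters of a word across `a`. For the empty word, `a z` is congruent
to `ε(a) z` modulo 𝔪M, which is contained in `U`. -/
theorem core_actA (hAW : ρ.IsAW) (hU : mM ρ ≤ U) (a : A m n) {z : M} (hz : z ∈ core ρ U) :
    ρ.actA a z ∈ core ρ U := by
  refine mem_core.2 fun l => ?_
  induction l generalizing a z with
  | nil =>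
    have h1 := actA_mem_mM ρ (sub_eps_mem a) z
    rw [map_sub, map_smul, LinearMap.sub_apply, LinearMap.smul_apply, hAW.2] at h1
    have h2 := add_mem (hU h1) (Submodule.smul_mem _ (eps m n a) (core_le hz))
    rw [sub_add_cancel] at h2
    exact h2
  | cons b l ih =>
    rw [word, Module.End.mul_apply, extW_actA ρ (del_mem b), map_add]
    exact add_mem (ih _ hz) (ih _ (del_mem_core hz b))

/-- Letters of a word are moved past `D` at the cost of brackets, which are again superderivations.
For the empty word, `D` is an element of Δ plus a field vanishing at the point, and `U` and its core
absorb both parts. -/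
theorem core_extW (hT : ∀ p, ∀ D ∈ isoDer m n p, ∀ v ∈ U, extW ρ D v ∈ U) {p : ZMod 2}
    {D : Module.End ℂ (A m n)} (hD : D ∈ superDer m n p) {z : M} (hz : z ∈ core ρ U) :
    extW ρ D z ∈ core ρ U := by
  refine mem_core.2 fun l => ?_
  induction l generalizing p D z with
  | nil =>
    have h : D = (D - ∑ b, eps m n (coef b D) • del b) + ∑ b, eps m n (coef b D) • del b := by
      abel
    change extW ρ D z ∈ U
    rw [h, map_add, LinearMap.add_apply]
    refine add_mem (hT p _ (sub_const_mem hD) z (core_le hz)) ?_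
    rw [map_sum, LinearMap.sum_apply]
    refine Submodule.sum_mem _ fun b _ => ?_
    rw [map_smul, LinearMap.smul_apply]
    exact Submodule.smul_mem _ _ (core_le (del_mem_core hz b))
  | cons b l ih =>
    rw [word, Module.End.mul_apply, extW_comp ρ (del_mem b) hD, map_add, map_smul]
    exact add_mem (ih (bracket_mem (del_mem b) hD) hz)
      (Submodule.smul_mem _ _ (ih hD (del_mem_core hz b)))

theorem core_eq_bot_or_top (hAW : ρ.IsAW) (hsimple : ρ.IsSimple) (hU : mM ρ ≤ U)
    (hs : ∀ v ∈ U, parityOp ρ.isInternal v ∈ U)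
    (hT : ∀ p, ∀ D ∈ isoDer m n p, ∀ v ∈ U, extW ρ D v ∈ U) :
    core ρ U = ⊥ ∨ core ρ U = ⊤ :=
  hsimple.2 _ ((isGraded_iff ρ.isInternal).2 fun _ hv => core_parityOp hs hv)
    (fun p D v hv => by rw [← extW_coe]; exact core_extW hT D.2 hv)
    fun a _ hv => core_actA hAW hU a hv

/-- A vector that vanishes at the point with all its derivatives is zero. Both the realization of
the fibre and the final formula for the action rest on this. -/
theorem core_mM (hAW : ρ.IsAW) (hsimple : ρ.IsSimple) (h : mM ρ ≠ ⊤) : core ρ (mM ρ) = ⊥ :=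
  (core_eq_bot_or_top hAW hsimple le_rfl (fun _ hv => parityOp_mM ρ hv)
    fun _ _ hD _ hv => extW_mM ρ hD hv).resolve_right
    fun h' => h (top_le_iff.1 (h' ▸ core_le))

end

/-! ### Weights, and the nonvanishing of the fibre. -/

section
variable {m n : ℕ}

/-- The space underlying `W_{m,n}`. -/
noncomputable def allDer (m n : ℕ) : Submodule ℂ (Module.End ℂ (A m n)) := superDer m n 0 ⊔ superDer m n 1

theorem superDer_le_allDer (p : ZMod 2) : superDer m n p ≤ allDer m n := by
  rcases zmod2 p with rfl | rfl
  · exact le_sup_left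
  · exact le_sup_right

theorem mulLeft_mul_mem_allDer (a : A m n) {q : ZMod 2} {D : Module.End ℂ (A m n)}
    (hD : D ∈ superDer m n q) : LinearMap.mulLeft ℂ a * D ∈ allDer m n := by
  obtain ⟨x, hx, y, hy, rfl⟩ := exists_add a
  have : LinearMap.mulLeft ℂ (x + y) * D = LinearMap.mulLeft ℂ x * D + LinearMap.mulLeft ℂ y * D := by
    ext z; simp [add_mul]
  rw [this]
  exact add_mem (superDer_le_allDer _ (mulLeft_mul_mem hx hD))
    (superDer_le_allDer _ (mulLeft_mul_mem hy hD))

theorem superDer_eq_del {p : ZMod 2} {D : Module.End ℂ (A m n)} (hD : D ∈ superDer m n p) :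
    D = ∑ b, LinearMap.mulLeft ℂ (coef b D) * del b :=
  LinearMap.ext fun a => by rw [superDer_eq hD a]; simp [LinearMap.sum_apply]

theorem A_induction_graded {P : A m n → Prop}
    (h : ∀ (α : Fin m → ℤ) (c : ℂ) (w : Grassmann n), P (mk (AddMonoidAlgebra.single α c) w))
    (hadd : ∀ a b, P a → P b → P (a + b)) (a : A m n) : P a := by
  have h0 : P 0 := by simpa using h 0 0 0
  induction a using A_tmul_induction with
  | zero => exact h0
  | add x y hx hy => exact hadd _ _ hx hy
  | mk f w =>
    induction f using AddMonoidAlgebra.induction_linear with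
    | zero => simpa using h0
    | add f g hf hg => rw [map_add, LinearMap.add_apply]; exact hadd _ _ hf hg
    | single α c => exact h α c w

theorem euler_mulLeft_del (i : Fin m) (b : Ix m n) (α : Fin m → ℤ) (c : ℂ) (w : Grassmann n) :
    (del (.inl i) * (LinearMap.mulLeft ℂ (mk (AddMonoidAlgebra.single α c) w) * del b) -
      LinearMap.mulLeft ℂ (mk (AddMonoidAlgebra.single α c) w) * del b * del (.inl i) :
      Module.End ℂ (A m n)) =
    ((α i : ℤ) : ℂ) • (LinearMap.mulLeft ℂ (mk (AddMonoidAlgebra.single α c) w) * del b) := by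
  have h : (del (.inl i) (mk (AddMonoidAlgebra.single α c) w) : A m n) =
      ((α i : ℤ) : ℂ) • mk (AddMonoidAlgebra.single α c) w := by
    rw [del, Sum.elim_inl, mapA_mk, euler_single, map_smul]; rfl
  refine LinearMap.ext fun a => ?_
  simp only [LinearMap.sub_apply, Module.End.mul_apply, LinearMap.mulLeft_apply,
    LinearMap.smul_apply, superDer_mul (del_mem _), h, del_comm (.inl i) b]
  simp [par, sgn_zero_left, sig]

variable {M : Type*} [AddCommGroup M] [Module ℂ M] {ρ : ExtWittModule m n M}

/-- An even first factor produces no sign, so the relation extends to a second factor that is not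
homogeneous. It is applied with `D` one of the `d_i` or the Euler field. -/
theorem extW_bracket_even {D F : Module.End ℂ (A m n)} (hD : D ∈ superDer m n 0)
    (hF : F ∈ allDer m n) :
    extW ρ (D * F - F * D) = extW ρ D * extW ρ F - extW ρ F * extW ρ D := by
  obtain ⟨x, hx, y, hy, rfl⟩ := Submodule.mem_sup.1 hF
  have h0 := extW_bracket ρ hD hx
  have h1 := extW_bracket ρ hD hy
  rw [sgn_zero_left, one_smul, one_smul] at h0 h1
  have : D * (x + y) - (x + y) * D = (D * x - x * D) + (D * y - y * D) := by noncomm_ring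
  rw [this, map_add, map_add, h0, h1]
  noncomm_ring

theorem mem_weightSpace {μ : Fin m → ℂ} {v : M} :
    v ∈ ρ.weightSpace μ ↔ ∀ i, extW ρ (del (.inl i)) v = μ i • v := by
  simp only [ExtWittModule.weightSpace, Submodule.mem_iInf, Module.End.mem_eigenspace_iff,
    ← extW_coe]
  rfl

/-- The weight `μ + α`. -/
def shift {m : ℕ} (μ : Fin m → ℂ) (α : Fin m → ℤ) : Fin m → ℂ := fun i => μ i + α i

theorem tpow_mem_weightSpace {μ : Fin m → ℂ} {v : M} (hv : v ∈ ρ.weightSpace μ)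
    (α : Fin m → ℤ) : ρ.actA (tpow α) v ∈ ρ.weightSpace (shift μ α) := by
  rw [mem_weightSpace] at *
  intro i
  rw [extW_actA ρ (del_mem _), hv i, del_tpow, map_smul, LinearMap.smul_apply, map_smul]
  simp [par, sig, shift, add_smul, add_comm]

theorem xi_mem_weightSpace {μ : Fin m → ℂ} {v : M} (hv : v ∈ ρ.weightSpace μ) (j : Fin n) :
    ρ.actA (xi j) v ∈ ρ.weightSpace μ := by
  rw [mem_weightSpace] at *
  intro i
  rw [extW_actA ρ (del_mem _), hv i, del_xi_even, map_smul]
  simp [par, sig]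

theorem extW_del_comm (a b : Ix m n) (v : M) :
    extW ρ (del a) (extW ρ (del b) v) =
      sgn (par a) (par b) • extW ρ (del b) (extW ρ (del a) v) := by
  rw [extW_comp ρ (del_mem a) (del_mem b)]
  have : (del a * del b - sgn (par a) (par b) • (del b * del a) : Module.End ℂ (A m n)) = 0 :=
    LinearMap.ext fun x => by simp [del_comm a b]
  rw [this, map_zero, LinearMap.zero_apply, zero_add]

theorem del_mem_weightSpace {μ : Fin m → ℂ} {v : M} (hv : v ∈ ρ.weightSpace μ) (b : Ix m n) :
    extW ρ (del b) v ∈ ρ.weightSpace μ := by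
  rw [mem_weightSpace] at *
  intro i
  rw [extW_del_comm, hv i, map_smul]
  simp [par, sgn_zero_left]

/-- The sum of the weight spaces with weights in `μ + ℤ^m`. -/
noncomputable def cosetSpace (ρ : ExtWittModule m n M) (μ : Fin m → ℂ) : Submodule ℂ M :=
  ⨆ α : Fin m → ℤ, ρ.weightSpace (shift μ α)

theorem shift_zero (μ : Fin m → ℂ) : shift μ 0 = μ := by
  ext i; simp [shift]

theorem shift_shift (μ : Fin m → ℂ) (α β : Fin m → ℤ) :
    shift (shift μ α) β = shift μ (α + β) := by
  ext i; simp [shift, add_assoc]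

theorem weightSpace_le (μ : Fin m → ℂ) (α : Fin m → ℤ) :
    ρ.weightSpace (shift μ α) ≤ cosetSpace ρ μ :=
  le_iSup (fun α : Fin m → ℤ => ρ.weightSpace (shift μ α)) α

theorem actA_cosetSpace (hAW : ρ.IsAW) (a : A m n) (μ : Fin m → ℂ) {v : M}
    (hv : v ∈ cosetSpace ρ μ) : ρ.actA a v ∈ cosetSpace ρ μ := by
  induction a using A_induction generalizing v with
  | h1 => rwa [hAW.2]
  | ht α =>
    induction hv using Submodule.iSup_induction' with
    | mem β x hx =>
      have h := tpow_mem_weightSpace hx α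
      rw [shift_shift] at h
      exact weightSpace_le _ _ h
    | zero => simp
    | add x y _ _ hx hy => rw [map_add]; exact add_mem hx hy
  | hx j =>
    induction hv using Submodule.iSup_induction' with
    | mem β x hx => exact weightSpace_le _ _ (xi_mem_weightSpace hx j)
    | zero => simp
    | add x y _ _ hx hy => rw [map_add]; exact add_mem hx hy
  | hadd a b ha hb => rw [map_add]; exact add_mem (ha hv) (hb hv)
  | hmul a b ha hb => rw [← hAW.1]; exact ha (hb hv)
  | hs c a ha => rw [map_smul]; exact Submodule.smul_mem _ _ (ha hv)

theorem mulLeft_del_cosetSpace (a : A m n) (b : Ix m n) (μ : Fin m → ℂ) {v : M}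
    (hv : v ∈ ρ.weightSpace μ) :
    extW ρ (LinearMap.mulLeft ℂ a * del b) v ∈ cosetSpace ρ μ := by
  induction a using A_induction_graded with
  | h α c w =>
    refine weightSpace_le μ α ?_
    rw [mem_weightSpace] at *
    intro i
    have h := extW_bracket_even (ρ := ρ) (del_mem (.inl i))
      (mulLeft_mul_mem_allDer (mk (AddMonoidAlgebra.single α c) w) (del_mem b))
    rw [euler_mulLeft_del, map_smul] at h
    have h' := LinearMap.congr_fun h v
    simp only [LinearMap.sub_apply, Module.End.mul_apply, LinearMap.smul_apply, hv i,
      map_smul] at h'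
    rw [sub_eq_iff_eq_add.1 h'.symm, shift, add_smul, add_comm]
  | hadd x y hx hy =>
    have : LinearMap.mulLeft ℂ (x + y) * del b =
        LinearMap.mulLeft ℂ x * del b + LinearMap.mulLeft ℂ y * del b := by
      ext z; simp [add_mul]
    rw [this, map_add]
    exact add_mem hx hy

theorem cosetSpace_shift (μ : Fin m → ℂ) (α : Fin m → ℤ) :
    cosetSpace ρ (shift μ α) ≤ cosetSpace ρ μ :=
  iSup_le fun β => by rw [shift_shift]; exact weightSpace_le _ _

theorem extW_cosetSpace {p : ZMod 2} {D : Module.End ℂ (A m n)} (hD : D ∈ superDer m n p)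
    (μ : Fin m → ℂ) {v : M} (hv : v ∈ cosetSpace ρ μ) : extW ρ D v ∈ cosetSpace ρ μ := by
  rw [superDer_eq_del hD, map_sum, LinearMap.sum_apply]
  refine Submodule.sum_mem _ fun b _ => ?_
  induction hv using Submodule.iSup_induction' with
  | mem β x hx => exact cosetSpace_shift μ β (mulLeft_del_cosetSpace _ b _ hx)
  | zero => simp
  | add x y _ _ hx hy => rw [map_add]; exact add_mem hx hy

theorem parityOp_cosetSpace (μ : Fin m → ℂ) {v : M} (hv : v ∈ cosetSpace ρ μ) :
    parityOp ρ.isInternal v ∈ cosetSpace ρ μ := by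
  induction hv using Submodule.iSup_induction' with
  | mem β x hx =>
    refine weightSpace_le μ β ?_
    rw [mem_weightSpace] at *
    intro i
    rw [extW_parityOp ρ (del_mem _), hx i, map_smul]
    simp [par, sgn_zero_right]
  | zero => simp
  | add x y _ _ hx hy => rw [map_add]; exact add_mem hx hy

/-- Elements of `A` and vector fields shift weights by the lattice ℤ^m only, so the part of `M` over
one coset is a graded submodule. -/
theorem exists_cosetSpace_eq_top (hAW : ρ.IsAW) (hsimple : ρ.IsSimple) (hw : ρ.IsWeight) :
    ∃ μ, ρ.weightSpace μ ≠ ⊥ ∧ cosetSpace ρ μ = ⊤ := by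
  have : ∃ μ, ρ.weightSpace μ ≠ ⊥ := by
    by_contra! h
    have := hsimple.1
    rw [ExtWittModule.IsWeight] at hw
    simp only [h, iSup_bot] at hw
    exact bot_ne_top hw
  obtain ⟨μ, hμ⟩ := this
  refine ⟨μ, hμ, (hsimple.2 (cosetSpace ρ μ)
    ((isGraded_iff ρ.isInternal).2 fun _ hv => parityOp_cosetSpace μ hv)
    (fun p D v hv => by rw [← extW_coe]; exact extW_cosetSpace D.2 μ hv)
    fun a v hv => actA_cosetSpace hAW a μ hv).resolve_left fun h => hμ ?_⟩
  have h2 := weightSpace_le (ρ := ρ) μ 0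
  rw [h, shift_zero] at h2
  exact le_bot_iff.1 h2

/-- The weight spaces sit inside the joint generalized eigenspaces of the commuting operators `d_i`,
which are independent. -/
theorem weightSpace_iSupIndep (ρ : ExtWittModule m n M) :
    iSupIndep fun μ => ρ.weightSpace μ := by
  have hc : ∀ i j : Fin m, Commute (extW ρ (del (.inl i))) (extW ρ (del (.inl j))) := by
    intro i j
    refine LinearMap.ext fun v => ?_
    have := extW_del_comm (ρ := ρ) (.inl i) (.inl j) v
    simp only [par, Sum.elim_inl, sgn_zero_left, one_smul] at this
    exact this
  have h := Module.End.independent_iInf_maxGenEigenspace_of_forall_mapsTo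
    (fun i : Fin m => extW ρ (del (.inl i))) fun i j c =>
      Module.End.mapsTo_maxGenEigenspace_of_comm (hc j i) c
  refine h.mono fun μ v hv => ?_
  rw [mem_weightSpace] at hv
  refine Submodule.mem_iInf _ |>.2 fun i => ?_
  have he : v ∈ Module.End.eigenspace (extW ρ (del (.inl i))) (μ i) :=
    Module.End.mem_eigenspace_iff.2 (hv i)
  exact (Module.End.genEigenspace _ (μ i)).monotone (by simp) he

theorem shift_injective (μ : Fin m → ℂ) : Function.Injective (shift μ) := by
  intro α β h
  ext i
  have := congrFun h i
  simpa [shift] using this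

/-- Translation of all weight spaces to the weight space of weight `μ`. -/
theorem exists_translate {μ : Fin m → ℂ} (h : cosetSpace ρ μ = ⊤) :
    ∃ s : Module.End ℂ M, ∀ α, ∀ v ∈ ρ.weightSpace (shift μ α),
      s v = ρ.actA (tpow (-α)) v := by
  have hi : DirectSum.IsInternal fun α => ρ.weightSpace (shift μ α) :=
    DirectSum.isInternal_submodule_of_iSupIndep_of_iSup_eq_top
      ((weightSpace_iSupIndep ρ).comp (shift_injective μ)) h
  let e := LinearEquiv.ofBijective
    (DirectSum.coeLinearMap fun α => ρ.weightSpace (shift μ α)) hi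
  let g : (DirectSum (Fin m → ℤ) fun α => ρ.weightSpace (shift μ α)) →ₗ[ℂ] M :=
    DirectSum.toModule ℂ _ M fun α =>
      ρ.actA (tpow (-α)) ∘ₗ (ρ.weightSpace (shift μ α)).subtype
  refine ⟨g ∘ₗ e.symm.toLinearMap, fun α v hv => ?_⟩
  have he : e.symm v = DirectSum.lof ℂ _ (fun α => ρ.weightSpace (shift μ α)) α ⟨v, hv⟩ := by
    rw [LinearEquiv.symm_apply_eq]
    exact (DirectSum.coeLinearMap_lof (fun α => ρ.weightSpace (shift μ α)) α ⟨v, hv⟩).symm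
  simp only [LinearMap.comp_apply, LinearEquiv.coe_coe, he, g, DirectSum.toModule_lof]
  rfl

/-- A Nakayama argument for the nilpotent ideal generated by the `ξ_j`. In the inductive step either
`ξ_j` kills `U` and can be dropped, or `U` is replaced by `ξ_j U`, on which `ξ_j` acts by zero since
`ξ_j² = 0` and which inherits the supposed equality. -/
theorem iSup_xi_ne (hAW : ρ.IsAW) (S : Finset (Fin n)) {U : Submodule ℂ M} (hU : U ≠ ⊥)
    (hs : ∀ j, ∀ v ∈ U, ρ.actA (xi j) v ∈ U) : ⨆ j ∈ S, U.map (ρ.actA (xi j)) ≠ U := by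
  induction S using Finset.induction_on generalizing U with
  | empty => simpa using hU.symm
  | insert j S hj ih =>
    rw [Finset.iSup_insert]
    intro h
    have hsw : ∀ (k : Fin n) (v : M),
        ρ.actA (xi j) (ρ.actA (xi k) v) = - ρ.actA (xi k) (ρ.actA (xi j) v) := by
      intro k v
      rw [hAW.1, xi_mul_xi, map_neg, LinearMap.neg_apply, hAW.1]
    by_cases hz : U.map (ρ.actA (xi j)) = ⊥
    · rw [hz, bot_sup_eq] at h
      exact ih hU hs h
    · have hs' : ∀ k, ∀ v ∈ U.map (ρ.actA (xi j)), ρ.actA (xi k) v ∈ U.map (ρ.actA (xi j)) := by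
        rintro k _ ⟨v, hv, rfl⟩
        have := hsw k v
        rw [← neg_eq_iff_eq_neg] at this
        rw [← this, ← map_neg, ← map_neg]
        exact Submodule.mem_map_of_mem (hs k _ (neg_mem hv))
      refine ih hz hs' (le_antisymm (iSup₂_le fun k _ => ?_) ?_)
      · rintro _ ⟨v, hv, rfl⟩
        exact hs' k v hv
      · rw [Submodule.map_le_iff_le_comap]
        conv_lhs => rw [← h]
        refine sup_le ?_ (iSup₂_le fun k hk => ?_)
        · rintro _ ⟨v, _, rfl⟩
          have h2 := neg_eq_self (hsw j v)
          rw [Submodule.mem_comap, h2]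
          exact zero_mem _
        · rintro _ ⟨v, hv, rfl⟩
          rw [Submodule.mem_comap, hsw]
          exact neg_mem (Submodule.mem_iSup_of_mem k (Submodule.mem_iSup_of_mem hk
            (Submodule.mem_map_of_mem (Submodule.mem_map_of_mem hv))))

/-- Translating all weight spaces to weight `μ` turns `t^α` into the identity and keeps the `ξ_j`.
If 𝔪M were everything, the weight space would equal the sum of its images under the `ξ_j`,
contradicting `iSup_xi_ne`. -/
theorem mM_ne_top (hAW : ρ.IsAW) {μ : Fin m → ℂ} (hμ : ρ.weightSpace μ ≠ ⊥)
    (h : cosetSpace ρ μ = ⊤) : mM ρ ≠ ⊤ := by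
  intro htop
  obtain ⟨s, hs⟩ := exists_translate h
  have hmem : ∀ v : M, v ∈ cosetSpace ρ μ := fun v => by rw [h]; trivial
  have hsμ : ∀ v, s v ∈ ρ.weightSpace μ := by
    intro v
    induction hmem v using Submodule.iSup_induction' with
    | mem α x hx =>
      rw [hs α x hx]
      have := tpow_mem_weightSpace hx (-α)
      rwa [shift_shift, add_neg_cancel, shift_zero] at this
    | zero => simp
    | add x y _ _ hx hy => rw [map_add]; exact add_mem hx hy
  have hs1 : ∀ v ∈ ρ.weightSpace μ, s v = v := by
    intro v hv
    rw [hs 0 v (by rwa [shift_zero]), neg_zero, tpow_zero, hAW.2]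
  have hst : ∀ α v, s (ρ.actA (tpow α) v) = s v := by
    intro α v
    induction hmem v using Submodule.iSup_induction' with
    | mem β x hx =>
      have h2 := tpow_mem_weightSpace hx α
      rw [shift_shift] at h2
      rw [hs _ _ h2, hs β x hx, hAW.1, ← tpow_add]
      congr 3
      abel
    | zero => simp
    | add x y _ _ hx hy => rw [map_add, map_add, map_add, hx, hy]
  have hsx : ∀ j v, s (ρ.actA (xi j) v) = ρ.actA (xi j) (s v) := by
    intro j v
    induction hmem v using Submodule.iSup_induction' with
    | mem β x hx =>
      rw [hs _ _ (xi_mem_weightSpace hx j), hs β x hx, hAW.1, hAW.1, tpow_comm]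
    | zero => simp
    | add x y _ _ hx hy => rw [map_add, map_add, map_add, map_add, hx, hy]
  set Y := ⨆ j ∈ (Finset.univ : Finset (Fin n)), (ρ.weightSpace μ).map (ρ.actA (xi j)) with hY
  -- Modulo the images of the `ξ_j`, an element of `A` acts after translation through its value at
  -- the point. The property passes to sums and products, so generators suffice.
  have hYa : ∀ a v, s (ρ.actA a v) - eps m n a • s v ∈ Y := by
    intro a
    induction a using A_induction with
    | h1 => intro v; simp [hAW.2]
    | ht α => intro v; simp [hst, eps_tpow]
    | hx j =>
      intro v
      rw [hsx, eps_xi, zero_smul, sub_zero]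
      exact Submodule.mem_iSup_of_mem j (Submodule.mem_iSup_of_mem (Finset.mem_univ j)
        (Submodule.mem_map_of_mem (hsμ v)))
    | hadd a b ha hb =>
      intro v
      have := add_mem (ha v) (hb v)
      simp only [map_add, LinearMap.add_apply, add_smul]
      convert this using 1
      abel
    | hmul a b ha hb =>
      intro v
      have := add_mem (ha (ρ.actA b v)) (Submodule.smul_mem _ (eps m n a) (hb v))
      rw [← hAW.1, map_mul, mul_smul]
      convert this using 1
      rw [smul_sub]
      abel
    | hs c a ha =>
      intro v
      have := Submodule.smul_mem _ c (ha v)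
      simp only [map_smul, LinearMap.smul_apply, smul_eq_mul, mul_smul]
      rwa [smul_sub] at this
  refine iSup_xi_ne hAW Finset.univ hμ (fun j v hv => xi_mem_weightSpace hv j) (le_antisymm ?_ ?_)
  · refine iSup₂_le fun j _ => ?_
    rintro _ ⟨v, hv, rfl⟩
    exact xi_mem_weightSpace hv j
  · intro v hv
    rw [← hs1 v hv]
    have : mM ρ ≤ Y.comap s := mM_le fun a ha v => by
      have := hYa a v
      rwa [mem_mI.1 ha, zero_smul, sub_zero] at this
    rw [htop] at this
    exact this trivial

/-- Since `1 - t^{-α}` lies in 𝔪, a vector of weight `μ + α` is congruent to its translate of weight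
`μ`. -/
theorem weightSpace_sup_mM (hAW : ρ.IsAW) {μ : Fin m → ℂ} (h : cosetSpace ρ μ = ⊤) :
    ρ.weightSpace μ ⊔ mM ρ = ⊤ := by
  rw [eq_top_iff, ← h]
  refine iSup_le fun α v hv => ?_
  have h1 := tpow_mem_weightSpace hv (-α)
  rw [shift_shift, add_neg_cancel, shift_zero] at h1
  have h2 := actA_mem_mM ρ (neg_mem (sub_eps_mem (tpow (-α)))) v
  rw [eps_tpow, one_smul, neg_sub, map_sub, LinearMap.sub_apply, hAW.2] at h2
  have := Submodule.add_mem_sup h1 h2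
  rwa [add_sub_cancel] at this

/-! ### The fibre realized by vectors of fixed weight killed by the `∂/∂ξ_j`. -/

/-- The vectors of weight `lam` killed by all `∂/∂ξ_j`. -/
noncomputable def topSpace (ρ : ExtWittModule m n M) (lam : Fin m → ℂ) : Submodule ℂ M :=
  ⨅ b, Module.End.eigenspace (extW ρ (del b)) (Sum.elim lam (0 : Fin n → ℂ) b)

theorem mem_topSpace {lam : Fin m → ℂ} {v : M} :
    v ∈ topSpace ρ lam ↔ ∀ b, extW ρ (del b) v = Sum.elim lam (0 : Fin n → ℂ) b • v := by
  simp only [topSpace, Submodule.mem_iInf, Module.End.mem_eigenspace_iff]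

theorem topSpace_le (lam : Fin m → ℂ) : topSpace ρ lam ≤ ρ.weightSpace lam := fun v hv =>
  mem_weightSpace.2 fun i => by simpa using mem_topSpace.1 hv (.inl i)

theorem exists_sub_mem_mM (hAW : ρ.IsAW) {lam : Fin m → ℂ} (S : Finset (Fin n)) {z : M}
    (hz : z ∈ ρ.weightSpace lam) : ∃ z' ∈ ρ.weightSpace lam, z - z' ∈ mM ρ ∧
      ∀ j ∈ S, extW ρ (del (.inr j)) z' = 0 := by
  induction S using Finset.induction_on with
  | empty => exact ⟨z, hz, by simp, by simp⟩
  | insert j S hj ih =>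
    obtain ⟨z', hz', h1, h2⟩ := ih
    have hz : ∀ k ∈ insert j S, extW ρ (del (.inr k)) (extW ρ (del (.inr j)) z') = 0 := by
      intro k hk
      have hsw := extW_del_comm (ρ := ρ) (.inr k) (.inr j) z'
      simp only [par, Sum.elim_inr, sgn_one_one, neg_one_smul] at hsw
      by_cases hkj : k = j
      · subst hkj; exact neg_eq_self hsw
      · rw [hsw, h2 k ((Finset.mem_insert.1 hk).resolve_left hkj), map_zero, neg_zero]
    -- The operator `1 - ξ_j ∂/∂ξ_j` projects onto the kernel of `∂/∂ξ_j`. It changes a vector only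
    -- by an element of 𝔪M and keeps it killed by the derivatives already treated.
    refine ⟨z' - ρ.actA (xi j) (extW ρ (del (.inr j)) z'),
      sub_mem hz' (xi_mem_weightSpace (del_mem_weightSpace hz' _) j), ?_, fun k hk => ?_⟩
    · rw [← sub_add]
      exact add_mem h1 (actA_mem_mM ρ (crd_mem_mI (.inr j)) _)
    · rw [map_sub, extW_actA ρ (del_mem _), del_xi, hz k hk, map_zero, add_zero]
      by_cases hkj : k = j
      · subst hkj
        rw [if_pos rfl, hAW.2, sub_self]
      · rw [h2 k ((Finset.mem_insert.1 hk).resolve_left hkj), if_neg hkj]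
        simp

theorem topSpace_sup_mM (hAW : ρ.IsAW) {lam : Fin m → ℂ} (h : cosetSpace ρ lam = ⊤) :
    topSpace ρ lam ⊔ mM ρ = ⊤ := by
  rw [eq_top_iff, ← weightSpace_sup_mM hAW h]
  refine sup_le (fun z hz => ?_) le_sup_right
  obtain ⟨z', hz', h1, h2⟩ := exists_sub_mem_mM hAW Finset.univ hz
  rw [← add_sub_cancel z' z]
  refine Submodule.add_mem_sup (mem_topSpace.2 ?_) h1
  rintro (i | j)
  · exact mem_weightSpace.1 hz' i
  · simpa using h2 j (Finset.mem_univ j)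

/-- Δ acts on these vectors by scalars, so all derivatives stay in `U`. -/
theorem topSpace_mem_core {lam : Fin m → ℂ} {U : Submodule ℂ M} {v : M} (hv : v ∈ topSpace ρ lam)
    (hU : v ∈ U) : v ∈ core ρ U := by
  refine mem_core.2 fun l => ?_
  induction l with
  | nil => exact hU
  | cons b l ih =>
    rw [word, Module.End.mul_apply, mem_topSpace.1 hv, map_smul]
    exact Submodule.smul_mem _ _ ih

/-- A vector in the intersection lies in the core of 𝔪M, which is zero. -/
theorem isCompl_topSpace (hAW : ρ.IsAW) (hsimple : ρ.IsSimple) (hm : mM ρ ≠ ⊤) {lam : Fin m → ℂ}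
    (h : cosetSpace ρ lam = ⊤) : IsCompl (topSpace ρ lam) (mM ρ) := by
  refine ⟨Submodule.disjoint_def.2 fun v h1 h2 => ?_, codisjoint_iff.2 (topSpace_sup_mM hAW h)⟩
  have := topSpace_mem_core h1 h2
  rwa [core_mM hAW hsimple hm, Submodule.mem_bot] at this

/-- The fibre `M / 𝔪 M` is simple over the vector fields vanishing at the point. -/
theorem eq_mM_or_top (hAW : ρ.IsAW) (hsimple : ρ.IsSimple) {lam : Fin m → ℂ}
    (h : cosetSpace ρ lam = ⊤) {U : Submodule ℂ M} (hU : mM ρ ≤ U)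
    (hs : ∀ v ∈ U, parityOp ρ.isInternal v ∈ U)
    (hT : ∀ p, ∀ D ∈ isoDer m n p, ∀ v ∈ U, extW ρ D v ∈ U) : U = mM ρ ∨ U = ⊤ := by
  rcases core_eq_bot_or_top hAW hsimple hU hs hT with h1 | h1
  · left
    refine le_antisymm (fun u hu => ?_) hU
    have hu' : u ∈ topSpace ρ lam ⊔ mM ρ := by rw [topSpace_sup_mM hAW h]; trivial
    obtain ⟨v, hv, z, hz, rfl⟩ := Submodule.mem_sup.1 hu'
    have hvU : v ∈ U := by
      have := sub_mem hu (hU hz)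
      rwa [add_sub_cancel_right] at this
    have := topSpace_mem_core hv hvU
    rw [h1, Submodule.mem_bot] at this
    rwa [this, zero_add]
  · exact Or.inr (top_le_iff.1 (h1 ▸ core_le))

end

/-! ### Fields vanishing to second order act by zero on the fibre. -/

section
variable {m n : ℕ} {M : Type*} [AddCommGroup M] [Module ℂ M] {ρ : ExtWittModule m n M}

/-- The vector fields vanishing at the point `t = 1`, `ξ = 0`. -/
noncomputable def allIso (m n : ℕ) : Submodule ℂ (Module.End ℂ (A m n)) :=
  isoDer m n 0 ⊔ isoDer m n 1

theorem isoDer_le_allIso (p : ZMod 2) : isoDer m n p ≤ allIso m n := by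
  rcases zmod2 p with rfl | rfl
  · exact le_sup_left
  · exact le_sup_right

theorem allIso_le : allIso m n ≤ allDer m n :=
  sup_le_sup (fun _ h => h.1) fun _ h => h.1

theorem exists_add_of_mem_mI {a : A m n} (ha : a ∈ mI m n) :
    ∃ x ∈ grA m n 0, x ∈ mI m n ∧ ∃ y ∈ grA m n 1, y ∈ mI m n ∧ a = x + y := by
  obtain ⟨x, hx, y, hy, rfl⟩ := exists_add a
  have h1 : y ∈ mI m n := mem_mI.2 (eps_odd hy)
  refine ⟨x, hx, ?_, y, hy, h1, rfl⟩
  have := sub_mem ha h1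
  rwa [add_sub_cancel_right] at this

theorem mulLeft_mul_isoDer {p q : ZMod 2} {x : A m n} {D : Module.End ℂ (A m n)}
    (hx : x ∈ grA m n p) (hx' : x ∈ mI m n) (hD : D ∈ superDer m n q) :
    LinearMap.mulLeft ℂ x * D ∈ isoDer m n (p + q) :=
  ⟨mulLeft_mul_mem hx hD, fun _ => mul_mem_mI_right _ hx'⟩

theorem mulLeft_add_mul (x y : A m n) (D : Module.End ℂ (A m n)) :
    LinearMap.mulLeft ℂ (x + y) * D = LinearMap.mulLeft ℂ x * D + LinearMap.mulLeft ℂ y * D := by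
  ext z; simp [add_mul]

theorem mulLeft_smul_mul (c : ℂ) (x : A m n) (D : Module.End ℂ (A m n)) :
    LinearMap.mulLeft ℂ (c • x) * D = c • (LinearMap.mulLeft ℂ x * D) := by
  ext z; simp

theorem mulLeft_mul_allIso {q : ZMod 2} {x : A m n} {D : Module.End ℂ (A m n)}
    (hx : x ∈ mI m n) (hD : D ∈ superDer m n q) : LinearMap.mulLeft ℂ x * D ∈ allIso m n := by
  obtain ⟨x, h0, h0', y, h1, h1', rfl⟩ := exists_add_of_mem_mI hx
  rw [mulLeft_add_mul]
  exact add_mem (isoDer_le_allIso _ (mulLeft_mul_isoDer h0 h0' hD))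
    (isoDer_le_allIso _ (mulLeft_mul_isoDer h1 h1' hD))

theorem allIso_mM {F : Module.End ℂ (A m n)} (hF : F ∈ allIso m n) :
    mM ρ ≤ (mM ρ).comap (extW ρ F) := by
  obtain ⟨x, hx, y, hy, rfl⟩ := Submodule.mem_sup.1 hF
  intro z hz
  rw [Submodule.mem_comap, map_add]
  exact add_mem (extW_mM ρ hx hz) (extW_mM ρ hy hz)

theorem eul_mem_isoDer : eul m n ∈ isoDer m n 0 := ⟨eul_mem, eul_mem_mI⟩

/-- A field of degree k induces on the fibre either zero or an eigenvector, of eigenvalue k, of ad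
of the Euler field. The latter acts on the finite-dimensional space of endomorphisms and has
finitely many eigenvalues. -/
theorem exists_bound [FiniteDimensional ℂ (M ⧸ mM ρ)] :
    ∃ R : ℕ, ∀ k : ℕ, R ≤ k → ∀ F ∈ allIso m n, eul m n * F - F * eul m n = (k : ℂ) • F →
      ∀ v, extW ρ F v ∈ mM ρ := by
  let E : Module.End ℂ (M ⧸ mM ρ) :=
    (mM ρ).mapQ (mM ρ) (extW ρ (eul m n)) (allIso_mM (isoDer_le_allIso 0 eul_mem_isoDer))
  let ad : Module.End ℂ (Module.End ℂ (M ⧸ mM ρ)) := LinearMap.mulLeft ℂ E - LinearMap.mulRight ℂ E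
  have hfin : {k : ℕ | (k : ℂ) ∈ spectrum ℂ ad}.Finite :=
    (Module.End.finite_spectrum ad).preimage (Nat.cast_injective.injOn)
  obtain ⟨R, hR⟩ := hfin.bddAbove
  -- `R` bounds the natural numbers in the spectrum, so degrees from `R + 1` on are excluded.
  refine ⟨R + 1, fun k hk F hF h => ?_⟩
  let F' : Module.End ℂ (M ⧸ mM ρ) := (mM ρ).mapQ (mM ρ) (extW ρ F) (allIso_mM hF)
  have had : ad F' = (k : ℂ) • F' := by
    refine LinearMap.ext fun z => ?_
    obtain ⟨v, rfl⟩ := Submodule.Quotient.mk_surjective _ z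
    have hb := extW_bracket_even (ρ := ρ) eul_mem (allIso_le hF)
    rw [h, map_smul] at hb
    have hb' := LinearMap.congr_fun hb v
    exact congrArg (Submodule.Quotient.mk (p := mM ρ)) hb'.symm
  have hF0 : F' = 0 := by
    by_contra hne
    have : ad.HasEigenvalue (k : ℂ) := Module.End.hasEigenvalue_of_hasEigenvector
      ⟨Module.End.mem_eigenspace_iff.2 had, hne⟩
    exact absurd (hR (Module.End.HasEigenvalue.mem_spectrum this)) (by omega)
  intro v
  have := LinearMap.congr_fun hF0 (Submodule.Quotient.mk v)
  exact (Submodule.Quotient.mk_eq_zero _).1 this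

/-- Take an eigenvector of the Euler field on the fibre whose eigenvalue has maximal real part. A
field of degree k ≥ 1 would raise the eigenvalue by k. -/
theorem exists_top [FiniteDimensional ℂ (M ⧸ mM ρ)] (hm : mM ρ ≠ ⊤) :
    ∃ v ∉ mM ρ, ∀ k : ℕ, 1 ≤ k → ∀ F ∈ allIso m n, eul m n * F - F * eul m n = (k : ℂ) • F →
      extW ρ F v ∈ mM ρ := by
  have : Nontrivial (M ⧸ mM ρ) := Submodule.Quotient.nontrivial_iff.2 hm
  let E : Module.End ℂ (M ⧸ mM ρ) :=
    (mM ρ).mapQ (mM ρ) (extW ρ (eul m n)) (allIso_mM (isoDer_le_allIso 0 eul_mem_isoDer))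
  obtain ⟨c0, hc0⟩ := Module.End.exists_eigenvalue E
  obtain ⟨c, hc, hmax⟩ := Set.exists_max_image (spectrum ℂ E) Complex.re
    (Module.End.finite_spectrum E) ⟨c0, hc0.mem_spectrum⟩
  obtain ⟨q, hq⟩ := (Module.End.hasEigenvalue_iff_mem_spectrum.2 hc).exists_hasEigenvector
  obtain ⟨v, rfl⟩ := Submodule.Quotient.mk_surjective _ q
  refine ⟨v, fun hv => hq.2 ((Submodule.Quotient.mk_eq_zero _).2 hv), fun k hk F hF h => ?_⟩
  let F' : Module.End ℂ (M ⧸ mM ρ) := (mM ρ).mapQ (mM ρ) (extW ρ F) (allIso_mM hF)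
  by_contra hne
  have hb := extW_bracket_even (ρ := ρ) eul_mem (allIso_le hF)
  rw [h, map_smul] at hb
  have hb' : (k : ℂ) • F' (Submodule.Quotient.mk v) =
      E (F' (Submodule.Quotient.mk v)) - F' (E (Submodule.Quotient.mk v)) :=
    congrArg (Submodule.Quotient.mk (p := mM ρ)) (LinearMap.congr_fun hb v)
  rw [hq.apply_eq_smul, map_smul, eq_sub_iff_add_eq, ← add_smul] at hb'
  have hev : E.HasEigenvalue ((k : ℂ) + c) := Module.End.hasEigenvalue_of_hasEigenvector
    ⟨Module.End.mem_eigenspace_iff.2 hb'.symm,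
      fun h0 => hne ((Submodule.Quotient.mk_eq_zero _).1 h0)⟩
  have hle := hmax _ hev.mem_spectrum
  simp only [Complex.add_re, Complex.natCast_re] at hle
  have : (1 : ℝ) ≤ k := by exact_mod_cast hk
  linarith

/-- The operators on `A_{m,n}` that act on `M` with values in `𝔪 M`. -/
noncomputable def killer (ρ : ExtWittModule m n M) : Submodule ℂ (Module.End ℂ (A m n)) :=
  ⨅ v : M, (mM ρ).comap (LinearMap.applyₗ v ∘ₗ extW ρ)

theorem mem_killer {F : Module.End ℂ (A m n)} : F ∈ killer ρ ↔ ∀ v, extW ρ F v ∈ mM ρ := by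
  simp [killer, Submodule.mem_iInf]

theorem killer_bracket {p q : ZMod 2} {D F : Module.End ℂ (A m n)} (hD : D ∈ isoDer m n p)
    (hF : F ∈ isoDer m n q) (h : D ∈ killer ρ) : D * F - sgn p q • (F * D) ∈ killer ρ := by
  rw [mem_killer] at *
  intro v
  rw [extW_bracket ρ hD.1 hF.1]
  exact sub_mem (h _) (Submodule.smul_mem _ _ (extW_mM ρ hF (h v)))

theorem pow_pd_killer {R : ℕ} (hR : ∀ k : ℕ, R ≤ k → ∀ F ∈ allIso m n,
    eul m n * F - F * eul m n = (k : ℂ) • F → ∀ v, extW ρ F v ∈ mM ρ) (i : Fin m) {j : ℕ}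
    (hj : R ≤ j) : LinearMap.mulLeft ℂ (crd (.inl i) ^ (j + 1)) * pd (.inl i) ∈ killer ρ := by
  refine mem_killer.2 (hR j hj _ (mulLeft_mul_allIso ?_ (pd_mem _)) ?_)
  · rw [pow_succ]; exact mul_mem_mI_left _ (crd_mem_mI _)
  · rw [eul_mulLeft_pd (eul_pow i (j + 1)), Nat.cast_succ, add_sub_cancel_right]

theorem crd_pow_mI (i : Fin m) (j : ℕ) : (crd (.inl i) ^ (j + 1) : A m n) ∈ mI m n := by
  rw [pow_succ]; exact mul_mem_mI_left _ (crd_mem_mI _)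

/-- Here `g` is arbitrary in 𝔪, not homogeneous for the Euler field. With `x` the coordinate and `∂`
its derivation, `[x^(j+1) ∂, x g ∂] - [x^(j+2) ∂, g ∂] = 2 x^(j+1) g ∂`, the derivatives of `g`
cancelling. The first entries of both brackets have degree at least `R`, so they kill the fibre. -/
theorem pow_mul_pd_killer_same {R : ℕ} (hR : ∀ k : ℕ, R ≤ k → ∀ F ∈ allIso m n,
    eul m n * F - F * eul m n = (k : ℂ) • F → ∀ v, extW ρ F v ∈ mM ρ) (i : Fin m) {j : ℕ}
    (hj : R ≤ j) {q : ZMod 2} {g : A m n} (hg : g ∈ grA m n q) (hg' : g ∈ mI m n) :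
    LinearMap.mulLeft ℂ (crd (.inl i) ^ (j + 1) * g) * pd (.inl i) ∈ killer ρ := by
  have hD : ∀ j, LinearMap.mulLeft ℂ (crd (.inl i) ^ (j + 1) : A m n) * pd (.inl i) ∈
      isoDer m n 0 := fun j => by
    have := mulLeft_mul_isoDer (crd_pow_mem (n := n) i (j + 1)) (crd_pow_mI i j) (pd_mem (.inl i))
    rwa [par, Sum.elim_inl, add_zero] at this
  have hF : ∀ g ∈ grA m n q, g ∈ mI m n → LinearMap.mulLeft ℂ g * pd (.inl i) ∈ isoDer m n q := by
    intro g hg hg'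
    have := mulLeft_mul_isoDer hg hg' (pd_mem (.inl i))
    rwa [par, Sum.elim_inl, add_zero] at this
  have hxg : crd (.inl i) * g ∈ grA m n q := by
    have := grA_mul (crd_mem (.inl i)) hg
    rwa [par, Sum.elim_inl, zero_add] at this
  have b1 := killer_bracket (hD (j + 1)) (hF g hg hg') (pow_pd_killer hR i (by omega))
  have b2 := killer_bracket (hD j) (hF _ hxg (mul_mem_mI_left _ hg')) (pow_pd_killer hR i hj)
  have m1 := isoDer_bracket (hD (j + 1)) (hF g hg hg')
  have m2 := isoDer_bracket (hD j) (hF _ hxg (mul_mem_mI_left _ hg'))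
  have m3 : LinearMap.mulLeft ℂ (crd (.inl i) ^ (j + 1) * g) * pd (.inl i) ∈ superDer m n q := by
    have h := grA_mul (crd_pow_mem i (j + 1)) hg
    rw [zero_add] at h
    have := mulLeft_mul_mem h (pd_mem (.inl i))
    rwa [par, Sum.elim_inl, add_zero] at this
  rw [sgn_zero_left, one_smul] at b1 b2 m1 m2
  have key := superDer_ext (sub_mem m2.1 m1.1) (Submodule.smul_mem _ (2 : ℂ) m3) fun b => by
    simp only [LinearMap.sub_apply, LinearMap.smul_apply, Module.End.mul_apply, pd_crd,
      LinearMap.mulLeft_apply]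
    split_ifs with h
    · have hc := fun k => even_comm (crd_pow_mem (n := n) i k) g
      have hx : ∀ (x y : A m n), pd (.inl i) (x * y) = pd (.inl i) x * y + x * pd (.inl i) y := by
        intro x y; rw [superDer_mul (pd_mem _)]; simp [par, sig]
      simp only [mul_one, hx, pd_crd_pow_same, pd_crd, if_true, one_mul, mul_add,
        mul_smul_comm, mul_assoc, Nat.add_sub_cancel, ← hc]
      rw [← mul_assoc (crd (.inl i)), ← pow_succ', ← mul_assoc _ (crd (.inl i)), ← pow_succ]
      push_cast
      module
    · simp
  have h2 := sub_mem b2 b1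
  rw [key] at h2
  have := Submodule.smul_mem _ (2⁻¹ : ℂ) h2
  rwa [smul_smul, inv_mul_cancel₀ two_ne_zero, one_smul] at this

/-- For a direction `b` other than `i`, bracketing `x^(j+1) g ∂_i` with `x ∂_b` gives `x^(j+1) g
∂_b` up to a field of the form `x^(j+1) g' ∂_i` with `g' = x ∂_b g` in 𝔪, already known to kill the
fibre. -/
theorem pow_mul_pd_killer {R : ℕ} (hR : ∀ k : ℕ, R ≤ k → ∀ F ∈ allIso m n,
    eul m n * F - F * eul m n = (k : ℂ) • F → ∀ v, extW ρ F v ∈ mM ρ) (i : Fin m) {j : ℕ}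
    (hj : R ≤ j) {q : ZMod 2} {g : A m n} (hg : g ∈ grA m n q) (hg' : g ∈ mI m n) (b : Ix m n) :
    LinearMap.mulLeft ℂ (crd (.inl i) ^ (j + 1) * g) * pd b ∈ killer ρ := by
  by_cases hb : b = .inl i
  · subst hb; exact pow_mul_pd_killer_same hR i hj hg hg'
  have hxg : crd (.inl i) ^ (j + 1) * g ∈ grA m n q := by
    have h := grA_mul (crd_pow_mem i (j + 1)) hg
    rwa [zero_add] at h
  have hD : LinearMap.mulLeft ℂ (crd (.inl i) ^ (j + 1) * g) * pd (.inl i) ∈ isoDer m n q := by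
    have := mulLeft_mul_isoDer hxg (mul_mem_mI_left _ hg') (pd_mem (.inl i))
    rwa [par, Sum.elim_inl, add_zero] at this
  have hF : LinearMap.mulLeft ℂ (crd (.inl i)) * pd b ∈ isoDer m n (par b) := by
    have := mulLeft_mul_isoDer (crd_mem (.inl i)) (crd_mem_mI (.inl i)) (pd_mem (n := n) b)
    rwa [par, Sum.elim_inl, zero_add] at this
  have hg2 : crd (.inl i) * pd b g ∈ grA m n (par b + q) := by
    have := grA_mul (crd_mem (.inl i)) ((pd_mem b).1 _ _ hg)
    rwa [par, Sum.elim_inl, zero_add] at this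
  have h1 := killer_bracket hD hF (pow_mul_pd_killer_same hR i hj hg hg')
  have m1 := isoDer_bracket hD hF
  have h2 := pow_mul_pd_killer_same (ρ := ρ) hR i hj hg2 (mul_mem_mI_right _ (crd_mem_mI _))
  have m2 : LinearMap.mulLeft ℂ (crd (.inl i) ^ (j + 1) * (crd (.inl i) * pd b g)) *
      pd (.inl i) ∈ superDer m n (q + par b) := by
    have := mulLeft_mul_mem (grA_mul (crd_pow_mem i (j + 1)) hg2) (pd_mem (.inl i))
    rwa [par, Sum.elim_inl, add_zero, zero_add, add_comm] at this
  have key := superDer_ext (mulLeft_mul_mem hxg (pd_mem b))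
    (add_mem m1.1 (Submodule.smul_mem _ (sgn q (par b)) m2)) fun c => by
    have hx : pd b (crd (.inl i) ^ (j + 1) * g) = crd (.inl i) ^ (j + 1) * pd b g := by
      rw [superDer_mul (pd_mem b), pd_crd_pow_ne hb, zero_mul, zero_add,
        sig_of_mem _ (crd_pow_mem i _), sgn_zero_right, one_smul]
    have hx' : (crd (.inl i) : A m n) * (crd (.inl i) ^ (j + 1) * pd b g) =
        crd (.inl i) ^ (j + 1) * (crd (.inl i) * pd b g) := by
      rw [← mul_assoc, ← mul_assoc, ← pow_succ', ← pow_succ]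
    simp only [LinearMap.sub_apply, LinearMap.add_apply, LinearMap.smul_apply,
      Module.End.mul_apply, pd_crd, LinearMap.mulLeft_apply]
    by_cases hcb : b = c
    · subst hcb
      simp [Ne.symm hb, pd_crd]
    · by_cases hci : Sum.inl i = c
      · subst hci
        simp [hcb, hx, hx']
      · simp [hcb, hci]
  rw [key]
  exact add_mem h1 (Submodule.smul_mem _ _ h2)

theorem powI_pd_killer {R : ℕ} (hR : ∀ k : ℕ, R ≤ k → ∀ F ∈ allIso m n,
    eul m n * F - F * eul m n = (k : ℂ) • F → ∀ v, extW ρ F v ∈ mM ρ) (b : Ix m n) {z : A m n}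
    (hz : z ∈ powI m n (R + 2)) : LinearMap.mulLeft ℂ z * pd b ∈ killer ρ := by
  induction hz using Submodule.span_induction with
  | mem z hz =>
    obtain ⟨i, a, rfl⟩ := hz
    obtain ⟨x, hx, y, hy, rfl⟩ := exists_add a
    -- One of the `R + 2` factors is moved into the cofactor, so that the cofactor lies in 𝔪.
    rw [pow_succ, mul_assoc, mul_add, mul_add, mulLeft_add_mul]
    exact add_mem (pow_mul_pd_killer hR i le_rfl (grA_mul (crd_mem (.inl i)) hx)
      (mul_mem_mI_right _ (crd_mem_mI _)) b) (pow_mul_pd_killer hR i le_rfl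
      (grA_mul (crd_mem (.inl i)) hy) (mul_mem_mI_right _ (crd_mem_mI _)) b)
  | zero =>
    have : LinearMap.mulLeft ℂ (0 : A m n) * pd b = 0 := by ext; simp
    rw [this]; exact zero_mem _
  | add x y _ _ hx hy => rw [mulLeft_add_mul]; exact add_mem hx hy
  | smul c x _ hx => rw [mulLeft_smul_mul]; exact Submodule.smul_mem _ _ hx

/-- Some vector outside `𝔪 M` is mapped to `𝔪 M` by all vector fields vanishing to second
order. -/
theorem exists_sq_killed [FiniteDimensional ℂ (M ⧸ mM ρ)] (hm : mM ρ ≠ ⊤) :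
    ∃ v ∉ mM ρ, ∀ p, ∀ D ∈ superDer m n p, (∀ a, D a ∈ mI m n * mI m n) →
      extW ρ D v ∈ mM ρ := by
  obtain ⟨R, hR⟩ := exists_bound (ρ := ρ)
  obtain ⟨v, hv, htop⟩ := exists_top hm
  refine ⟨v, hv, fun p D hD hDa => ?_⟩
  rw [superDer_eq_pd hD, map_sum, LinearMap.sum_apply]
  refine Submodule.sum_mem _ fun b _ => ?_
  -- The coefficients `f` for which `f ∂_b` maps `v` into 𝔪M. The condition is linear in `f`, so it
  -- suffices to treat the two kinds of summands of 𝔪².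
  let Z : Submodule ℂ (A m n) := (mM ρ).comap
    ((LinearMap.applyₗ v ∘ₗ extW ρ) ∘ₗ (LinearMap.mulRight ℂ (pd b : Module.End ℂ (A m n))) ∘ₗ
      LinearMap.mul ℂ (A m n))
  have hZ : mI m n * mI m n ≤ Z := by
    refine (mI_sq_le_iSup R).trans (sup_le (iSup_le fun r f hf => ?_) fun z hz => ?_)
    · refine htop (r + 1) (by omega) (LinearMap.mulLeft ℂ f * pd b)
        (mulLeft_mul_allIso (mI_sq_le (lin_pow_le r hf)) (pd_mem b)) ?_
      rw [eul_mulLeft_pd (eul_lin_pow hf)]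
      push_cast
      ring_nf
    · exact mem_killer.1 (powI_pd_killer hR b hz) v
  exact hZ (hDa (crd b))

/-- Second order fields are stable under bracket with fields vanishing at the point, so the vectors
they send into 𝔪M form a subspace to which `eq_mM_or_top` applies. It exceeds 𝔪M by
`exists_sq_killed`. -/
theorem sq_killed (hAW : ρ.IsAW) (hsimple : ρ.IsSimple) [FiniteDimensional ℂ (M ⧸ mM ρ)]
    (hm : mM ρ ≠ ⊤) {lam : Fin m → ℂ} (h : cosetSpace ρ lam = ⊤) {p : ZMod 2}
    {D : Module.End ℂ (A m n)} (hD : D ∈ superDer m n p) (hDa : ∀ a, D a ∈ mI m n * mI m n)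
    (v : M) : extW ρ D v ∈ mM ρ := by
  let U : Submodule ℂ M :=
    { carrier := {v | ∀ p, ∀ D ∈ superDer m n p, (∀ a, D a ∈ mI m n * mI m n) →
        extW ρ D v ∈ mM ρ}
      zero_mem' := fun p D _ _ => by simp
      add_mem' := fun hx hy p D hD hDa => by
        rw [map_add]; exact add_mem (hx p D hD hDa) (hy p D hD hDa)
      smul_mem' := fun c x hx p D hD hDa => by
        rw [map_smul]; exact Submodule.smul_mem _ c (hx p D hD hDa) }
  have hU : U = mM ρ ∨ U = ⊤ := by
    refine eq_mM_or_top hAW hsimple h ?_ ?_ ?_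
    · exact fun z hz p D hD hDa => extW_mM ρ ⟨hD, fun a => mI_sq_le (hDa a)⟩ hz
    · intro v hv p D hD hDa
      rw [extW_parityOp ρ hD]
      exact Submodule.smul_mem _ _ (parityOp_mM ρ (hv p D hD hDa))
    · intro q F hF v hv p D hD hDa
      rw [extW_comp ρ hD hF.1]
      refine add_mem (hv _ _ (bracket_mem hD hF.1) fun a => ?_)
        (Submodule.smul_mem _ _ (extW_mM ρ hF (hv p D hD hDa)))
      exact sub_mem (hDa _) (Submodule.smul_mem _ _ (superDer_mI_sq hF.1 hF.2 (hDa a)))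
  rcases hU with hU | hU
  · obtain ⟨v, hv, hv'⟩ := exists_sq_killed (ρ := ρ) hm
    exact absurd (hU ▸ (show v ∈ U from hv')) hv
  · have : v ∈ U := by rw [hU]; trivial
    exact this p D hD hDa

/-! ### Finite dimension of the fibre. -/

theorem finiteDimensional_weightSpace (hc : ρ.IsCuspidal) (μ : Fin m → ℂ) :
    FiniteDimensional ℂ (ρ.weightSpace μ) := by
  obtain ⟨N, hN⟩ := hc.2
  exact Module.rank_lt_aleph0_iff.1 ((hN μ).trans (Cardinal.natCast_lt_aleph0))

theorem finiteDimensional_fibre (hAW : ρ.IsAW) (hc : ρ.IsCuspidal) {μ : Fin m → ℂ}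
    (h : cosetSpace ρ μ = ⊤) : FiniteDimensional ℂ (M ⧸ mM ρ) := by
  have := finiteDimensional_weightSpace hc μ
  refine Module.Finite.of_surjective ((mM ρ).mkQ ∘ₗ (ρ.weightSpace μ).subtype) fun q => ?_
  obtain ⟨v, rfl⟩ := Submodule.Quotient.mk_surjective _ q
  have hv : v ∈ ρ.weightSpace μ ⊔ mM ρ := by rw [weightSpace_sup_mM hAW h]; trivial
  obtain ⟨x, hx, z, hz, rfl⟩ := Submodule.mem_sup.1 hv
  refine ⟨⟨x, hx⟩, (Submodule.Quotient.eq _).2 ?_⟩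
  simpa using hz

end

/-! ### Δ-stable subspaces of the maximal ideal are zero. -/

section
variable {m n : ℕ}

theorem coeff_euler (i : Fin m) (f : Laurent m) (β : Fin m → ℤ) :
    (euler i f).coeff β = ((β i : ℤ) : ℂ) * f.coeff β := by
  induction f using AddMonoidAlgebra.induction_linear with
  | zero => simp
  | add f g hf hg => simp [hf, hg, mul_add]
  | single α c =>
    rw [euler_single]
    by_cases h : α = β
    · subst h; simp
    · simp [h]

/-- Induction on the number of terms reduces to a single monomial `c t^α`, whose value at the point
is `c`. -/
theorem laurent_eq_zero {K : Submodule ℂ (A m n)} (hK : ∀ i : Fin m, ∀ a ∈ K, del (.inl i) a ∈ K)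
    (he : ∀ a ∈ K, eps m n a = 0) (f : Laurent m) (hf : mk f 1 ∈ K) : f = 0 := by
  induction hN : f.coeff.support.card using Nat.strong_induction_on generalizing f with
  | _ N ih =>
    by_contra hne
    have hsupp : f.coeff.support.Nonempty := by
      rw [Finsupp.support_nonempty_iff]
      intro h0
      exact hne (AddMonoidAlgebra.ext (by simpa using h0))
    obtain ⟨α, hα⟩ := hsupp
    -- Applying `d_i - α_i` removes `α` from the support without adding exponents, so the induction
    -- hypothesis applies to the result.
    have hz : ∀ i, euler i f - ((α i : ℤ) : ℂ) • f = 0 := by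
      intro i
      have hc : ∀ β, (euler i f - ((α i : ℤ) : ℂ) • f).coeff β =
          (((β i : ℤ) : ℂ) - ((α i : ℤ) : ℂ)) * f.coeff β := by
        intro β; simp [coeff_euler, sub_mul]
      refine ih _ ?_ _ ?_ rfl
      · rw [← hN]
        refine Finset.card_lt_card (Finset.ssubset_iff_subset_ne.2 ⟨fun β hβ => ?_, fun h => ?_⟩)
        · rw [Finsupp.mem_support_iff, hc] at hβ
          exact Finsupp.mem_support_iff.2 (right_ne_zero_of_mul hβ)
        · rw [← h, Finsupp.mem_support_iff, hc] at hα
          simp at hα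
      · have := sub_mem (hK i _ hf) (Submodule.smul_mem _ ((α i : ℤ) : ℂ) hf)
        rw [del, Sum.elim_inl, mapA_mk] at this
        rw [map_sub, map_smul]
        exact this
    have hs : f = AddMonoidAlgebra.single α (f.coeff α) := by
      refine AddMonoidAlgebra.ext (Finsupp.ext fun β => ?_)
      by_cases h : α = β
      · subst h; simp
      · have h0 : f.coeff β = 0 := by
          obtain ⟨i, hi⟩ := Function.ne_iff.1 h
          have h1 : (euler i f - ((α i : ℤ) : ℂ) • f).coeff β = 0 := by rw [hz i]; simp
          have h2 : (((β i : ℤ) : ℂ) - ((α i : ℤ) : ℂ)) * f.coeff β = 0 := by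
            rw [← h1]; simp [coeff_euler, sub_mul]
          refine (mul_eq_zero.1 h2).resolve_left fun h3 => hi ?_
          exact_mod_cast (sub_eq_zero.1 h3).symm
        simp [h, h0]
    have h1 := he _ hf
    rw [eps_mk, hs] at h1
    simp only [AddMonoidAlgebra.lift_single, map_one, mul_one] at h1
    refine Finsupp.mem_support_iff.1 hα ?_
    simpa using h1

/-- The substitution `ξ_j ↦ 0` for `j` in a finite set. -/
theorem exists_subst (S : Finset (Fin n)) : ∃ P : A m n →ₐ[ℂ] A m n,
    (∀ α, P (tpow α) = tpow α) ∧ (∀ k, P (xi k) = if k ∈ S then 0 else xi k) ∧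
    ∀ a, (∀ j ∈ S, del (.inr j) a = 0) → P a = a := by
  induction S using Finset.induction_on with
  | empty => exact ⟨AlgHom.id ℂ _, by simp, by simp, by simp⟩
  | insert j S hj ih =>
    obtain ⟨P, h1, h2, h3⟩ := ih
    -- The substitution `ξ_j ↦ 0` is `1 - ξ_j ∂/∂ξ_j`. It is multiplicative because the quadratic
    -- cross term contains `ξ_j²`.
    let Q : A m n →ₗ[ℂ] A m n := LinearMap.id - LinearMap.mulLeft ℂ (xi j) ∘ₗ del (.inr j)
    have hQ : ∀ a, Q a = a - xi j * del (.inr j) a := fun a => rfl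
    have hxx : (xi j * xi j : A m n) = 0 := neg_eq_self (xi_mul_xi j j)
    have hmul : ∀ a b, Q (a * b) = Q a * Q b := by
      intro a b
      have hs : ∀ a : A m n, sig (par (.inr j : Ix m n)) a = parity m n a := fun a => rfl
      have e1 : xi j * del (.inr j) a * (xi j * del (.inr j) b) = 0 := by
        rw [mul_assoc, ← mul_assoc (del (.inr j) a), mul_xi, mul_assoc, ← mul_assoc, hxx, zero_mul]
      rw [hQ, hQ, hQ, sub_mul, mul_sub, mul_sub, e1, superDer_mul (del_mem _), hs, mul_add,
        ← mul_assoc, ← mul_assoc, ← mul_assoc, mul_xi, mul_assoc, mul_assoc]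
      abel
    let Q' : A m n →ₐ[ℂ] A m n := AlgHom.ofLinearMap Q (by rw [hQ, del_one]; simp) hmul
    have hQ' : ∀ a, Q' a = a - xi j * del (.inr j) a := fun a => rfl
    refine ⟨P.comp Q', fun α => ?_, fun k => ?_, fun a ha => ?_⟩
    · rw [AlgHom.comp_apply, hQ', del_tpow_odd, mul_zero, sub_zero, h1]
    · rw [AlgHom.comp_apply, hQ', del_xi]
      by_cases hjk : j = k
      · subst hjk; simp
      · simp [hjk, h2, Ne.symm hjk]
    · rw [AlgHom.comp_apply, hQ', ha j (Finset.mem_insert_self _ _), mul_zero, sub_zero]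
      exact h3 a fun k hk => ha k (Finset.mem_insert_of_mem hk)

/-- The substitution setting every `ξ_j` to zero fixes `a`, and its image consists of Laurent
polynomials. -/
theorem exists_laurent {a : A m n} (ha : ∀ j : Fin n, del (.inr j) a = 0) : ∃ f, a = mk f 1 := by
  obtain ⟨P, h1, h2, h3⟩ := exists_subst (m := m) (n := n) Finset.univ
  rw [← h3 a fun j _ => ha j]
  clear ha
  induction a using A_induction with
  | h1 => exact ⟨1, by rw [map_one]; rfl⟩
  | ht α => exact ⟨_, h1 α⟩
  | hx j => exact ⟨0, by simp [h2]⟩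
  | hadd a b ha hb =>
    obtain ⟨f, hf⟩ := ha
    obtain ⟨g, hg⟩ := hb
    exact ⟨f + g, by rw [map_add, hf, hg, map_add, LinearMap.add_apply]⟩
  | hmul a b ha hb =>
    obtain ⟨f, hf⟩ := ha
    obtain ⟨g, hg⟩ := hb
    exact ⟨f * g, by rw [map_mul, hf, hg, mk_mul_mk, one_mul]⟩
  | hs c a ha =>
    obtain ⟨f, hf⟩ := ha
    exact ⟨c • f, by rw [map_smul, hf, map_smul, LinearMap.smul_apply]⟩

/-- A subspace of the maximal ideal stable under the `d_i` and `∂/∂ξ_j` is zero. -/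
theorem eq_zero_of_mem_stable {K : Submodule ℂ (A m n)} (hK : ∀ b, ∀ a ∈ K, del b a ∈ K)
    (he : ∀ a ∈ K, eps m n a = 0) {a : A m n} (ha : a ∈ K) : a = 0 := by
  -- `S` contains the odd variables that may occur in `a`. The derivative in a direction `j` of `S`
  -- no longer involves `ξ_j`, so it is zero by induction, and then neither does `a`.
  have key : ∀ (S : Finset (Fin n)), ∀ a ∈ K, (∀ j ∉ S, del (.inr j) a = 0) → a = 0 := by
    intro S
    induction S using Finset.induction_on with
    | empty =>
      intro a ha h
      obtain ⟨f, rfl⟩ := exists_laurent fun j => h j (by simp)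
      rw [laurent_eq_zero (fun i => hK (.inl i)) he f ha]
      simp
    | insert j S _ ih =>
      intro a ha h
      have h0 : del (.inr j) a = 0 := by
        refine ih _ (hK _ a ha) fun k hk => ?_
        by_cases hkj : k = j
        · subst hkj
          have := del_comm (.inr k) (.inr k) a
          simp only [par, Sum.elim_inr, sgn_one_one, neg_one_smul] at this
          exact neg_eq_self this
        · rw [del_comm, h k (by simp [hkj, hk]), map_zero, smul_zero]
      refine ih a ha fun k hk => ?_
      by_cases hkj : k = j
      · subst hkj; exact h0
      · exact h k (by simp [hkj, hk])
  exact key Finset.univ a ha (by simp)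

end

/-! ### Linear parts of fields vanishing at the point. -/

section
variable {m n : ℕ}

/-- The vector field with linear part `X` at the point `t = 1`, `ξ = 0`. -/
noncomputable def linField (m n : ℕ) :
    Matrix (Ix m n) (Ix m n) ℂ →ₗ[ℂ] Module.End ℂ (A m n) where
  toFun X := ∑ a, ∑ b, X a b • (LinearMap.mulLeft ℂ (crd a) * del b)
  map_add' X Y := by simp [add_smul, Finset.sum_add_distrib]
  map_smul' c X := by simp [mul_smul, Finset.smul_sum]

theorem linField_apply (X : Matrix (Ix m n) (Ix m n) ℂ) :
    linField m n X = ∑ a, ∑ b, X a b • (LinearMap.mulLeft ℂ (crd a) * del b) := rfl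

theorem linField_mem {p : ZMod 2} {X : Matrix (Ix m n) (Ix m n) ℂ} (hX : X ∈ grGL m n p) :
    linField m n X ∈ isoDer m n p := by
  rw [linField_apply]
  refine Submodule.sum_mem _ fun a _ => Submodule.sum_mem _ fun b _ => ?_
  by_cases h : par a + par b = p
  · subst h
    exact Submodule.smul_mem _ _ (mulLeft_mul_isoDer (crd_mem a) (crd_mem_mI a) (del_mem b))
  · rw [hX a b h, zero_smul]; exact zero_mem _

theorem coef_linField (X : Matrix (Ix m n) (Ix m n) ℂ) (c : Ix m n) :
    coef c (linField m n X) = ∑ a, X a c • crd a := by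
  rw [linField_apply, map_sum]
  refine Finset.sum_congr rfl fun a _ => ?_
  rw [map_sum, Finset.sum_eq_single c (fun b _ hb => by simp [coef_mulLeft_del, Ne.symm hb])
    (by simp), map_smul, coef_mulLeft_del, if_pos rfl]

/-- The linear part of a vector field at the point `t = 1`, `ξ = 0`. -/
noncomputable def jac (D : Module.End ℂ (A m n)) : Matrix (Ix m n) (Ix m n) ℂ :=
  Matrix.of fun a b => eps m n (mcoef a b D)

theorem jac_apply (D : Module.End ℂ (A m n)) (a b : Ix m n) :
    jac D a b = eps m n (del a (coef b D)) := by
  change eps m n (sig (par a) (del a (coef b D))) = _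
  rw [eps_sig]

theorem jac_linField (X : Matrix (Ix m n) (Ix m n) ℂ) : jac (linField m n X) = X := by
  ext a c
  rw [jac_apply, coef_linField]
  simp only [map_sum, map_smul, del_crd, smul_eq_mul, mul_ite, mul_one, mul_zero,
    Finset.sum_ite_eq, Finset.mem_univ, if_true]

theorem jac_mem {p : ZMod 2} {D : Module.End ℂ (A m n)} (hD : D ∈ superDer m n p) :
    jac D ∈ grGL m n p := by
  intro a b h
  refine eps_odd ?_
  have h1 : p + (par a + par b) = 1 := by
    revert h; generalize par a + par b = r; revert p r
    rintro p - r; revert p r; decide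
  rw [← h1]
  exact mcoef_mem hD a b

/-- Evaluate `mcoef_bracket` at the point. The terms in which a field differentiates a coefficient
vanish there, and what remains is the supercommutator of matrices. -/
theorem jac_bracket {p q : ZMod 2} {D F : Module.End ℂ (A m n)} (hD : D ∈ isoDer m n p)
    (hF : F ∈ isoDer m n q) :
    jac (D * F - sgn p q • (F * D)) = jac D * jac F - sgn p q • (jac F * jac D) := by
  ext a b
  change eps m n (mcoef a b _) = _
  rw [mcoef_bracket hD.1 hF.1]
  simp only [map_add, map_sub, map_smul, map_sum, map_mul, eps_sig, mem_mI.1 (hD.2 _),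
    mem_mI.1 (hF.2 _), Matrix.sub_apply, Matrix.smul_apply, Matrix.mul_apply]
  simp [jac]

/-- Taylor expansion of the coefficients: they vanish at the point, and `linField` reproduces their
linear terms. Modulo second order fields only the matrix remains. -/
theorem sub_linField {p : ZMod 2} {D : Module.End ℂ (A m n)} (hD : D ∈ isoDer m n p) :
    D - linField m n (jac D) ∈ superDer m n p ∧
      ∀ a, (D - linField m n (jac D)) a ∈ mI m n * mI m n := by
  have h := sub_mem hD (linField_mem (jac_mem hD.1))
  refine ⟨h.1, fun a => ?_⟩
  rw [superDer_eq h.1]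
  refine Submodule.sum_mem _ fun b _ => mul_mem_mI_sq_right _ ?_
  have hc : eps m n (coef b D) = 0 := by
    rcases b with i | j
    · exact mem_mI.1 (mul_mem_mI_left _ (hD.2 _))
    · exact mem_mI.1 (hD.2 _)
  have ht := taylor (coef b D)
  rw [hc, zero_smul, sub_zero] at ht
  rw [map_sub, coef_linField]
  simpa only [jac_apply] using ht

end

/-! ### The `gl(m,n)`-module on the fibre. -/

section
variable {m n : ℕ} {M : Type*} [AddCommGroup M] [Module ℂ M] {ρ : ExtWittModule m n M}
  {lam : Fin m → ℂ}

theorem parityOp_topSpace {v : M} (hv : v ∈ topSpace ρ lam) :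
    parityOp ρ.isInternal v ∈ topSpace ρ lam := by
  rw [mem_topSpace] at *
  intro b
  rw [extW_parityOp ρ (del_mem b), hv b, map_smul, smul_comm]
  rcases b with i | j
  · simp [par, sgn_zero_right]
  · simp

section
variable (hc : IsCompl (topSpace ρ lam) (mM ρ))

/-- The projection of `M` onto the fibre, realized as `topSpace`. -/
noncomputable def toTop : M →ₗ[ℂ] topSpace ρ lam := (topSpace ρ lam).projectionOnto (mM ρ) hc

theorem toTop_coe (v : topSpace ρ lam) : toTop hc v = v :=
  Submodule.projectionOnto_apply_left hc v

theorem toTop_eq_zero {v : M} : toTop hc v = 0 ↔ v ∈ mM ρ := by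
  rw [← LinearMap.mem_ker, toTop, Submodule.ker_projectionOnto]

theorem sub_toTop_mem (v : M) : v - (toTop hc v : M) ∈ mM ρ := by
  rw [← toTop_eq_zero hc, map_sub, toTop_coe, sub_self]

theorem toTop_eq {v w : M} (h : v - w ∈ mM ρ) : toTop hc v = toTop hc w := by
  rw [← sub_eq_zero, ← map_sub, toTop_eq_zero]; exact h

theorem toTop_actA (hAW : ρ.IsAW) (a : A m n) (v : topSpace ρ lam) :
    toTop hc (ρ.actA a v) = eps m n a • v := by
  have h := actA_mem_mM ρ (sub_eps_mem a) (v : M)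
  rw [map_sub, map_smul, LinearMap.sub_apply, LinearMap.smul_apply, hAW.2] at h
  rw [toTop_eq hc h, map_smul, toTop_coe]

theorem toTop_extW_toTop {p : ZMod 2} {D : Module.End ℂ (A m n)} (hD : D ∈ isoDer m n p) (v : M) :
    toTop hc (extW ρ D (toTop hc v)) = toTop hc (extW ρ D v) := by
  symm
  refine toTop_eq hc ?_
  rw [← map_sub]
  exact extW_mM ρ hD (sub_toTop_mem hc v)

theorem toTop_parityOp (v : M) :
    (toTop hc (parityOp ρ.isInternal v) : M) = parityOp ρ.isInternal (toTop hc v) := by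
  have h := parityOp_mM ρ (sub_toTop_mem hc v)
  rw [map_sub] at h
  rw [toTop_eq hc h]
  exact congrArg Subtype.val (toTop_coe hc ⟨_, parityOp_topSpace (toTop hc v).2⟩)

theorem toTop_mem_gr {p : ZMod 2} {v : M} (hv : v ∈ ρ.gr p) : (toTop hc v : M) ∈ ρ.gr p := by
  rw [mem_gr_iff ρ.isInternal] at *
  rw [← toTop_parityOp, hv, map_smul]
  rfl

/-- The operator by which a matrix acts on the fibre. -/
noncomputable def glAct :
    Matrix (Ix m n) (Ix m n) ℂ →ₗ[ℂ] Module.End ℂ (topSpace ρ lam) where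
  toFun X := toTop hc ∘ₗ extW ρ (linField m n X) ∘ₗ (topSpace ρ lam).subtype
  map_add' X Y := by ext v; simp
  map_smul' c X := by ext v; simp

theorem glAct_apply (X : Matrix (Ix m n) (Ix m n) ℂ) (v : topSpace ρ lam) :
    glAct hc X v = toTop hc (extW ρ (linField m n X) v) := rfl

variable (hk : ∀ (p : ZMod 2) (D : Module.End ℂ (A m n)), D ∈ superDer m n p →
  (∀ a, D a ∈ mI m n * mI m n) → ∀ v : M, extW ρ D v ∈ mM ρ)

include hk in
-- By `sub_linField`, `D` differs from the linear field with the same matrix by a second order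
-- field, which acts on the fibre by zero.
theorem toTop_extW {p : ZMod 2} {D : Module.End ℂ (A m n)} (hD : D ∈ isoDer m n p)
    (v : topSpace ρ lam) : toTop hc (extW ρ D v) = glAct hc (jac D) v := by
  have h := hk p _ (sub_linField hD).1 (sub_linField hD).2 v
  rw [map_sub, LinearMap.sub_apply] at h
  rw [toTop_eq hc h, glAct_apply]

/-- The `gl(m,n)`-module structure on the fibre. -/
noncomputable def fibreModule : GLModule m n (topSpace ρ lam) where
  gr p := (ρ.gr p).comap (topSpace ρ lam).subtype
  isInternal := by
    rw [isInternal_iff]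
    have hi := (isInternal_iff ρ.gr).1 ρ.isInternal
    refine ⟨Submodule.disjoint_def.2 fun v h0 h1 => ?_, codisjoint_iff.2 (eq_top_iff.2 fun v _ => ?_)⟩
    · exact Subtype.ext (Submodule.disjoint_def.1 hi.disjoint _ h0 h1)
    · obtain ⟨x, hx, y, hy, hxy⟩ := exists_gr_add ρ.isInternal
        (fun _ hv => parityOp_topSpace hv) v.2
      have : v = ⟨x, hx.1⟩ + ⟨y, hy.1⟩ := Subtype.ext hxy
      rw [this]
      exact Submodule.add_mem_sup hx.2 hy.2
  act := glAct hc
  act_mem p q X hX v hv := toTop_mem_gr hc (extW_mem ρ (linField_mem hX).1 hv)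
  act_bracket p q X hX Y hY := by
    refine LinearMap.ext fun v => ?_
    have h1 := linField_mem hX
    have h2 := linField_mem hY
    have hb := jac_bracket h1 h2
    rw [jac_linField, jac_linField] at hb
    -- A bracket of linear fields need not be a linear field, as these are built from `d_i = t_i
    -- ∂/∂t_i`. Only its linear part matters on the fibre.
    rw [← hb, ← toTop_extW hc hk (isoDer_bracket h1 h2), extW_bracket ρ h1.1 h2.1]
    simp only [LinearMap.sub_apply, LinearMap.smul_apply, Module.End.mul_apply, map_sub, map_smul,
      glAct_apply, toTop_extW_toTop hc h1, toTop_extW_toTop hc h2]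

theorem fibreModule_act (X : Matrix (Ix m n) (Ix m n) ℂ) :
    (fibreModule hc hk).act X = glAct hc X := rfl

/-- For a submodule `N` of the fibre, `N + 𝔪M` is stable under parity and under all fields vanishing
at the point, since these act on the fibre through matrices. Then `eq_mM_or_top` applies. -/
theorem fibreModule_isSimple (hAW : ρ.IsAW) (hsimple : ρ.IsSimple) (hm : mM ρ ≠ ⊤)
    (h : cosetSpace ρ lam = ⊤) : (fibreModule hc hk).IsSimple := by
  refine ⟨?_, fun N hgr hact => ?_⟩
  · rw [Submodule.nontrivial_iff_ne_bot]
    intro h0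
    have := hc.sup_eq_top
    rw [h0, bot_sup_eq] at this
    exact hm this
  have hU : N.map (topSpace ρ lam).subtype ⊔ mM ρ = mM ρ ∨
      N.map (topSpace ρ lam).subtype ⊔ mM ρ = ⊤ := by
    refine eq_mM_or_top hAW hsimple h le_sup_right ?_ ?_
    · intro v hv
      obtain ⟨x, ⟨w, hw, rfl⟩, z, hz, rfl⟩ := Submodule.mem_sup.1 hv
      rw [map_add]
      refine add_mem (Submodule.mem_sup_left ?_) (Submodule.mem_sup_right (parityOp_mM ρ hz))
      clear hv
      rw [SetLike.mem_coe, hgr] at hw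
      induction hw using Submodule.iSup_induction' with
      | mem p w hw =>
        have h2 : parityOp ρ.isInternal w = sgn 1 p • (w : M) :=
          (mem_gr_iff ρ.isInternal).1 hw.2
        rw [Submodule.subtype_apply, h2]
        exact Submodule.smul_mem _ _ (Submodule.mem_map_of_mem hw.1)
      | zero => simp
      | add x y _ _ hx hy => rw [map_add, map_add]; exact add_mem hx hy
    · intro p D hD v hv
      obtain ⟨x, ⟨w, hw, rfl⟩, z, hz, rfl⟩ := Submodule.mem_sup.1 hv
      rw [map_add]
      refine add_mem ?_ (Submodule.mem_sup_right (extW_mM ρ hD hz))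
      have h1 := sub_toTop_mem hc (extW ρ D w)
      rw [toTop_extW hc hk hD] at h1
      have h2 : ((glAct hc (jac D) w : topSpace ρ lam) : M) ∈
          N.map (topSpace ρ lam).subtype := Submodule.mem_map_of_mem (hact _ _ hw)
      have := Submodule.add_mem_sup h2 h1
      rwa [add_sub_cancel] at this
  rcases hU with hU | hU
  · left
    rw [eq_bot_iff]
    intro v hv
    have h1 : (v : M) ∈ mM ρ := by
      rw [← hU]; exact Submodule.mem_sup_left (Submodule.mem_map_of_mem hv)
    exact Subtype.ext (Submodule.disjoint_def.1 hc.disjoint _ v.2 h1)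
  · right
    rw [eq_top_iff]
    intro v _
    have h1 : (v : M) ∈ N.map (topSpace ρ lam).subtype ⊔ mM ρ := by rw [hU]; trivial
    obtain ⟨x, ⟨w, hw, rfl⟩, z, hz, hxz⟩ := Submodule.mem_sup.1 h1
    have : v = w := by
      have := toTop_eq hc (v := (v : M)) (w := (w : M)) (by rw [← hxz]; simpa using hz)
      rwa [toTop_coe, toTop_coe] at this
    rw [this]; exact hw

theorem glAct_eq_sum (X : Matrix (Ix m n) (Ix m n) ℂ) (v : topSpace ρ lam) :
    glAct hc X v = ∑ a, ∑ b, X a b • glAct hc (Matrix.single a b 1) v := by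
  conv_lhs => rw [Matrix.matrix_eq_sum_single X]
  simp only [map_sum, LinearMap.sum_apply]
  refine Finset.sum_congr rfl fun a _ => Finset.sum_congr rfl fun b _ => ?_
  rw [← LinearMap.smul_apply, ← map_smul, Matrix.smul_single, smul_eq_mul, mul_one]

/-! ### The action of a vector field on the realized fibre. -/

/-- The difference of the actions of `D` on `topSpace` in `M` and in the tensor module. -/
noncomputable def defect (D : Module.End ℂ (A m n)) (v : topSpace ρ lam) : M :=
  extW ρ D v - (ρ.actA (lamc lam D) v +
    ∑ a, ∑ b, ρ.actA (mcoef a b D) (glAct hc (Matrix.single a b 1) v))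

theorem coef_del (b c : Ix m n) : coef c (del b : Module.End ℂ (A m n)) = if c = b then 1 else 0 := by
  rw [← coef_mulLeft_del]
  congr 1
  ext; simp

theorem mcoef_del (a b c : Ix m n) : mcoef a b (del c : Module.End ℂ (A m n)) = 0 := by
  change sig (par a) (del a (coef b (del c))) = 0
  rw [coef_del]
  split_ifs <;> simp [del_one]

theorem lamc_del (c : Ix m n) : lamc lam (del c : Module.End ℂ (A m n)) =
    Sum.elim lam (0 : Fin n → ℂ) c • (1 : A m n) := by
  rcases c with i | j <;> simp [lamc, coef_del]

theorem del_actA_topSpace (x : A m n) (w : topSpace ρ lam) (c : Ix m n) :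
    extW ρ (del c) (ρ.actA x w) = ρ.actA (del c x) w +
      Sum.elim lam (0 : Fin n → ℂ) c • ρ.actA x w := by
  rw [extW_actA ρ (del_mem c), mem_topSpace.1 w.2 c, map_smul]
  rcases c with i | j <;> simp [par, sig]

/-- Differentiating a defect produces the defect of a bracket and a multiple of the original, so
defects are closed under Δ. -/
theorem del_defect {p : ZMod 2} {D : Module.End ℂ (A m n)} (hD : D ∈ superDer m n p) (c : Ix m n)
    (v : topSpace ρ lam) : extW ρ (del c) (defect hc D v) =
      defect hc (del c * D - sgn (par c) p • (D * del c)) v +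
        Sum.elim lam (0 : Fin n → ℂ) c • defect hc D v := by
  have h1 : lamc lam (del c * D - sgn (par c) p • (D * del c)) = del c (lamc lam D) := by
    rw [lamc_bracket lam (del_mem c) hD, lamc_del, map_smul, superDer_one hD]
    simp
  have h2 : ∀ a b, mcoef a b (del c * D - sgn (par c) p • (D * del c)) =
      del c (mcoef a b D) := by
    intro a b
    rw [mcoef_bracket (del_mem c) hD]
    simp [mcoef_del]
  -- The sign matters only for odd `c`, where the eigenvalue is zero.
  have h3 : sgn (par c) p • Sum.elim lam (0 : Fin n → ℂ) c • extW ρ D v =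
      Sum.elim lam (0 : Fin n → ℂ) c • extW ρ D v := by
    rcases c with i | j <;> simp [par, sgn_zero_left]
  simp only [defect, map_sub, map_add, map_sum, del_actA_topSpace, h1, h2]
  rw [extW_comp ρ (del_mem c) hD, mem_topSpace.1 v.2 c, map_smul, h3]
  simp only [map_sub, LinearMap.sub_apply, map_smul, LinearMap.smul_apply,
    Finset.sum_add_distrib, smul_sub, smul_add, Finset.smul_sum]
  abel

include hk in
-- Modulo 𝔪M all coefficients may be evaluated at the point. The constant part of `D` acts by the
-- weight, giving the `lamc` term, and the rest acts through its linear part.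
theorem defect_mem (hAW : ρ.IsAW) {p : ZMod 2} {D : Module.End ℂ (A m n)}
    (hD : D ∈ superDer m n p) (v : topSpace ρ lam) : defect hc D v ∈ mM ρ := by
  rw [← toTop_eq_zero hc]
  have h0 := sub_const_mem hD
  set D0 := D - ∑ b, eps m n (coef b D) • del b with hD0
  have hj : jac D0 = jac D := by
    ext a b
    simp only [jac, hD0, Matrix.of_apply, map_sub, map_sum, map_smul, mcoef_del, smul_zero,
      Finset.sum_const_zero, sub_zero]
  have hDD : D = D0 + ∑ b, eps m n (coef b D) • del b := by rw [hD0]; abel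
  have e1 : toTop hc (extW ρ D v) = glAct hc (jac D) v + eps m n (lamc lam D) • v := by
    conv_lhs => rw [hDD]
    rw [map_add, LinearMap.add_apply, map_add, toTop_extW hc hk h0, hj]
    congr 1
    have hb : ∀ b, toTop hc (extW ρ (del b) v) = Sum.elim lam (0 : Fin n → ℂ) b • v := by
      intro b
      rw [mem_topSpace.1 v.2, map_smul, toTop_coe]
    rw [map_sum, LinearMap.sum_apply, map_sum]
    simp only [map_smul, LinearMap.smul_apply, hb]
    simp [Fintype.sum_sum_type, lamc, Finset.sum_smul, smul_smul, mul_comm]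
  simp only [defect, map_sub, map_add, map_sum, toTop_actA hc hAW]
  rw [e1, glAct_eq_sum, add_comm]
  exact sub_self _

include hk in
-- The defect and all its Δ-derivatives lie in 𝔪M, so it belongs to the core of 𝔪M, which is zero.
theorem extW_topSpace (hAW : ρ.IsAW) (hsimple : ρ.IsSimple) (hm : mM ρ ≠ ⊤) {p : ZMod 2}
    {D : Module.End ℂ (A m n)} (hD : D ∈ superDer m n p) (v : topSpace ρ lam) :
    extW ρ D v = ρ.actA (lamc lam D) v +
      ∑ a, ∑ b, ρ.actA (mcoef a b D) (glAct hc (Matrix.single a b 1) v) := by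
  rw [← sub_eq_zero]
  change defect hc D v = 0
  have : defect hc D v ∈ core ρ (mM ρ) := by
    refine mem_core.2 fun l => ?_
    induction l generalizing p D with
    | nil => exact defect_mem hc hk hAW hD v
    | cons c l ih =>
      rw [word, Module.End.mul_apply, del_defect hc hD, map_add, map_smul]
      exact add_mem (ih (bracket_mem (del_mem c) hD)) (Submodule.smul_mem _ _ (ih hD))
  rwa [core_mM hAW hsimple hm, Submodule.mem_bot] at this

/-! ### The isomorphism from the tensor module. -/

/-- The map `a ⊗ v ↦ a v`. -/
noncomputable def fromTensor (ρ : ExtWittModule m n M) (lam : Fin m → ℂ) :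
    A m n ⊗[ℂ] topSpace ρ lam →ₗ[ℂ] M :=
  TensorProduct.lift (LinearMap.compl₂ ρ.actA (topSpace ρ lam).subtype)

theorem fromTensor_tmul (a : A m n) (v : topSpace ρ lam) :
    fromTensor ρ lam (a ⊗ₜ v) = ρ.actA a v := rfl

include hk in
-- By the Leibniz rule the formula on the fibre determines the action on all `a v`. The twist of `y`
-- in the tensor module is the sign for moving a coefficient past `y`.
theorem fromTensor_tensorW (hAW : ρ.IsAW) (hsimple : ρ.IsSimple) (hm : mM ρ ≠ ⊤) {p : ZMod 2}
    {D : Module.End ℂ (A m n)} (hD : D ∈ superDer m n p) (z : A m n ⊗[ℂ] topSpace ρ lam) :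
    fromTensor ρ lam (tensorW lam (fibreModule hc hk) D z) =
      extW ρ D (fromTensor ρ lam z) := by
  induction z using TensorProduct.induction_on with
  | zero => simp
  | add x y hx hy => simp only [map_add, hx, hy]
  | tmul y v =>
    have h1 : ∀ a b, mcoef a b D * sig (par a + par b) y = sig p y * mcoef a b D := by
      intro a b
      have h := mcoef_mem hD a b
      rw [supercomm h, sig_sig, add_assoc, CharTwo.add_self_eq_zero, add_zero]
    rw [tensorW_tmul, fromTensor_tmul, extW_actA ρ hD,
      extW_topSpace hc hk hAW hsimple hm hD]
    simp only [map_add, map_sum, fromTensor_tmul, fibreModule_act, h1, hAW.1, LinearMap.add_apply,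
      supercomm (lamc_mem lam hD) y]
    abel

theorem fromTensor_tensorA (hAW : ρ.IsAW) (a : A m n) (z : A m n ⊗[ℂ] topSpace ρ lam) :
    fromTensor ρ lam (tensorA m n _ a z) = ρ.actA a (fromTensor ρ lam z) := by
  induction z using TensorProduct.induction_on with
  | zero => simp
  | add x y hx hy => simp only [map_add, hx, hy]
  | tmul y v => rw [tensorA_tmul, fromTensor_tmul, fromTensor_tmul, hAW.1]

theorem fromTensor_mem {p : ZMod 2} {z : A m n ⊗[ℂ] topSpace ρ lam}
    (hz : z ∈ grTensor (fibreModule hc hk).gr p) : fromTensor ρ lam z ∈ ρ.gr p := by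
  induction hz using Submodule.span_induction with
  | zero => simp
  | add x y _ _ hx hy => rw [map_add]; exact add_mem hx hy
  | smul c x _ hx => rw [map_smul]; exact Submodule.smul_mem _ _ hx
  | mem x hx =>
    obtain ⟨i, j, y, hy, v, hv, rfl, rfl⟩ := hx
    exact ρ.actA_mem i j y hy v hv

theorem fromTensor_parityOp (z : A m n ⊗[ℂ] topSpace ρ lam) :
    fromTensor ρ lam (parityOp (isInternal_grTensor (fibreModule hc hk).isInternal) z) =
      parityOp ρ.isInternal (fromTensor ρ lam z) := by
  have h : ∀ p, ∀ z ∈ grTensor (m := m) (n := n) (fibreModule hc hk).gr p, fromTensor ρ lam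
      (parityOp (isInternal_grTensor (fibreModule hc hk).isInternal) z) =
      parityOp ρ.isInternal (fromTensor ρ lam z) := by
    intro p z hz
    rw [(mem_gr_iff _).1 hz, (mem_gr_iff _).1 (fromTensor_mem hc hk hz), map_smul]
  obtain ⟨x, hx, y, hy, rfl⟩ := exists_gr_add
    (isInternal_grTensor (m := m) (n := n) (fibreModule hc hk).isInternal) (N := ⊤) (by simp)
    (Submodule.mem_top (x := z))
  simp only [map_add, h 0 x hx.2, h 1 y hy.2]

include hc hk in
-- The range is a graded submodule containing the realized fibre, which is nonzero.
theorem fromTensor_surjective (hAW : ρ.IsAW) (hsimple : ρ.IsSimple) (hm : mM ρ ≠ ⊤) :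
    Function.Surjective (fromTensor ρ lam) := by
  rw [← LinearMap.range_eq_top]
  refine (hsimple.2 _ ((isGraded_iff ρ.isInternal).2 ?_) ?_ ?_).resolve_left ?_
  · rintro _ ⟨z, rfl⟩
    rw [← fromTensor_parityOp hc hk]
    exact LinearMap.mem_range_self _ _
  · rintro p D _ ⟨z, rfl⟩
    rw [← extW_coe, ← fromTensor_tensorW hc hk hAW hsimple hm D.2]
    exact LinearMap.mem_range_self _ _
  · rintro a _ ⟨z, rfl⟩
    rw [← fromTensor_tensorA hAW]
    exact LinearMap.mem_range_self _ _
  · intro h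
    apply hm
    have h0 : topSpace ρ lam = ⊥ := by
      rw [eq_bot_iff]
      intro v hv
      rw [← h]
      exact ⟨1 ⊗ₜ ⟨v, hv⟩, by rw [fromTensor_tmul]; exact hAW.2 v⟩
    have := hc.sup_eq_top
    rwa [h0, bot_sup_eq] at this

theorem del_fromTensor (b : Ix m n) (z : A m n ⊗[ℂ] topSpace ρ lam) :
    fromTensor ρ lam ((del b).rTensor (topSpace ρ lam) z) =
      extW ρ (del b) (fromTensor ρ lam z) -
        Sum.elim lam (0 : Fin n → ℂ) b • fromTensor ρ lam z := by
  induction z using TensorProduct.induction_on with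
  | zero => simp
  | add x y hx hy => simp only [map_add, hx, hy, smul_add]; abel
  | tmul y v => rw [LinearMap.rTensor_tmul, fromTensor_tmul, fromTensor_tmul, del_actA_topSpace]; abel

include hc in
-- In a basis of the fibre, the i-th coordinates of kernel elements form a Δ-stable subspace of `A`,
-- because the kernel is stable under Δ acting on the first factor. Reducing modulo 𝔪M shows that
-- these coordinates vanish at the point, so they are zero.
theorem fromTensor_injective (hAW : ρ.IsAW) [FiniteDimensional ℂ (topSpace ρ lam)] :
    Function.Injective (fromTensor ρ lam) := by
  rw [injective_iff_map_eq_zero]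
  intro z hz
  let B := Module.finBasis ℂ (topSpace ρ lam)
  let c : ∀ _ : Fin (Module.finrank ℂ (topSpace ρ lam)), A m n ⊗[ℂ] topSpace ρ lam →ₗ[ℂ] A m n :=
    fun i => (TensorProduct.rid ℂ (A m n)).toLinearMap ∘ₗ (B.coord i).lTensor (A m n)
  have hc1 : ∀ i y v, c i (y ⊗ₜ v) = B.coord i v • y := fun i y v => rfl
  have hsum : ∀ z, z = ∑ i, c i z ⊗ₜ[ℂ] B i := by
    intro z
    induction z using TensorProduct.induction_on with
    | zero => simp
    | add x y hx hy =>
      simp only [map_add, TensorProduct.add_tmul, Finset.sum_add_distrib]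
      rw [← hx, ← hy]
    | tmul y v =>
      simp only [hc1, TensorProduct.smul_tmul]
      rw [← TensorProduct.tmul_sum]
      congr 1
      exact (B.sum_repr v).symm
  have hcd : ∀ i b z, c i ((del b).rTensor (topSpace ρ lam) z) = del b (c i z) := by
    intro i b z
    induction z using TensorProduct.induction_on with
    | zero => simp
    | add x y hx hy => simp only [map_add, hx, hy]
    | tmul y v => rw [LinearMap.rTensor_tmul, hc1, hc1, map_smul]
  have hce : ∀ z, toTop hc (fromTensor ρ lam z) = ∑ i, eps m n (c i z) • B i := by
    intro z
    conv_lhs => rw [hsum z]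
    simp only [map_sum, fromTensor_tmul, toTop_actA hc hAW]
  have hci : ∀ i, c i z = 0 := by
    intro i
    refine eq_zero_of_mem_stable (K := (LinearMap.ker (fromTensor ρ lam)).map (c i)) ?_ ?_
      (Submodule.mem_map_of_mem hz)
    · rintro b _ ⟨w, hw, rfl⟩
      rw [← hcd]
      refine Submodule.mem_map_of_mem ?_
      rw [LinearMap.mem_ker, del_fromTensor, LinearMap.mem_ker.1 hw]
      simp
    · rintro _ ⟨w, hw, rfl⟩
      have h1 := hce w
      rw [LinearMap.mem_ker.1 hw, map_zero] at h1
      exact Fintype.linearIndependent_iff.1 B.linearIndependent _ h1.symm i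
  rw [hsum z]
  simp [hci]

end

end

end WittSuper

theorem lemma3p8 (m n : ℕ) (hmn : (m, n) ≠ (0, 0))
    {M : Type u} [AddCommGroup M] [Module ℂ M] (ρ : WittSuper.ExtWittModule m n M)
    (hAW : ρ.IsAW) (hsimple : ρ.IsSimple) (hcusp : ρ.IsCuspidal) :
    ∃ (lam : Fin m → ℂ) (V : Type u) (_ : AddCommGroup V) (_ : Module ℂ V)
      (τ : WittSuper.GLModule m n V),
      FiniteDimensional ℂ V ∧ τ.IsSimple ∧
        ρ.IsIsomorphic (WittSuper.tensorModule lam τ) := by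
  obtain ⟨lam, hlam, h⟩ := WittSuper.exists_cosetSpace_eq_top hAW hsimple hcusp.1
  have hm := WittSuper.mM_ne_top hAW hlam h
  have hc := WittSuper.isCompl_topSpace hAW hsimple hm h
  have := WittSuper.finiteDimensional_fibre hAW hcusp h
  have := WittSuper.finiteDimensional_weightSpace hcusp lam
  have hfin : FiniteDimensional ℂ (WittSuper.topSpace ρ lam) :=
    Submodule.finiteDimensional_of_le (WittSuper.topSpace_le lam)
  have hk : ∀ (p : ZMod 2) (D : Module.End ℂ (WittSuper.A m n)), D ∈ WittSuper.superDer m n p →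
      (∀ a, D a ∈ WittSuper.mI m n * WittSuper.mI m n) →
      ∀ v : M, WittSuper.extW ρ D v ∈ WittSuper.mM ρ :=
    fun _ _ hD hDa v => WittSuper.sq_killed hAW hsimple hm h hD hDa v
  refine ⟨lam, WittSuper.topSpace ρ lam, inferInstance, inferInstance,
    WittSuper.fibreModule hc hk, hfin, WittSuper.fibreModule_isSimple hc hk hAW hsimple hm h, ?_⟩
  let e := LinearEquiv.ofBijective (WittSuper.fromTensor ρ lam)
    ⟨WittSuper.fromTensor_injective hc hAW,
      WittSuper.fromTensor_surjective hc hk hAW hsimple hm⟩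
  have he : ∀ z, e z = WittSuper.fromTensor ρ lam z := fun _ => rfl
  refine ⟨e.symm, fun p v hv => ?_, fun p D v => ?_, fun a v => ?_⟩
  · obtain ⟨z, rfl⟩ := e.surjective v
    rw [e.symm_apply_apply]
    -- Homogeneity is an eigenvalue condition for the parity operators, which the map intertwines,
    -- so it passes to the inverse.
    refine (WittSuper.mem_gr_iff
      (WittSuper.isInternal_grTensor (WittSuper.fibreModule hc hk).isInternal)).2 (e.injective ?_)
    rw [map_smul, he, he, WittSuper.fromTensor_parityOp, ← he,
      (WittSuper.mem_gr_iff ρ.isInternal).1 hv]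
  · obtain ⟨z, rfl⟩ := e.surjective v
    rw [e.symm_apply_apply, LinearEquiv.symm_apply_eq, he, he, ← WittSuper.extW_coe]
    exact (WittSuper.fromTensor_tensorW hc hk hAW hsimple hm D.2 z).symm
  · obtain ⟨z, rfl⟩ := e.surjective v
    rw [e.symm_apply_apply, LinearEquiv.symm_apply_eq, he, he]
    exact (WittSuper.fromTensor_tensorA hAW a z).symm
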